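/- Let $a\in\mathbb R$, $b>0$, $\alpha>0$. For $N\in\mathbb N$ consider fermionic modes $f_0,\dots,f_{N-1}$ with the fermionic XX Hamiltonian $H_N=\sum_{j,k}V_{j,k}f_j^\dagger f_k$, where $V\in\mathbb R^{N\times N}$ is the circulant matrix with $a$ on the main diagonal and $b$ on the first off-diagonals (periodic boundary conditions), and its Gibbs state $\rho=e^{-\beta H_N}/\operatorname{tr}(e^{-\beta H_N})$ at inverse temperature $\beta>0$. For $0<q<1$ let $A=\{0,\dots,\lceil qN\rceil-1\}$, $B=\{\lceil qN\rceil,\dots,N-1\}$, let $\rho_A,\rho_B$ be the reduced states, and let $$I_\alpha(A:B)=S_\alpha(\rho_A)+S_\alpha(\rho_B)-S_\alpha(\rho),\qquad S_\alpha(\sigma)=\frac{1}{1-\alpha}\log_2\operatorname{tr}(\sigma^\alpha)\ (\alpha\ne1),\quad S_1(\sigma)=-\operatorname{tr}(\sigma\log_2\sigma).$$ For every $\beta>0$ the limit $I_{\alpha,\infty}=I_{\alpha,\infty}(\beta)=\lim_{N\to\infty}I_\alpha(A:B)$ exists and does not depend on $q$, and it satisfies the following, where $\log$ is the natural logarithm.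 1. $$\lim_{\beta\to0^+}\frac{I_{\alpha,\infty}}{\beta^2}=\frac{\alpha b^2}{2\log 2}.$$ 2. If $|a|<2b$, then $$\limsup_{\beta\to\infty}\frac{I_{\alpha,\infty}}{\log\beta}\le\frac{2\alpha}{\pi^2\log(2)\,(\min\{1,\alpha\})^2}\,\min\left\{\frac{27}{2\min\{1,\alpha\}},\frac{4}{|1-\alpha|}\right\},$$ where $4/|1-\alpha|$ is read as $+\infty$ for $\alpha=1$. 3. If $|a|>2b$, then for every $\kappa<(|a|-2b)\cdot\min\{\alpha,1\}$, $$\lim_{\beta\to\infty}e^{\kappa\beta}\,I_{\alpha,\infty}=0.$$ -/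

import Mathlib

noncomputable section

namespace FermiXX

open scoped Matrix

/-! ### Fock space of `N` fermionic modes

The Fock space of the modes `0, …, N - 1` has the orthonormal occupation number basis `|S⟩`, where
`S ⊆ {0, …, N - 1}` is the set of occupied modes, and
`|{s₁ < ⋯ < s_m}⟩ = f_{s₁}† ⋯ f_{s_m}† |∅⟩`. Operators are complex matrices in this basis. -/

/-- Operators on the Fock space of `N` fermionic modes. -/
abbrev FockOp (N : ℕ) : Type := Matrix (Finset (Fin N)) (Finset (Fin N)) ℂ

/-- The annihilation operator `f_j`: it sends `|T⟩` to `(-1) ^ #{k ∈ T | k < j} |T \ {j}⟩` if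
`j ∈ T` and to `0` otherwise. The creation operator `f_j†` is its conjugate transpose. -/
def annihilation {N : ℕ} (j : Fin N) : FockOp N :=
  Matrix.of fun S T => if j ∈ T ∧ S = T.erase j then (-1 : ℂ) ^ (T.filter (· < j)).card else 0

/-- The Hamiltonian matrix of the fermionic XX model: the circulant `N × N` matrix with `a` on the
main diagonal and `b` on the first off-diagonals (periodic boundary conditions). -/
def couplingXX (a b : ℝ) (N : ℕ) : Matrix (Fin N) (Fin N) ℝ :=
  Matrix.of fun j k =>
    if j = k then a
    else if (j.val + 1) % N = k.val ∨ (k.val + 1) % N = j.val then b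
    else 0

/-- The quadratic Hamiltonian `H = ∑_{j,k} V_{j,k} f_j† f_k`. -/
def hamiltonian {N : ℕ} (V : Matrix (Fin N) (Fin N) ℝ) : FockOp N :=
  ∑ j, ∑ k, (V j k : ℂ) • ((annihilation j)ᴴ * annihilation k)

/-- The Gibbs state `exp (-β H) / tr (exp (-β H))` at inverse temperature `β`. -/
def gibbsState {N : ℕ} (β : ℝ) (H : FockOp N) : FockOp N :=
  (NormedSpace.exp (-(β : ℂ) • H)).trace⁻¹ • NormedSpace.exp (-(β : ℂ) • H)

/-- The sign with `f_S† f_U† |∅⟩ = reorderSign S U • |S ∪ U⟩` for disjoint `S` and `U`, where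
`f_S†` denotes the product of the `f_s†`, `s ∈ S`, in increasing order. -/
def reorderSign {N : ℕ} (S U : Finset (Fin N)) : ℂ :=
  (-1) ^ ((S ×ˢ U).filter fun p => p.2 < p.1).card

/-- The reduced state `ρ_A` of a set `A` of modes, obtained by tracing out the complement of `A`:
the matrix of the partial trace over the modes outside of `A` in the product basis
`f_S† f_U† |∅⟩`, `S ⊆ A`, `U ⊆ Aᶜ`. An element `O` of the algebra generated by the `f_j`, `f_j†`
with `j ∈ A` acts on the first factor only, so that `tr (ρ_A O) = tr (ρ O)`. -/
def reducedState {N : ℕ} (A : Finset (Fin N)) (ρ : FockOp N) :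
    Matrix {S : Finset (Fin N) // S ⊆ A} {S : Finset (Fin N) // S ⊆ A} ℂ :=
  Matrix.of fun S T =>
    ∑ U ∈ Aᶜ.powerset, reorderSign S.1 U * reorderSign T.1 U * ρ (S.1 ∪ U) (T.1 ∪ U)

/-! ### Entropies and mutual information -/

/-- The Rényi entropy `S_α(ρ) = (1 - α)⁻¹ log₂ tr (ρ ^ α)` of a density matrix `ρ`, and for `α = 1`
the von Neumann entropy `-tr (ρ log₂ ρ)`. Functions of `ρ` are taken in the functional calculus
of Hermitian matrices. -/
def renyiEntropy {n : Type*} [Fintype n] [DecidableEq n] (α : ℝ) (ρ : Matrix n n ℂ) : ℝ :=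
  if α = 1 then (cfc (fun x : ℝ => -(x * Real.logb 2 x)) ρ).trace.re
  else (1 - α)⁻¹ * Real.logb 2 (cfc (fun x : ℝ => x ^ α) ρ).trace.re

/-- The mutual (Rényi) information `I_α(A:B) = S_α(ρ_A) + S_α(ρ_B) - S_α(ρ)`, where `B` is the
complement of `A`. -/
def mutualInformation {N : ℕ} (α : ℝ) (A : Finset (Fin N)) (ρ : FockOp N) : ℝ :=
  renyiEntropy α (reducedState A ρ) + renyiEntropy α (reducedState Aᶜ ρ) - renyiEntropy α ρ

/-- The block `A = {0, 1, …, ⌈q N⌉ - 1}`. -/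
def block (q : ℝ) (N : ℕ) : Finset (Fin N) :=
  Finset.univ.filter fun i => i.val < ⌈q * N⌉₊

/-- The mutual information `I_α(A:B)` of the thermal state of the fermionic XX model on `N` sites
at inverse temperature `β`, with `A = {0, …, ⌈q N⌉ - 1}` and `B = {⌈q N⌉, …, N - 1}`. -/
def mutualInformationXX (a b α β q : ℝ) (N : ℕ) : ℝ :=
  mutualInformation α (block q N) (gibbsState β (hamiltonian (couplingXX a b N)))

/-- The constant
`2 α / (π² log 2 · min{1,α}²) · min {27 / (2 min{1,α}), 4 / |1 - α|}`, in which
`4 / |1 - α|` is infinite for `α = 1`. -/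
def lowTemperatureConstant (α : ℝ) : ℝ :=
  2 * α / (Real.pi ^ 2 * Real.log 2 * (min 1 α) ^ 2) *
    (if α = 1 then 27 / (2 * min 1 α) else min (27 / (2 * min 1 α)) (4 / |1 - α|))

end FermiXX

end

/-!
The Gibbs state of a quadratic Hamiltonian with coupling matrix `V` is Gaussian with correlation
matrix `Γ = φ(V)`, where `φ(x) = 1 / (1 + exp (β x))` is the Fermi function, and its reduced states
are the Gaussian states of the blocks `Γ_A`, `Γ_B` (`partialTrace_exp_quadHam`). The entropy of a
Gaussian state is a sum over its modes. With the entropy `g` of a single mode, the mutual information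
therefore equals `tr g(Γ_A) + tr g(Γ_B) - tr g(Γ)` up to the factor `1 / log 2`: the defect of `g`
with respect to the block decomposition (`mutualInformation_gibbsState`).

The coupling matrix is circulant and its blocks are Toeplitz matrices. If `φ` and `g` are polynomials,
the block defect can be computed by counting closed paths, where a path contributes its height. By
Spitzer's identity (`maxSum_eq`) the result is, for all large `N`, a quadratic form in the Fourier
coefficients of the powers of the symbol. This form is also a sum `∑_{k,l} |⟨k|P_A|l⟩|² K(v_k, v_l)`
over pairs of eigenvectors of `V` (`pairSum`) with an explicit kernel `K = widomKernel (-g'')`, a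
discrete form of Widom's second order trace formula. The Berezin–Lieb–Peierls inequality bounds the
block defect by the second derivative of `g` and the off-diagonal blocks of `Γ`
(`abs_blockDefect_le`), and commutator estimates control the dependence on `φ`
(`SymbolClose.abs_blockDefect_pow_sub_le`). Both bounds are uniform in `N`, because the off-diagonal
blocks of a Lipschitz function of `V` have bounded Frobenius norm, hence the block defect and the
pair sum have the same limit for all `φ` in `C¹` and `g` in `C²` (`exists_bothTendTo`), which does
not depend on the ratio `q`.

The three asymptotic statements follow from estimates for the kernel.

* As `β → 0` one has `φ(x) ≈ 1 / 2 - β x / 4` and `-g''(1 / 2) = 4 α`, so that the kernel is close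
  to `α β² (x - y)² / 8`, and the pair sum of `(x - y)²` is `4 b²`.
* The kernel is bounded by the squared increments of two functions of `φ(x)`, with a constant that
  depends on `α`: powers of `φ` and `1 - φ` if `α < 2`, and `φ` and the escort distribution
  `φ ^ α / (φ ^ α + (1 - φ) ^ α)` if `2 ≤ α` (`widomKernel_le_rpow`, `widomKernel_le_escort`). These
  functions are monotone with total variation at most `1` and Lipschitz constant of order `β`. The
  limit of the pair sum of a squared increment is an `H^{1/2}` norm, which exceeds the total
  variation by a logarithm of the Lipschitz constant only (`eventually_pairSum_sq_le_log`). This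
  gives the bound by a multiple of `log β`.
* If `0` is not in the band `[a - 2 b, a + 2 b]`, the same functions have exponentially small
  derivatives on the band.
-/

noncomputable section

namespace FermiXX

open scoped Matrix

/-! ### Canonical anticommutation relations -/

section CAR

variable {ι : Type*} [LinearOrder ι]

/-- The Jordan–Wigner sign `(-1) ^ #{s ∈ S | s < j}`. -/
def modeSign (j : ι) (S : Finset ι) : ℂ := (-1) ^ (S.filter (· < j)).card

/-- The creation operator `f_j†` on the Fock space of modes indexed by a linear order `ι`. -/
def create (j : ι) : Matrix (Finset ι) (Finset ι) ℂ :=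
  Matrix.of fun S T => if j ∉ T ∧ S = insert j T then modeSign j T else 0

/-- The annihilation operator `f_j`, for modes indexed by a linear order `ι`. -/
def annih (j : ι) : Matrix (Finset ι) (Finset ι) ℂ := (create j)ᴴ

theorem modeSign_mul_self (j : ι) (S : Finset ι) : modeSign j S * modeSign j S = 1 := by
  unfold modeSign
  rw [← mul_pow]; simp

theorem star_modeSign (j : ι) (S : Finset ι) : star (modeSign j S) = modeSign j S := by
  simp [modeSign]

theorem modeSign_insert_of_le {i j : ι} (h : j ≤ i) (S : Finset ι) :
    modeSign j (insert i S) = modeSign j S := by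
  unfold modeSign
  rw [Finset.filter_insert, if_neg (not_lt.2 h)]

theorem modeSign_insert_of_lt {i j : ι} (h : i < j) {S : Finset ι} (hi : i ∉ S) :
    modeSign j (insert i S) = -modeSign j S := by
  unfold modeSign
  rw [Finset.filter_insert, if_pos h, Finset.card_insert_of_notMem (by simp [hi]), pow_succ]
  ring

theorem create_apply (j : ι) (S T : Finset ι) :
    create j S T = if j ∉ T ∧ S = insert j T then modeSign j T else 0 := rfl

theorem annih_apply (j : ι) (S T : Finset ι) :
    annih j S T = if j ∉ S ∧ T = insert j S then modeSign j S else 0 := by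
  rw [annih, Matrix.conjTranspose_apply, create_apply]
  split_ifs <;> simp [star_modeSign]

theorem annihilation_eq_annih {N : ℕ} (j : Fin N) : annihilation j = annih j := by
  ext S T
  rw [annih_apply]
  simp only [annihilation, Matrix.of_apply]
  by_cases h : j ∉ S ∧ T = insert j S
  · rw [if_pos h, if_pos, h.2]
    · exact modeSign_insert_of_le le_rfl S
    · rw [h.2]
      simp [h.1]
  · rw [if_neg h, if_neg]
    rintro ⟨h1, rfl⟩
    exact h ⟨Finset.notMem_erase j T, (Finset.insert_erase h1).symm⟩

variable [Fintype ι]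

theorem create_mul_apply (j : ι) {m : Type*} (X : Matrix (Finset ι) m ℂ) (S : Finset ι) (T : m) :
    (create j * X) S T = if j ∈ S then modeSign j (S.erase j) * X (S.erase j) T else 0 := by
  rw [Matrix.mul_apply]
  split_ifs with h
  · rw [Finset.sum_eq_single (S.erase j)]
    · rw [create_apply, if_pos ⟨Finset.notMem_erase j S, (Finset.insert_erase h).symm⟩]
    · intro R _ hR
      rw [create_apply, if_neg, zero_mul]
      rintro ⟨h1, rfl⟩
      exact hR (Finset.erase_insert h1).symm
    · simp
  · refine Finset.sum_eq_zero fun R _ => ?_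
    rw [create_apply, if_neg, zero_mul]
    rintro ⟨h1, rfl⟩
    exact h (Finset.mem_insert_self j R)

theorem mul_create_apply (j : ι) {m : Type*} (X : Matrix m (Finset ι) ℂ) (S : m) (T : Finset ι) :
    (X * create j) S T = if j ∈ T then 0 else X S (insert j T) * modeSign j T := by
  rw [Matrix.mul_apply]
  split_ifs with h
  · exact Finset.sum_eq_zero fun R _ => by rw [create_apply, if_neg (fun h' => h'.1 h), mul_zero]
  · rw [Finset.sum_eq_single (insert j T)]
    · rw [create_apply, if_pos ⟨h, rfl⟩]
    · intro R _ hR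
      rw [create_apply, if_neg (fun h' => hR h'.2), mul_zero]
    · simp

theorem annih_mul_apply (j : ι) {m : Type*} (X : Matrix (Finset ι) m ℂ) (S : Finset ι) (T : m) :
    (annih j * X) S T = if j ∈ S then 0 else modeSign j S * X (insert j S) T := by
  rw [Matrix.mul_apply]
  split_ifs with h
  · exact Finset.sum_eq_zero fun R _ => by rw [annih_apply, if_neg (fun h' => h'.1 h), zero_mul]
  · rw [Finset.sum_eq_single (insert j S)]
    · rw [annih_apply, if_pos ⟨h, rfl⟩]
    · intro R _ hR
      rw [annih_apply, if_neg (fun h' => hR h'.2), zero_mul]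
    · simp

theorem create_mul_create_eq_neg (i j : ι) : create i * create j = -(create j * create i) := by
  ext S T
  rw [Matrix.neg_apply, ← Matrix.mul_one (create i * create j),
    ← Matrix.mul_one (create j * create i), Matrix.mul_assoc, Matrix.mul_assoc]
  simp only [create_mul_apply]
  rcases eq_or_ne i j with rfl | hij
  · simp
  by_cases hi : i ∈ S
  swap
  · simp [hi]
  by_cases hj : j ∈ S
  swap
  · simp [hj]
  simp only [hi, hj, if_true, Finset.mem_erase, ne_eq, hij, hij.symm, not_false_eq_true, and_self,
    Finset.erase_right_comm (a := j) (b := i)]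
  obtain ⟨R, hiR, hjR, hR⟩ : ∃ R, i ∉ R ∧ j ∉ R ∧ S = insert i (insert j R) := by
    refine ⟨(S.erase i).erase j, by simp, by simp, ?_⟩
    rw [Finset.insert_erase (by simp [hj, hij.symm]), Finset.insert_erase hi]
  have e1 : S.erase i = insert j R := by
    rw [hR, Finset.erase_insert (by simp [hij, hiR])]
  have e2 : S.erase j = insert i R := by
    rw [hR, Finset.insert_comm, Finset.erase_insert (by simp [hij.symm, hjR])]
  rw [e1, e2, Finset.erase_insert hjR, Finset.erase_insert hiR]
  rcases lt_or_gt_of_ne hij with h | h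
  · rw [modeSign_insert_of_le h.le, modeSign_insert_of_lt h hiR]
    ring
  · rw [modeSign_insert_of_le h.le, modeSign_insert_of_lt h hjR]
    ring

theorem annih_mul_create_add (i j : ι) :
    annih i * create j + create j * annih i = if i = j then 1 else 0 := by
  ext S T
  rw [Matrix.add_apply, ← Matrix.mul_one (annih i * create j),
    ← Matrix.mul_one (create j * annih i), Matrix.mul_assoc, Matrix.mul_assoc]
  simp only [create_mul_apply, annih_mul_apply]
  rcases eq_or_ne i j with rfl | hij
  · by_cases hi : i ∈ S
    · simp only [hi, if_true, Finset.notMem_erase, if_false, zero_add]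
      rw [← mul_assoc, modeSign_mul_self, one_mul, Finset.insert_erase hi]
    · simp only [hi, if_true, Finset.mem_insert_self, if_false, add_zero]
      rw [Finset.erase_insert hi, ← mul_assoc, modeSign_mul_self, one_mul]
  · rw [if_neg hij, Matrix.zero_apply]
    by_cases hj : j ∈ S
    swap
    · simp [hj, hij.symm]
    by_cases hi : i ∈ S
    · simp [hi, hij]
    have e1 : (insert i S).erase j = insert i (S.erase j) := by
      rw [Finset.erase_insert_of_ne hij]
    simp only [hi, hj, if_true, Finset.mem_insert, or_true,
      Finset.mem_erase, and_false, if_false]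
    rw [e1]
    have hS : insert j (S.erase j) = S := Finset.insert_erase hj
    have hi' : i ∉ S.erase j := by simp [hi]
    rcases lt_or_gt_of_ne hij with h | h
    · rw [modeSign_insert_of_lt h hi']
      have : modeSign i S = modeSign i (S.erase j) := by
        rw [← modeSign_insert_of_le h.le (S.erase j), hS]
      rw [this]; ring
    · rw [modeSign_insert_of_le h.le]
      have : modeSign i S = -modeSign i (S.erase j) := by
        rw [← modeSign_insert_of_lt h (Finset.notMem_erase j S), hS]
      rw [this]; ring

end CAR

/-! ### Quadratic Hamiltonians -/

section Quadratic

variable {ι : Type*} [LinearOrder ι] [Fintype ι]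

/-- The quadratic Hamiltonian `∑_{j,k} X_{j,k} f_j† f_k`. -/
def quadHam (X : Matrix ι ι ℝ) : Matrix (Finset ι) (Finset ι) ℂ :=
  ∑ j, ∑ k, (X j k : ℂ) • (create j * annih k)

theorem hamiltonian_eq_quadHam {N : ℕ} (V : Matrix (Fin N) (Fin N) ℝ) :
    hamiltonian V = quadHam V := by
  unfold hamiltonian quadHam
  simp only [annihilation_eq_annih]
  simp only [annih, Matrix.conjTranspose_conjTranspose]

theorem quadHam_smul (c : ℝ) (X : Matrix ι ι ℝ) : quadHam (c • X) = (c : ℂ) • quadHam X := by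
  simp only [quadHam, Finset.smul_sum, smul_smul, Matrix.smul_apply, smul_eq_mul, Complex.ofReal_mul]

theorem quadHam_mul_create (X : Matrix ι ι ℝ) (l : ι) :
    quadHam X * create l = create l * quadHam X + ∑ j, (X j l : ℂ) • create j := by
  have key : ∀ j k, create j * annih k * create l
      = create l * (create j * annih k) + if k = l then create j else 0 := by
    intro j k
    have h1 := annih_mul_create_add k l
    have h2 := create_mul_create_eq_neg j l
    rw [Matrix.mul_assoc, eq_sub_of_add_eq h1, Matrix.mul_sub, ← Matrix.mul_assoc (create j), h2,
      Matrix.neg_mul, Matrix.mul_assoc]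
    split_ifs <;> simp [add_comm]
  simp only [quadHam, Finset.sum_mul, Finset.mul_sum, Matrix.smul_mul, Matrix.mul_smul, key,
    smul_add, Finset.sum_add_distrib]
  congr 1
  refine Finset.sum_congr rfl fun j _ => ?_
  simp

theorem quadHam_isHermitian {X : Matrix ι ι ℝ} (hX : X.IsHermitian) : (quadHam X).IsHermitian := by
  unfold Matrix.IsHermitian quadHam
  simp only [Matrix.conjTranspose_sum, Matrix.conjTranspose_smul, Matrix.conjTranspose_mul, annih,
    Matrix.conjTranspose_conjTranspose]
  rw [Finset.sum_comm]
  refine Finset.sum_congr rfl fun j _ => Finset.sum_congr rfl fun k _ => ?_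
  congr 1
  have := hX.apply j k
  simp at this
  simp [this]

/-- An operator that does not change the number of fermions. -/
def NumberConserving (X : Matrix (Finset ι) (Finset ι) ℂ) : Prop :=
  ∀ S T, S.card ≠ T.card → X S T = 0

/-- The number operator. -/
def numberOp (ι : Type*) [LinearOrder ι] : Matrix (Finset ι) (Finset ι) ℂ :=
  Matrix.diagonal fun S => (S.card : ℂ)

theorem numberConserving_iff_commute (X : Matrix (Finset ι) (Finset ι) ℂ) :
    NumberConserving X ↔ Commute (numberOp ι) X := by
  unfold NumberConserving Commute SemiconjBy numberOp
  rw [← Matrix.ext_iff]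
  refine forall₂_congr fun S T => ?_
  rw [Matrix.diagonal_mul, Matrix.mul_diagonal, mul_comm, mul_eq_mul_left_iff]
  rw [Nat.cast_inj]
  tauto

theorem numberConserving_quadHam (X : Matrix ι ι ℝ) : NumberConserving (quadHam X) := by
  intro S T hST
  simp only [quadHam, Matrix.sum_apply, Matrix.smul_apply]
  refine Finset.sum_eq_zero fun j _ => Finset.sum_eq_zero fun k _ => ?_
  rw [create_mul_apply]
  split_ifs with h
  · rw [annih_apply, if_neg, mul_zero, smul_zero]
    rintro ⟨h1, rfl⟩
    rw [Finset.card_insert_of_notMem h1, Finset.card_erase_of_mem h] at hST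
    exact hST (Nat.sub_add_cancel (Finset.card_pos.2 ⟨j, h⟩)).symm
  · simp

open NormedSpace

theorem NumberConserving.exp {X : Matrix (Finset ι) (Finset ι) ℂ} (hX : NumberConserving X) :
    NumberConserving (NormedSpace.exp X) := by
  rw [numberConserving_iff_commute] at hX ⊢
  open scoped Matrix.Norms.Operator in
  exact hX.exp_right

/-- The creation operator `∑_k O_{k,i} f_k†` of the mode in column `i` of `O`. -/
def modeCreate (O : Matrix ι ι ℝ) (i : ι) : Matrix (Finset ι) (Finset ι) ℂ :=
  ∑ k, (O k i : ℂ) • create k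

theorem quadHam_mul_modeCreate {X O : Matrix ι ι ℝ} {x : ι → ℝ}
    (h : X * O = O * Matrix.diagonal x) (i : ι) :
    quadHam X * modeCreate O i = modeCreate O i * (quadHam X + (x i : ℂ) • 1) := by
  have h' : ∀ j, ∑ k, X j k * O k i = O j i * x i := by
    intro j
    have := congrFun (congrFun h j) i
    rwa [Matrix.mul_apply, Matrix.mul_diagonal] at this
  simp only [modeCreate, Finset.mul_sum, Matrix.mul_smul, quadHam_mul_create, smul_add,
    Finset.sum_add_distrib, Matrix.mul_add, Finset.sum_mul, Matrix.smul_mul]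
  congr 1
  simp only [Finset.smul_sum, smul_smul, Matrix.mul_one]
  rw [Finset.sum_comm]
  refine Finset.sum_congr rfl fun j _ => ?_
  rw [← Finset.sum_smul]
  congr 1
  have := h' j
  rw [mul_comm (x i : ℂ), ← Complex.ofReal_mul, ← this]
  push_cast
  exact Finset.sum_congr rfl fun k _ => mul_comm _ _

theorem semiconjBy_exp {n : Type*} [Fintype n] [DecidableEq n] {F A B : Matrix n n ℂ}
    (h : SemiconjBy F A B) : SemiconjBy F (NormedSpace.exp A) (NormedSpace.exp B) := by
  open scoped Matrix.Norms.Operator in exact SemiconjBy.exp_right (x := F) (a := A) (b := B) h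

/-- Creating an eigenmode of `X` shifts `quadHam X` by the eigenvalue. -/
theorem exp_quadHam_mul_modeCreate {X O : Matrix ι ι ℝ} {x : ι → ℝ}
    (h : X * O = O * Matrix.diagonal x) (i : ι) :
    NormedSpace.exp (quadHam X) * modeCreate O i
      = (Real.exp (x i) : ℂ) • (modeCreate O i * NormedSpace.exp (quadHam X)) := by
  have h1 : SemiconjBy (modeCreate O i) (quadHam X + (x i : ℂ) • 1) (quadHam X) :=
    (quadHam_mul_modeCreate h i).symm
  have h2 := semiconjBy_exp h1
  have h3 : Commute (quadHam X) ((x i : ℂ) • (1 : Matrix (Finset ι) (Finset ι) ℂ)) :=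
    (Commute.one_right _).smul_right _
  rw [Matrix.exp_add_of_commute _ _ h3, Matrix.smul_one_eq_diagonal, Matrix.exp_diagonal] at h2
  have h4 : (NormedSpace.exp fun _ : Finset ι => (x i : ℂ)) = fun _ => (Real.exp (x i) : ℂ) := by
    funext S
    rw [Pi.coe_exp, Complex.ofReal_exp, Complex.exp_eq_exp_ℂ]
  rw [h4, ← Matrix.smul_one_eq_diagonal] at h2
  refine h2.eq.symm.trans ?_
  simp

end Quadratic

/-! ### Entropies of Gaussian states -/

section GaussianTrace

variable {ι : Type*} [LinearOrder ι] [Fintype ι]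

theorem create_eq_sum_modeCreate {O : Matrix ι ι ℝ} (hO : O * Oᵀ = 1) (j : ι) :
    create j = ∑ i, (O j i : ℂ) • modeCreate O i := by
  simp only [modeCreate, Finset.smul_sum, smul_smul]
  rw [Finset.sum_comm]
  have h : ∀ k, ∑ i, (O j i : ℂ) * (O k i : ℂ) = if j = k then 1 else 0 := by
    intro k
    have := congrFun (congrFun hO j) k
    rw [Matrix.mul_apply, Matrix.one_apply] at this
    simp only [Matrix.transpose_apply] at this
    rw [← Complex.ofReal_one, ← Complex.ofReal_zero, ← apply_ite Complex.ofReal, ← this]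
    push_cast; rfl
  simp only [← Finset.sum_smul, h]
  simp

theorem conjTranspose_modeCreate (O : Matrix ι ι ℝ) (i : ι) :
    (modeCreate O i)ᴴ = ∑ k, (O k i : ℂ) • annih k := by
  simp [modeCreate, Matrix.conjTranspose_sum, Matrix.conjTranspose_smul, annih]

theorem modeAnnih_mul_modeCreate_add {O : Matrix ι ι ℝ} (hO : Oᵀ * O = 1) (i : ι) :
    (modeCreate O i)ᴴ * modeCreate O i + modeCreate O i * (modeCreate O i)ᴴ = 1 := by
  rw [conjTranspose_modeCreate]
  simp only [modeCreate, Finset.sum_mul, Finset.mul_sum, Matrix.smul_mul, Matrix.mul_smul,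
    smul_smul]
  rw [Finset.sum_comm, ← Finset.sum_add_distrib]
  have h1 : ∀ k l, ((O k i : ℂ) * (O l i : ℂ)) • (annih l * create k)
      + ((O l i : ℂ) * (O k i : ℂ)) • (create k * annih l)
      = if l = k then ((O k i * O k i : ℝ) : ℂ) • (1 : Matrix (Finset ι) (Finset ι) ℂ) else 0 := by
    intro k l
    rw [mul_comm (O l i : ℂ), ← smul_add, annih_mul_create_add]
    split_ifs with h
    · rw [h]; push_cast; rfl
    · simp
  have h2 : ∀ x, ((∑ i_1, ((O i_1 i : ℂ) * (O x i : ℂ)) • (annih x * create i_1))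
      + ∑ i_1, ((O x i : ℂ) * (O i_1 i : ℂ)) • (create i_1 * annih x))
      = ((O x i * O x i : ℝ) : ℂ) • (1 : Matrix (Finset ι) (Finset ι) ℂ) := by
    intro x
    rw [← Finset.sum_add_distrib]
    simp only [h1]
    simp
  have h3 : (∑ x, (O x i * O x i : ℝ)) = 1 := by
    have := congrFun (congrFun hO i) i
    rw [Matrix.mul_apply] at this
    simpa using this
  calc _ = ∑ x, ((O x i * O x i : ℝ) : ℂ) • (1 : Matrix (Finset ι) (Finset ι) ℂ) := by
        exact Finset.sum_congr rfl fun x _ => h2 x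
    _ = 1 := by
        rw [← Finset.sum_smul, ← Complex.ofReal_sum, h3]; simp

theorem quadHam_eq_sum_modes {X O : Matrix ι ι ℝ} {x : ι → ℝ} (hO : O * Oᵀ = 1)
    (h : X * O = O * Matrix.diagonal x) :
    quadHam X = ∑ i, (x i : ℂ) • (modeCreate O i * (modeCreate O i)ᴴ) := by
  have hX : X = O * Matrix.diagonal x * Oᵀ := by
    rw [← h, Matrix.mul_assoc, hO, Matrix.mul_one]
  simp only [conjTranspose_modeCreate]
  simp only [modeCreate, Finset.sum_mul, Finset.mul_sum, Matrix.smul_mul, Matrix.mul_smul,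
    smul_smul, Finset.smul_sum]
  unfold quadHam
  rw [Finset.sum_comm]
  conv_rhs => rw [Finset.sum_comm]
  refine Finset.sum_congr rfl fun k _ => ?_
  conv_rhs => rw [Finset.sum_comm]
  refine Finset.sum_congr rfl fun j _ => ?_
  rw [← Finset.sum_smul]
  congr 1
  rw [hX, Matrix.mul_apply]
  simp only [Matrix.mul_diagonal, Matrix.transpose_apply]
  push_cast
  exact Finset.sum_congr rfl fun i _ => by ring

/-- The occupation of an eigenmode in a Gaussian state is given by the Fermi function. -/
theorem trace_modeNumber_mul_exp {X O : Matrix ι ι ℝ} {x : ι → ℝ} (hO : Oᵀ * O = 1)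
    (h : X * O = O * Matrix.diagonal x) (i : ι) :
    (modeCreate O i * (modeCreate O i)ᴴ * NormedSpace.exp (quadHam X)).trace
      = ((Real.exp (x i) / (1 + Real.exp (x i)) : ℝ) : ℂ)
        * (NormedSpace.exp (quadHam X)).trace := by
  set F := modeCreate O i
  set E := NormedSpace.exp (quadHam X)
  have h1 : (F * Fᴴ * E).trace = (Real.exp (x i) : ℂ) * (Fᴴ * F * E).trace := by
    rw [Matrix.mul_assoc, Matrix.trace_mul_comm, Matrix.mul_assoc,
      exp_quadHam_mul_modeCreate h i, Matrix.mul_smul, Matrix.trace_smul, smul_eq_mul,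
      Matrix.mul_assoc]
  have h2 : (Fᴴ * F * E).trace = E.trace - (F * Fᴴ * E).trace := by
    rw [eq_sub_of_add_eq (modeAnnih_mul_modeCreate_add hO i), Matrix.sub_mul, Matrix.one_mul,
      Matrix.trace_sub]
  rw [h2] at h1
  have hpos : ((1 + Real.exp (x i) : ℝ) : ℂ) ≠ 0 := by
    rw [Complex.ofReal_ne_zero]; positivity
  rw [Complex.ofReal_div, div_mul_eq_mul_div, eq_div_iff hpos, Complex.ofReal_add,
    Complex.ofReal_one]
  linear_combination h1

theorem trace_quadHam_mul_exp {X O : Matrix ι ι ℝ} {x : ι → ℝ} (hO : Oᵀ * O = 1)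
    (h : X * O = O * Matrix.diagonal x) :
    (quadHam X * NormedSpace.exp (quadHam X)).trace
      = ((∑ i, x i * (Real.exp (x i) / (1 + Real.exp (x i))) : ℝ) : ℂ)
        * (NormedSpace.exp (quadHam X)).trace := by
  have hO' : O * Oᵀ = 1 := mul_eq_one_comm.1 hO
  conv_lhs => rw [quadHam_eq_sum_modes hO' h, ← quadHam_eq_sum_modes hO' h]
  conv_lhs => enter [1, 1]; rw [quadHam_eq_sum_modes hO' h]
  rw [Finset.sum_mul, Matrix.trace_sum, Complex.ofReal_sum, Finset.sum_mul]
  refine Finset.sum_congr rfl fun i _ => ?_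
  rw [Matrix.smul_mul, Matrix.trace_smul, trace_modeNumber_mul_exp hO h, smul_eq_mul,
    Complex.ofReal_mul, mul_assoc]

open scoped Matrix.Norms.Operator in
theorem hasDerivAt_trace_exp_smul {n : Type*} [Fintype n] [DecidableEq n] (H : Matrix n n ℂ)
    (t : ℝ) :
    HasDerivAt (fun t : ℝ => (NormedSpace.exp ((t : ℂ) • H)).trace)
      ((H * NormedSpace.exp ((t : ℂ) • H)).trace) t := by
  have h1 : HasDerivAt (fun u : ℝ => NormedSpace.exp (u • H)) (H * NormedSpace.exp (t • H)) t :=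
    hasDerivAt_exp_smul_const' H t
  have h2 := (LinearMap.toContinuousLinearMap (Matrix.traceLinearMap n ℝ ℂ)).hasFDerivAt.comp_hasDerivAt
    t h1
  simp only [← Complex.coe_smul] at h2
  exact h2

/-- The partition function of a quadratic Hamiltonian factorizes over the modes. Both sides satisfy the
same linear differential equation along `t ↦ t • X`. -/
theorem trace_exp_quadHam {X O : Matrix ι ι ℝ} {x : ι → ℝ} (hO : Oᵀ * O = 1)
    (h : X * O = O * Matrix.diagonal x) :
    (NormedSpace.exp (quadHam X)).trace = (Real.exp (∑ i, Real.log (1 + Real.exp (x i))) : ℝ) := by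
  set L : ℝ → ℝ := fun t => ∑ i, Real.log (1 + Real.exp (t * x i)) with hL
  set Z : ℝ → ℂ := fun t => (NormedSpace.exp ((t : ℂ) • quadHam X)).trace with hZ
  have hLd : ∀ t, HasDerivAt L (∑ i, x i * (Real.exp (t * x i) / (1 + Real.exp (t * x i)))) t := by
    intro t
    refine HasDerivAt.fun_sum fun i _ => ?_
    have h1 : HasDerivAt (fun t : ℝ => 1 + Real.exp (t * x i)) (Real.exp (t * x i) * (1 * x i)) t :=
      (((hasDerivAt_id t).mul_const (x i)).exp).const_add 1
    have h2 := h1.log (by positivity)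
    refine h2.congr_deriv ?_
    rw [one_mul, mul_comm (Real.exp _), mul_div_assoc]
  have hZd : ∀ t : ℝ, HasDerivAt Z
      (((∑ i, x i * (Real.exp (t * x i) / (1 + Real.exp (t * x i))) : ℝ) : ℂ) * Z t) t := by
    intro t
    rcases eq_or_ne t 0 with rfl | ht
    · have h1 := hasDerivAt_trace_exp_smul (quadHam X) 0
      convert h1 using 1
      simp only [hZ, Complex.ofReal_zero, zero_smul, NormedSpace.exp_zero, Matrix.mul_one, zero_mul,
        Real.exp_zero]
      have hO' : O * Oᵀ = 1 := mul_eq_one_comm.1 hO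
      rw [quadHam_eq_sum_modes hO' h, Matrix.trace_sum, Complex.ofReal_sum, Finset.sum_mul]
      refine Finset.sum_congr rfl fun i _ => ?_
      have h0 : (0 : Matrix ι ι ℝ) * O = O * Matrix.diagonal (fun _ => 0) := by simp
      have h2 := trace_modeNumber_mul_exp hO h0 i
      have h3 : quadHam (0 : Matrix ι ι ℝ) = 0 := by simp [quadHam]
      rw [h3, NormedSpace.exp_zero, Matrix.mul_one, Real.exp_zero] at h2
      rw [Matrix.trace_smul, h2, smul_eq_mul, Complex.ofReal_mul, mul_assoc]
    · have h1 := hasDerivAt_trace_exp_smul (quadHam X) t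
      convert h1 using 1
      have ht' : (t • X) * O = O * Matrix.diagonal (fun i => t * x i) := by
        rw [Matrix.smul_mul, h, ← Matrix.mul_smul]
        congr 1
        ext i j
        simp [Matrix.diagonal_apply]
      have h2 := trace_quadHam_mul_exp hO ht'
      rw [quadHam_smul, Matrix.smul_mul, Matrix.trace_smul, smul_eq_mul] at h2
      have ht0 : (t : ℂ) ≠ 0 := Complex.ofReal_ne_zero.2 ht
      apply mul_left_cancel₀ ht0
      rw [h2, ← mul_assoc, ← Complex.ofReal_mul, Finset.mul_sum]
      congr 2
      exact Finset.sum_congr rfl fun i _ => (mul_assoc _ _ _).symm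
  have hW : ∀ t : ℝ, HasDerivAt (fun t => Z t * (Real.exp (-L t) : ℂ)) 0 t := by
    intro t
    have h1 := ((hLd t).neg.exp).ofReal_comp
    have h2 := (hZd t).mul h1
    refine h2.congr_deriv ?_
    push_cast
    ring
  have hconst := is_const_of_deriv_eq_zero (fun t => (hW t).differentiableAt)
    (fun t => (hW t).deriv) 1 0
  simp only [hZ, hL, Complex.ofReal_one, one_smul, one_mul, Complex.ofReal_zero, zero_smul,
    zero_mul, NormedSpace.exp_zero, Real.exp_zero] at hconst
  have h0 : (1 : Matrix (Finset ι) (Finset ι) ℂ).trace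
      * (Real.exp (-∑ _i : ι, Real.log (1 + 1)) : ℂ) = 1 := by
    rw [Matrix.trace_one, Fintype.card_finset, Finset.sum_const, nsmul_eq_mul, Real.exp_neg,
      mul_comm (_ : ℝ), Finset.card_univ]
    have : Real.exp (Real.log (1 + 1) * (Fintype.card ι : ℝ)) = 2 ^ Fintype.card ι := by
      rw [Real.exp_mul, Real.exp_log (by norm_num), Real.rpow_natCast]; norm_num
    rw [this]
    push_cast
    exact mul_inv_cancel₀ (pow_ne_zero _ two_ne_zero)
  rw [h0, Real.exp_neg, Complex.ofReal_inv] at hconst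
  exact (mul_inv_eq_one₀ (Complex.ofReal_ne_zero.2 (Real.exp_pos _).ne')).1 hconst

end GaussianTrace

section Gibbs

variable {n : Type*} [Fintype n] [DecidableEq n]

theorem continuousOn_spectrum (A : Matrix n n ℂ) (f : ℝ → ℝ) :
    ContinuousOn f (spectrum ℝ A) := Matrix.finite_real_spectrum.continuousOn f

theorem exp_eq_cfc {H : Matrix n n ℂ} (hH : H.IsHermitian) :
    NormedSpace.exp H = cfc Real.exp H := by
  open scoped Matrix.Norms.L2Operator in
  exact (CFC.real_exp_eq_normedSpace_exp hH.isSelfAdjoint).symm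

theorem cfc_gibbs {H : Matrix n n ℂ} (hH : H.IsHermitian) (c : ℝ) (f : ℝ → ℝ) :
    cfc f ((c : ℂ) • NormedSpace.exp H) = cfc (fun x => f (c * Real.exp x)) H := by
  have hs : IsSelfAdjoint H := hH.isSelfAdjoint
  rw [exp_eq_cfc hH, Complex.coe_smul, ← cfc_smul c Real.exp H (continuousOn_spectrum _ _),
    ← cfc_comp' f (fun x => c • Real.exp x) H
      ((Matrix.finite_real_spectrum.image _).continuousOn f) (continuousOn_spectrum _ _)]
  rfl

/-- The Rényi entropy of a Gibbs state in terms of the partition functions at `1` and `α`. -/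
theorem renyiEntropy_gibbs {H : Matrix n n ℂ} (hH : H.IsHermitian) {Z : ℝ} (hZ : 0 < Z) {α : ℝ}
    (hα : α ≠ 1) {Zα : ℝ} (hZα' : 0 < Zα) (hZα : (NormedSpace.exp ((α : ℂ) • H)).trace = Zα) :
    renyiEntropy α (((Z⁻¹ : ℝ) : ℂ) • NormedSpace.exp H)
      = (1 - α)⁻¹ * (Real.log Zα - α * Real.log Z) / Real.log 2 := by
  have hs : IsSelfAdjoint H := hH.isSelfAdjoint
  have h1 : cfc (fun x : ℝ => x ^ α) (((Z⁻¹ : ℝ) : ℂ) • NormedSpace.exp H)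
      = ((Z ^ (-α) : ℝ) : ℂ) • NormedSpace.exp ((α : ℂ) • H) := by
    have hαH : ((α : ℂ) • H).IsHermitian := by
      unfold Matrix.IsHermitian
      rw [Matrix.conjTranspose_smul, hH.eq]; simp
    rw [cfc_gibbs hH, exp_eq_cfc hαH, Complex.coe_smul, Complex.coe_smul,
      ← cfc_comp_smul α Real.exp H ((Matrix.finite_real_spectrum.image _).continuousOn _),
      ← cfc_smul _ _ H (continuousOn_spectrum _ _)]
    congr 1
    funext x
    rw [Real.mul_rpow (by positivity) (by positivity), ← Real.exp_mul, Real.inv_rpow hZ.le,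
      Real.rpow_neg hZ.le, smul_eq_mul, smul_eq_mul, mul_comm x]
  rw [renyiEntropy, if_neg hα, h1, Matrix.trace_smul, hZα, smul_eq_mul, ← Complex.ofReal_mul,
    Complex.ofReal_re, Real.logb, Real.log_mul (by positivity) hZα'.ne', Real.log_rpow hZ]
  ring

/-- The von Neumann entropy of a Gibbs state in terms of the partition function and the energy. -/
theorem renyiEntropy_one_gibbs {H : Matrix n n ℂ} (hH : H.IsHermitian) {Z : ℝ} (hZ : 0 < Z)
    (hZ1 : (NormedSpace.exp H).trace = Z) {E : ℝ}
    (hE : (H * NormedSpace.exp H).trace = (E : ℂ) * Z) :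
    renyiEntropy 1 (((Z⁻¹ : ℝ) : ℂ) • NormedSpace.exp H) = (Real.log Z - E) / Real.log 2 := by
  have hs : IsSelfAdjoint H := hH.isSelfAdjoint
  have h1 : cfc (fun x : ℝ => -(x * Real.logb 2 x)) (((Z⁻¹ : ℝ) : ℂ) • NormedSpace.exp H)
      = ((Real.log Z / (Z * Real.log 2) : ℝ) : ℂ) • NormedSpace.exp H
        + ((-(1 / (Z * Real.log 2)) : ℝ) : ℂ) • (H * NormedSpace.exp H) := by
    have hid : H * cfc Real.exp H = cfc (fun x => x * Real.exp x) H := by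
      conv_lhs => enter [1]; rw [← cfc_id ℝ H]
      rw [← cfc_mul _ _ H (continuousOn_spectrum _ _) (continuousOn_spectrum _ _)]
      rfl
    rw [cfc_gibbs hH, exp_eq_cfc hH, hid, Complex.coe_smul, Complex.coe_smul,
      ← cfc_smul _ _ H (continuousOn_spectrum _ _), ← cfc_smul _ _ H (continuousOn_spectrum _ _),
      ← cfc_add H _ _ (continuousOn_spectrum _ _) (continuousOn_spectrum _ _)]
    congr 1
    funext x
    have hl : Real.log 2 ≠ 0 := (Real.log_pos (by norm_num)).ne'
    rw [Real.logb, Real.log_mul (by positivity) (by positivity), Real.log_exp, Real.log_inv]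
    simp only [smul_eq_mul]
    field_simp
    ring
  have hl : Real.log 2 ≠ 0 := (Real.log_pos (by norm_num)).ne'
  rw [renyiEntropy, if_pos rfl, h1, Matrix.trace_add, Matrix.trace_smul, Matrix.trace_smul, hZ1, hE]
  simp only [smul_eq_mul, ← Complex.ofReal_mul, ← Complex.ofReal_add, Complex.ofReal_re]
  field_simp
  ring

end Gibbs

/-- The Rényi entropy, in nats, of a single fermionic mode with occupation probability `x`. -/
def modeEntropy (α x : ℝ) : ℝ :=
  if α = 1 then -(x * Real.log x) - (1 - x) * Real.log (1 - x)
  else (1 - α)⁻¹ * Real.log (x ^ α + (1 - x) ^ α)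

/-- The Fermi function of `-x`. -/
def logistic (x : ℝ) : ℝ := Real.exp x / (1 + Real.exp x)

theorem modeEntropy_logistic_of_ne {α : ℝ} (hα : α ≠ 1) (x : ℝ) :
    modeEntropy α (logistic x)
      = (1 - α)⁻¹ * (Real.log (1 + Real.exp (α * x)) - α * Real.log (1 + Real.exp x)) := by
  have h1 : 1 - logistic x = 1 / (1 + Real.exp x) := by
    unfold logistic; field_simp; ring
  rw [modeEntropy, if_neg hα, h1, logistic, Real.div_rpow (by positivity) (by positivity),
    Real.div_rpow (by positivity) (by positivity), Real.one_rpow, ← Real.exp_mul, ← add_div,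
    Real.log_div (by positivity) (by positivity), Real.log_rpow (by positivity), mul_comm x,
    add_comm (Real.exp _) 1]

theorem modeEntropy_logistic_one (x : ℝ) :
    modeEntropy 1 (logistic x) = Real.log (1 + Real.exp x) - x * logistic x := by
  have h1 : 1 - logistic x = 1 / (1 + Real.exp x) := by
    unfold logistic; field_simp; ring
  have h2 : Real.log (logistic x) = x - Real.log (1 + Real.exp x) := by
    rw [logistic, Real.log_div (by positivity) (by positivity), Real.log_exp]
  have h3 : Real.log (1 - logistic x) = - Real.log (1 + Real.exp x) := by
    rw [h1, one_div, Real.log_inv]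
  rw [modeEntropy, if_pos rfl, h2, h3]
  ring

/-- The entropy of a Gaussian state is the sum of the entropies of its modes. The state may be
given with relabelled basis vectors. -/
theorem renyiEntropy_exp_quadHam {ι : Type*} [LinearOrder ι] [Fintype ι] {m : Type*} [Fintype m]
    [DecidableEq m] (e : m ≃ Finset ι) {X O : Matrix ι ι ℝ} {x : ι → ℝ} (hO : Oᵀ * O = 1)
    (h : X * O = O * Matrix.diagonal x) (α : ℝ) :
    renyiEntropy α (((NormedSpace.exp (quadHam X)).trace⁻¹ •
      NormedSpace.exp (quadHam X)).submatrix e e)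
      = (∑ i, modeEntropy α (logistic (x i))) / Real.log 2 := by
  have hO' : O * Oᵀ = 1 := mul_eq_one_comm.1 hO
  have hX : X.IsHermitian := by
    have : X = O * Matrix.diagonal x * Oᵀ := by
      rw [← h, Matrix.mul_assoc, hO', Matrix.mul_one]
    rw [this, Matrix.IsHermitian, Matrix.conjTranspose_eq_transpose_of_trivial]
    simp [Matrix.mul_assoc]
  have hsub : ∀ M : Matrix (Finset ι) (Finset ι) ℂ,
      (NormedSpace.exp M).submatrix e e = NormedSpace.exp (M.submatrix e e) := by
    intro M
    have hc : Continuous (Matrix.reindexAlgEquiv ℚ ℂ e.symm) := by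
      refine continuous_matrix fun i j => ?_
      exact (continuous_apply (e j)).comp (continuous_apply (e i))
    open scoped Matrix.Norms.Operator in
    exact NormedSpace.map_exp (Matrix.reindexAlgEquiv ℚ ℂ e.symm) hc M
  have htr : ∀ M : Matrix (Finset ι) (Finset ι) ℂ, (M.submatrix e e).trace = M.trace := by
    intro M
    simp only [Matrix.trace, Matrix.diag, Matrix.submatrix_apply]
    exact e.sum_comp fun S => M S S
  set H := quadHam X with hH
  have hHerm : (H.submatrix e e).IsHermitian := (quadHam_isHermitian hX).submatrix _
  have hsm : ((NormedSpace.exp H).trace⁻¹ • NormedSpace.exp H).submatrix e e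
      = (NormedSpace.exp H).trace⁻¹ • (NormedSpace.exp H).submatrix e e := rfl
  rw [hsm, hsub, trace_exp_quadHam hO h, ← Complex.ofReal_inv]
  set Z := Real.exp (∑ i, Real.log (1 + Real.exp (x i))) with hZ
  rcases eq_or_ne α 1 with rfl | hα
  · have hE := trace_quadHam_mul_exp hO h
    rw [trace_exp_quadHam hO h] at hE
    rw [renyiEntropy_one_gibbs hHerm (Real.exp_pos _)
      (by rw [← hsub, htr, hH, trace_exp_quadHam hO h])
      (E := ∑ i, x i * (Real.exp (x i) / (1 + Real.exp (x i))))
      (by rw [← hsub, ← hE, Matrix.submatrix_mul_equiv, htr]), Real.log_exp]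
    congr 1
    rw [← Finset.sum_sub_distrib]
    exact Finset.sum_congr rfl fun i _ => (modeEntropy_logistic_one (x i)).symm
  · have h' : (α • X) * O = O * Matrix.diagonal (fun i => α * x i) := by
      rw [Matrix.smul_mul, h, ← Matrix.mul_smul]
      congr 1
      ext i j
      simp [Matrix.diagonal_apply]
    have hα' := trace_exp_quadHam hO h'
    rw [quadHam_smul] at hα'
    rw [renyiEntropy_gibbs hHerm (Real.exp_pos _) hα (Real.exp_pos _)
      (by rw [← hα', ← htr, hsub]; rfl), Real.log_exp, Real.log_exp]
    congr 1
    rw [Finset.mul_sum, ← Finset.sum_sub_distrib, Finset.mul_sum]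
    exact Finset.sum_congr rfl fun i _ => (modeEntropy_logistic_of_ne hα (x i)).symm

/-! ### Partial traces -/

section Signs

variable {ι : Type*} [LinearOrder ι]

/-- The sign of reordering `f_S† f_U†`, for modes indexed by a linear order. -/
def crossSign (S U : Finset ι) : ℂ := (-1) ^ ((S ×ˢ U).filter fun p => p.2 < p.1).card

/-- The modes of `A` in `S : Finset A`, as modes of the whole system. -/
abbrev liftModes {A : Finset ι} (S : Finset A) : Finset ι := S.map (Function.Embedding.subtype _)

theorem crossSign_mul_self (S U : Finset ι) : crossSign S U * crossSign S U = 1 := by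
  unfold crossSign
  rw [← mul_pow]; simp

theorem crossSign_insert_left {a : ι} {S : Finset ι} (ha : a ∉ S) (U : Finset ι) :
    crossSign (insert a S) U = modeSign a U * crossSign S U := by
  unfold crossSign modeSign
  have h : insert a S ×ˢ U = U.image (fun u => (a, u)) ∪ S ×ˢ U := by
    ext ⟨x, y⟩
    simp only [Finset.mem_product, Finset.mem_insert, Finset.mem_union, Finset.mem_image,
      Prod.mk.injEq]
    constructor
    · rintro ⟨rfl | h, h'⟩
      · exact Or.inl ⟨y, h', rfl, rfl⟩
      · exact Or.inr ⟨h, h'⟩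
    · rintro (⟨_, h, rfl, rfl⟩ | ⟨h, h'⟩)
      · exact ⟨Or.inl rfl, h⟩
      · exact ⟨Or.inr h, h'⟩
  rw [← pow_add, h, Finset.filter_union, Finset.card_union_of_disjoint]
  · congr 2
    rw [Finset.filter_image, Finset.card_image_of_injective _ (Prod.mk_right_injective a)]
  · rw [Finset.disjoint_left]
    rintro ⟨x, y⟩ h1 h2
    simp only [Finset.mem_filter, Finset.mem_image, Finset.mem_product, Prod.mk.injEq] at h1 h2
    obtain ⟨⟨_, _, rfl, _⟩, _⟩ := h1
    exact ha h2.1.1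

theorem crossSign_insert_right {b : ι} {U : Finset ι} (hb : b ∉ U) (S : Finset ι) :
    crossSign S (insert b U) = (-1) ^ (S.filter (b < ·)).card * crossSign S U := by
  unfold crossSign
  have h : S ×ˢ insert b U = S.image (fun s => (s, b)) ∪ S ×ˢ U := by
    ext ⟨x, y⟩
    simp only [Finset.mem_product, Finset.mem_insert, Finset.mem_union, Finset.mem_image,
      Prod.mk.injEq]
    constructor
    · rintro ⟨h', rfl | h⟩
      · exact Or.inl ⟨x, h', rfl, rfl⟩
      · exact Or.inr ⟨h', h⟩
    · rintro (⟨_, h, rfl, rfl⟩ | ⟨h, h'⟩)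
      · exact ⟨h, Or.inl rfl⟩
      · exact ⟨h, Or.inr h'⟩
  rw [← pow_add, h, Finset.filter_union, Finset.card_union_of_disjoint]
  · congr 2
    rw [Finset.filter_image, Finset.card_image_of_injective _ (Prod.mk_left_injective b)]
  · rw [Finset.disjoint_left]
    rintro ⟨x, y⟩ h1 h2
    simp only [Finset.mem_filter, Finset.mem_image, Finset.mem_product, Prod.mk.injEq] at h1 h2
    obtain ⟨⟨_, _, _, rfl⟩, _⟩ := h1
    exact hb h2.1.2

theorem modeSign_union {j : ι} {S U : Finset ι} (h : Disjoint S U) :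
    modeSign j (S ∪ U) = modeSign j S * modeSign j U := by
  unfold modeSign
  rw [← pow_add, Finset.filter_union, Finset.card_union_of_disjoint
    (Finset.disjoint_filter_filter h)]

theorem modeSign_mul_neg_one_pow {b : ι} {S : Finset ι} (hb : b ∉ S) :
    modeSign b S * (-1) ^ (S.filter (b < ·)).card = (-1) ^ S.card := by
  unfold modeSign
  rw [← pow_add, ← Finset.card_union_of_disjoint]
  · congr 2
    ext x
    simp only [Finset.mem_union, Finset.mem_filter]
    refine ⟨fun h => h.elim And.left And.left, fun h => ?_⟩
    rcases lt_trichotomy x b with h' | rfl | h'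
    · exact Or.inl ⟨h, h'⟩
    · exact absurd h hb
    · exact Or.inr ⟨h, h'⟩
  · rw [Finset.disjoint_filter]
    exact fun x _ h1 h2 => lt_asymm h1 h2

theorem modeSign_liftModes {A : Finset ι} (a : A) (S : Finset A) :
    modeSign (a : ι) (liftModes S) = modeSign a S := by
  unfold modeSign
  rw [Finset.filter_map, Finset.card_map]
  rfl

theorem liftModes_insert {A : Finset ι} [DecidableEq A] (a : A) (S : Finset A) :
    liftModes (insert a S) = insert (a : ι) (liftModes S) := by
  simp only [liftModes, Finset.map_insert, Function.Embedding.subtype_apply]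

theorem liftModes_erase {A : Finset ι} [DecidableEq A] (a : A) (S : Finset A) :
    liftModes (S.erase a) = (liftModes S).erase (a : ι) := by
  simp only [liftModes, Finset.map_erase, Function.Embedding.subtype_apply]

theorem mem_liftModes {κ : Type*} {A : Finset κ} (a : A) (S : Finset A) :
    (a : κ) ∈ liftModes S ↔ a ∈ S := by
  simp [liftModes]

end Signs

section PartialTrace

variable {ι : Type*} [LinearOrder ι] [Fintype ι]

/-- The partial trace over the modes outside of `A`, as an operator on the Fock space of the modes
in `A`. -/
def partialTrace (A : Finset ι) (X : Matrix (Finset ι) (Finset ι) ℂ) :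
    Matrix (Finset A) (Finset A) ℂ :=
  Matrix.of fun S T => ∑ U ∈ Aᶜ.powerset, crossSign (liftModes S) U * crossSign (liftModes T) U *
    X (liftModes S ∪ U) (liftModes T ∪ U)

/-- Subsets of `A` as finite sets of elements of the subtype. -/
def subsetEquiv (A : Finset ι) : {S : Finset ι // S ⊆ A} ≃ Finset A where
  toFun S := S.1.subtype (· ∈ A)
  invFun S := ⟨liftModes S, fun x hx => by
    simp only [Finset.mem_map] at hx
    obtain ⟨y, -, rfl⟩ := hx
    exact y.2⟩
  left_inv S := by
    ext x
    simp only [Finset.mem_map, Finset.mem_subtype, Function.Embedding.subtype_apply, Subtype.exists,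
      exists_and_left, exists_prop, exists_eq_right_right, and_iff_left_iff_imp]
    exact fun h => S.2 h
  right_inv S := by
    ext x
    simp

theorem reducedState_eq {N : ℕ} (A : Finset (Fin N)) (ρ : FockOp N) :
    reducedState A ρ = (partialTrace A ρ).submatrix (subsetEquiv A) (subsetEquiv A) := by
  ext S T
  have hS : liftModes (subsetEquiv A S) = S.1 := congrArg Subtype.val ((subsetEquiv A).left_inv S)
  have hT : liftModes (subsetEquiv A T) = T.1 := congrArg Subtype.val ((subsetEquiv A).left_inv T)
  simp only [reducedState, partialTrace, Matrix.submatrix_apply, Matrix.of_apply, hS, hT]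
  rfl

theorem disjoint_liftModes {A : Finset ι} (S : Finset A) {U : Finset ι} (hU : U ∈ Aᶜ.powerset) :
    Disjoint (liftModes S) U := by
  rw [Finset.disjoint_left]
  intro x hx hx'
  simp only [Finset.mem_map] at hx
  obtain ⟨y, -, rfl⟩ := hx
  exact Finset.mem_compl.1 (Finset.mem_powerset.1 hU hx') y.2

theorem notMem_of_mem_powerset_compl {A U : Finset ι} (a : A) (hU : U ∈ Aᶜ.powerset) :
    (a : ι) ∉ U :=
  fun h => Finset.mem_compl.1 (Finset.mem_powerset.1 hU h) a.2

theorem partialTrace_add (A : Finset ι) (X Y : Matrix (Finset ι) (Finset ι) ℂ) :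
    partialTrace A (X + Y) = partialTrace A X + partialTrace A Y := by
  ext S T
  simp [partialTrace, mul_add, Finset.sum_add_distrib]

theorem partialTrace_smul (A : Finset ι) (c : ℂ) (X : Matrix (Finset ι) (Finset ι) ℂ) :
    partialTrace A (c • X) = c • partialTrace A X := by
  ext S T
  simp only [partialTrace, Matrix.of_apply, Matrix.smul_apply, smul_eq_mul, Finset.mul_sum]
  exact Finset.sum_congr rfl fun U _ => by ring

theorem partialTrace_sum (A : Finset ι) {κ : Type*} (s : Finset κ)
    (X : κ → Matrix (Finset ι) (Finset ι) ℂ) :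
    partialTrace A (∑ k ∈ s, X k) = ∑ k ∈ s, partialTrace A (X k) := by
  classical
  induction s using Finset.induction_on with
  | empty => ext S T; simp [partialTrace]
  | insert k s hk ih => rw [Finset.sum_insert hk, Finset.sum_insert hk, partialTrace_add, ih]

theorem partialTrace_mul_create {A : Finset ι} (a : A) (X : Matrix (Finset ι) (Finset ι) ℂ) :
    partialTrace A (X * create (a : ι)) = partialTrace A X * create a := by
  ext S T
  rw [mul_create_apply]
  simp only [partialTrace, Matrix.of_apply, mul_create_apply]
  split_ifs with h
  · refine Finset.sum_eq_zero fun U _ => ?_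
    rw [if_pos (Finset.mem_union_left _ ((mem_liftModes a T).2 h)), mul_zero]
  · have h' : (a : ι) ∉ liftModes T := fun h' => h ((mem_liftModes a T).1 h')
    rw [Finset.sum_mul]
    refine Finset.sum_congr rfl fun U hU => ?_
    rw [if_neg (by simp only [Finset.mem_union, not_or]
                   exact ⟨h', notMem_of_mem_powerset_compl a hU⟩),
      modeSign_union (disjoint_liftModes T hU), liftModes_insert, crossSign_insert_left h',
      modeSign_liftModes, Finset.insert_union]
    ring

theorem partialTrace_create_mul {A : Finset ι} (a : A) (X : Matrix (Finset ι) (Finset ι) ℂ) :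
    partialTrace A (create (a : ι) * X) = create a * partialTrace A X := by
  ext S T
  rw [create_mul_apply]
  simp only [partialTrace, Matrix.of_apply, create_mul_apply]
  split_ifs with h
  · rw [← modeSign_liftModes, liftModes_erase, Finset.mul_sum]
    refine Finset.sum_congr rfl fun U hU => ?_
    obtain ⟨R, hR, hS⟩ : ∃ R, (a : ι) ∉ R ∧ liftModes S = insert (a : ι) R :=
      ⟨_, Finset.notMem_erase _ _, (Finset.insert_erase ((mem_liftModes a S).2 h)).symm⟩
    have hd : Disjoint R U := by
      have := disjoint_liftModes S hU
      rw [hS] at this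
      exact this.mono_left (Finset.subset_insert _ _)
    have h2 : (a : ι) ∉ R ∪ U := by
      simp only [Finset.mem_union, not_or]
      exact ⟨hR, notMem_of_mem_powerset_compl a hU⟩
    rw [hS, Finset.erase_insert hR, Finset.insert_union, if_pos (Finset.mem_insert_self _ _),
      Finset.erase_insert h2, modeSign_union hd, crossSign_insert_left hR]
    linear_combination (modeSign (a : ι) R * crossSign R U * crossSign (liftModes T) U *
      X (R ∪ U) (liftModes T ∪ U)) * modeSign_mul_self (a : ι) U
  · refine Finset.sum_eq_zero fun U hU => ?_
    rw [if_neg, mul_zero]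
    simp only [Finset.mem_union, not_or]
    exact ⟨fun h' => h ((mem_liftModes a S).1 h'), notMem_of_mem_powerset_compl a hU⟩

/-- A mode that is traced out can be moved cyclically; the sign comes from its anticommuting with
the modes that are kept. -/
theorem partialTrace_create_mul_of_notMem {A : Finset ι} {b : ι} (hb : b ∉ A)
    {X : Matrix (Finset ι) (Finset ι) ℂ} (hX : NumberConserving X) :
    partialTrace A (create b * X) = -partialTrace A (X * create b) := by
  ext S T
  have hS : b ∉ liftModes S := fun h => by
    simp only [Finset.mem_map] at h
    obtain ⟨y, -, rfl⟩ := h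
    exact hb y.2
  have hT : b ∉ liftModes T := fun h => by
    simp only [Finset.mem_map] at h
    obtain ⟨y, -, rfl⟩ := h
    exact hb y.2
  simp only [partialTrace, Matrix.of_apply, create_mul_apply, Matrix.neg_apply, mul_create_apply]
  obtain ⟨B, hbB, hB⟩ : ∃ B, b ∉ B ∧ Aᶜ = insert b B :=
    ⟨Aᶜ.erase b, Finset.notMem_erase _ _,
      (Finset.insert_erase (Finset.mem_compl.2 hb)).symm⟩
  rw [hB, Finset.sum_powerset_insert hbB, Finset.sum_powerset_insert hbB]
  have hz1 : ∀ U ∈ B.powerset, crossSign (liftModes S) U * crossSign (liftModes T) U *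
      (if b ∈ liftModes S ∪ U then modeSign b ((liftModes S ∪ U).erase b) *
        X ((liftModes S ∪ U).erase b) (liftModes T ∪ U) else 0) = 0 := by
    intro U hU
    rw [if_neg, mul_zero]
    simp only [Finset.mem_union, not_or]
    exact ⟨hS, fun h => hbB (Finset.mem_powerset.1 hU h)⟩
  have hz2 : ∀ U ∈ B.powerset, crossSign (liftModes S) (insert b U) *
      crossSign (liftModes T) (insert b U) * (if b ∈ liftModes T ∪ insert b U then 0
        else X (liftModes S ∪ insert b U) (insert b (liftModes T ∪ insert b U)) *
          modeSign b (liftModes T ∪ insert b U)) = 0 := by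
    intro U hU
    rw [if_pos (by simp), mul_zero]
  rw [Finset.sum_eq_zero hz1, Finset.sum_eq_zero hz2, zero_add, add_zero, ← Finset.sum_neg_distrib]
  refine Finset.sum_congr rfl fun U hU => ?_
  have hbU : b ∉ U := fun h => hbB (Finset.mem_powerset.1 hU h)
  have hUA : U ∈ Aᶜ.powerset := by
    rw [hB]; exact Finset.mem_powerset.2 ((Finset.mem_powerset.1 hU).trans (Finset.subset_insert _ _))
  have hSU : b ∉ liftModes S ∪ U := by simp only [Finset.mem_union, not_or]; exact ⟨hS, hbU⟩
  have hTU : b ∉ liftModes T ∪ U := by simp only [Finset.mem_union, not_or]; exact ⟨hT, hbU⟩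
  rw [if_pos (by simp), if_neg hTU, Finset.union_insert, Finset.union_insert,
    Finset.erase_insert hSU, crossSign_insert_right hbU, crossSign_insert_right hbU,
    modeSign_union (disjoint_liftModes S hUA), modeSign_union (disjoint_liftModes T hUA)]
  by_cases hc : (liftModes S ∪ U).card = (insert b (liftModes T ∪ U)).card
  · rw [Finset.card_insert_of_notMem hTU,
      Finset.card_union_of_disjoint (disjoint_liftModes S hUA),
      Finset.card_union_of_disjoint (disjoint_liftModes T hUA)] at hc
    have hc' : (liftModes S).card = (liftModes T).card + 1 := by omega
    have e1 := modeSign_mul_neg_one_pow hS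
    have e2 := modeSign_mul_neg_one_pow hT
    have e3 : ((-1 : ℂ)) ^ ((liftModes T).filter (b < ·)).card
        * (-1) ^ ((liftModes T).filter (b < ·)).card = 1 := by rw [← mul_pow]; simp
    have e4 : ((-1 : ℂ)) ^ (liftModes T).card * (-1) ^ (liftModes T).card = 1 := by
      rw [← mul_pow]; simp
    rw [hc', pow_succ] at e1
    set s1 := modeSign b (liftModes S)
    set s2 := modeSign b (liftModes T)
    set g1 := ((-1 : ℂ)) ^ ((liftModes S).filter (b < ·)).card
    set g2 := ((-1 : ℂ)) ^ ((liftModes T).filter (b < ·)).card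
    set p := ((-1 : ℂ)) ^ (liftModes T).card
    have e5 : g1 * g2 * s1 = -s2 := by
      linear_combination g2 * e1 + g2 * e2 - s2 * e3
    linear_combination (crossSign (liftModes S) U * crossSign (liftModes T) U * modeSign b U *
      X (liftModes S ∪ U) (insert b (liftModes T ∪ U))) * e5
  · rw [hX _ _ hc]; ring

theorem NumberConserving.partialTrace {X : Matrix (Finset ι) (Finset ι) ℂ}
    (hX : NumberConserving X) (A : Finset ι) : NumberConserving (partialTrace A X) := by
  intro S T hST
  refine Finset.sum_eq_zero fun U hU => ?_
  rw [hX _ _, mul_zero]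
  rw [Finset.card_union_of_disjoint (disjoint_liftModes S hU),
    Finset.card_union_of_disjoint (disjoint_liftModes T hU), Finset.card_map, Finset.card_map]
  omega

theorem trace_partialTrace (A : Finset ι) (X : Matrix (Finset ι) (Finset ι) ℂ) :
    (partialTrace A X).trace = X.trace := by
  simp only [Matrix.trace, Matrix.diag, partialTrace, Matrix.of_apply]
  rw [← Finset.sum_product']
  refine Finset.sum_bij' (fun p _ => liftModes p.1 ∪ p.2)
    (fun W _ => (W.subtype (· ∈ A), W \ A)) (by simp) ?_ ?_ ?_ ?_
  · intro W _
    simp only [Finset.mem_product, Finset.mem_univ, true_and, Finset.mem_powerset]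
    intro x hx
    rw [Finset.mem_sdiff] at hx
    exact Finset.mem_compl.2 hx.2
  · rintro ⟨S, U⟩ h
    have hU : U ∈ Aᶜ.powerset := (Finset.mem_product.1 h).2
    ext x
    · simp only [Finset.mem_subtype, Finset.mem_union, mem_liftModes]
      exact ⟨fun h' => h'.resolve_right (notMem_of_mem_powerset_compl x hU), Or.inl⟩
    · simp only [Finset.mem_sdiff, Finset.mem_union]
      constructor
      · rintro ⟨h1 | h1, h2⟩
        · simp only [Finset.mem_map] at h1
          obtain ⟨y, -, rfl⟩ := h1
          exact absurd y.2 h2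
        · exact h1
      · exact fun h' => ⟨Or.inr h', Finset.mem_compl.1 (Finset.mem_powerset.1 hU h')⟩
  · intro W _
    ext x
    simp only [Finset.mem_union, Finset.mem_map, Finset.mem_subtype,
      Function.Embedding.subtype_apply, Subtype.exists, exists_and_left, exists_prop,
      exists_eq_right_right, Finset.mem_sdiff]
    tauto
  · rintro ⟨S, U⟩ _
    linear_combination (X (liftModes S ∪ U) (liftModes S ∪ U)) * crossSign_mul_self (liftModes S) U

end PartialTrace

/-! ### Reduced states of Gaussian states -/

section Reduced

variable {ι : Type*} [LinearOrder ι] [Fintype ι]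

/-- Number conserving operators are determined, up to a scalar, by their commutation relations with
the creation operators: all of Fock space is created from the vacuum. -/
theorem eq_smul_of_intertwine {R E : Matrix (Finset ι) (Finset ι) ℂ} (hR : NumberConserving R)
    (hE : NumberConserving E) (h0 : E ∅ ∅ ≠ 0) (L : ι → Matrix (Finset ι) (Finset ι) ℂ)
    (hRL : ∀ j, R * create j = L j * R) (hEL : ∀ j, E * create j = L j * E) :
    R = (R ∅ ∅ / E ∅ ∅) • E := by
  have key : ∀ T S, (R - (R ∅ ∅ / E ∅ ∅) • E) S T = 0 := by
    intro T
    induction T using Finset.induction_on with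
    | empty =>
      intro S
      rcases S.eq_empty_or_nonempty with rfl | hS
      · simp [div_mul_cancel₀ _ h0]
      · have hc : S.card ≠ (∅ : Finset ι).card := by simpa using hS.ne_empty
        simp [hR _ _ hc, hE _ _ hc]
    | insert j T hj ih =>
      intro S
      set D := R - (R ∅ ∅ / E ∅ ∅) • E with hD
      have hDL : D * create j = L j * D := by
        rw [hD, Matrix.sub_mul, Matrix.mul_sub, Matrix.smul_mul, Matrix.mul_smul, hRL, hEL]
      have h1 := congrFun (congrFun hDL S) T
      rw [mul_create_apply, if_neg hj, Matrix.mul_apply] at h1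
      simp only [ih, mul_zero, Finset.sum_const_zero] at h1
      have h2 : modeSign j T ≠ 0 := by
        intro h; have := modeSign_mul_self j T; rw [h] at this; simp at this
      exact (mul_eq_zero.1 h1).resolve_right h2
  ext S T
  have := key T S
  rw [Matrix.sub_apply, sub_eq_zero] at this
  exact this

/-- The vacuum entry of an invertible number conserving operator is nonzero, as the vacuum spans the
sector without fermions. -/
theorem NumberConserving.vacuum_ne_zero {E : Matrix (Finset ι) (Finset ι) ℂ}
    (hE : NumberConserving E) (hu : IsUnit E) : E ∅ ∅ ≠ 0 := by
  intro h0
  obtain ⟨F, hF⟩ := hu.exists_left_inv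
  have h1 := congrFun (congrFun hF ∅) ∅
  rw [Matrix.mul_apply, Finset.sum_eq_zero] at h1
  · simp at h1
  · intro S _
    rcases S.eq_empty_or_nonempty with rfl | hS
    · rw [h0, mul_zero]
    · rw [hE S ∅ (by simpa using hS.ne_empty), mul_zero]

theorem logistic_log {y : ℝ} (h0 : 0 < y) (h1 : y < 1) : logistic (Real.log (y / (1 - y))) = y := by
  have : 0 < 1 - y := by linarith
  rw [logistic, Real.exp_log (by positivity)]
  field_simp
  ring

/-- The reduced state of a Gaussian state with correlation matrix `Γ` is the Gaussian state of the
corresponding block of `Γ`. -/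
theorem partialTrace_exp_quadHam {X O : Matrix ι ι ℝ} {x : ι → ℝ} (hO : Oᵀ * O = 1)
    (h : X * O = O * Matrix.diagonal x) {Γ : Matrix ι ι ℝ}
    (hΓ : Γ * O = O * Matrix.diagonal fun i => logistic (x i)) (A : Finset ι)
    {O' : Matrix A A ℝ} {y : A → ℝ} (hO' : O'ᵀ * O' = 1) (hy0 : ∀ i, 0 < y i) (hy1 : ∀ i, y i < 1)
    (hΓA : Γ.submatrix (↑) (↑) * O' = O' * Matrix.diagonal y) :
    partialTrace A ((NormedSpace.exp (quadHam X)).trace⁻¹ • NormedSpace.exp (quadHam X))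
      = (NormedSpace.exp (quadHam (O' * Matrix.diagonal (fun i => Real.log (y i / (1 - y i)))
          * O'ᵀ))).trace⁻¹ • NormedSpace.exp (quadHam
          (O' * Matrix.diagonal (fun i => Real.log (y i / (1 - y i))) * O'ᵀ)) := by
  have hOt : O * Oᵀ = 1 := mul_eq_one_comm.1 hO
  have hOt' : O' * O'ᵀ = 1 := mul_eq_one_comm.1 hO'
  set E := NormedSpace.exp (quadHam X) with hE
  set ρ := E.trace⁻¹ • E with hρ
  set x' : A → ℝ := fun i => Real.log (y i / (1 - y i)) with hx'
  set X' := O' * Matrix.diagonal x' * O'ᵀ with hX'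
  set E' := NormedSpace.exp (quadHam X') with hE'
  set R := partialTrace A ρ with hR
  have hX'O : X' * O' = O' * Matrix.diagonal x' := by
    rw [hX', Matrix.mul_assoc, hO', Matrix.mul_one]
  have hEn : NumberConserving E := (numberConserving_quadHam X).exp
  have hE'n : NumberConserving E' := (numberConserving_quadHam X').exp
  have hρn : NumberConserving ρ := fun S T hST => by
    rw [hρ, Matrix.smul_apply, hEn S T hST, smul_zero]
  have hRn : NumberConserving R := hρn.partialTrace A
  -- the relation `ρ f_j† = ∑ Γ_{j,k} (ρ f_k† + f_k† ρ)`, first for eigenmodes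
  have hmode : ∀ i, ρ * modeCreate O i
      = (logistic (x i) : ℂ) • (ρ * modeCreate O i + modeCreate O i * ρ) := by
    intro i
    have h1 := exp_quadHam_mul_modeCreate h i
    have h2 : ρ * modeCreate O i = (Real.exp (x i) : ℂ) • (modeCreate O i * ρ) := by
      rw [hρ, Matrix.smul_mul, h1, Matrix.mul_smul, smul_comm]
    have h4 : ∀ (c d : ℂ) (M : Matrix (Finset ι) (Finset ι) ℂ), c = d * (c + 1) →
        c • M = d • (c • M + M) := by
      intro c d M hcd
      rw [← one_smul ℂ M, smul_smul, mul_one, ← add_smul, smul_smul, ← hcd]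
    rw [h2]
    refine h4 _ _ _ ?_
    have h3 : ((1 + Real.exp (x i) : ℝ) : ℂ) ≠ 0 := Complex.ofReal_ne_zero.2 (by positivity)
    rw [logistic, Complex.ofReal_div]
    rw [div_mul_eq_mul_div, eq_div_iff h3]
    push_cast; ring
  have hΓ' : ∀ j i, ∑ k, Γ j k * O k i = O j i * logistic (x i) := by
    intro j i
    have := congrFun (congrFun hΓ j) i
    rwa [Matrix.mul_apply, Matrix.mul_diagonal] at this
  have hΓsym : ∀ j k, Γ j k = ∑ i, O j i * logistic (x i) * O k i := by
    intro j k
    have : Γ = O * Matrix.diagonal (fun i => logistic (x i)) * Oᵀ := by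
      rw [← hΓ, Matrix.mul_assoc, hOt, Matrix.mul_one]
    rw [this, Matrix.mul_apply]
    simp [Matrix.mul_diagonal]
  have hsite : ∀ j, ρ * create j = ∑ k, (Γ j k : ℂ) • (ρ * create k + create k * ρ) := by
    intro j
    have e1 : ρ * create j = ∑ i, (O j i : ℂ) • (ρ * modeCreate O i) := by
      conv_lhs => rw [create_eq_sum_modeCreate hOt j]
      rw [Finset.mul_sum]
      exact Finset.sum_congr rfl fun i _ => Matrix.mul_smul _ _ _
    have e2 : ∀ i, ρ * modeCreate O i + modeCreate O i * ρ
        = ∑ k, (O k i : ℂ) • (ρ * create k + create k * ρ) := by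
      intro i
      simp only [modeCreate, Finset.mul_sum, Finset.sum_mul, Matrix.mul_smul, Matrix.smul_mul,
        smul_add, Finset.sum_add_distrib]
    rw [e1]
    calc _ = ∑ i, ∑ k, ((O j i * logistic (x i) * O k i : ℝ) : ℂ)
            • (ρ * create k + create k * ρ) := by
          refine Finset.sum_congr rfl fun i _ => ?_
          rw [hmode, e2, Finset.smul_sum, Finset.smul_sum]
          refine Finset.sum_congr rfl fun k _ => ?_
          rw [smul_smul, smul_smul]; push_cast; rfl
      _ = _ := by
          rw [Finset.sum_comm]
          refine Finset.sum_congr rfl fun k _ => ?_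
          rw [← Finset.sum_smul, hΓsym, Complex.ofReal_sum]
  have hred : ∀ a : A, R * create a
      = ∑ a' : A, (Γ a a' : ℂ) • (R * create a' + create a' * R) := by
    intro a
    have h1 := congrArg (partialTrace A) (hsite a)
    rw [partialTrace_mul_create, partialTrace_sum] at h1
    rw [h1]
    symm
    have h2 : ∀ a' : A, (Γ a a' : ℂ) • (R * create a' + create a' * R)
        = partialTrace A ((Γ a a' : ℂ) • (ρ * create (a' : ι) + create (a' : ι) * ρ)) := by
      intro a'
      rw [partialTrace_smul, partialTrace_add, partialTrace_mul_create, partialTrace_create_mul]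
    simp only [h2]
    rw [Finset.sum_coe_sort A
      (fun k => partialTrace A ((Γ a k : ℂ) • (ρ * create k + create k * ρ)))]
    refine Finset.sum_subset (Finset.subset_univ A) fun k _ hk => ?_
    rw [partialTrace_smul, partialTrace_add, partialTrace_create_mul_of_notMem hk hρn,
      add_neg_cancel, smul_zero]
  have hredmode : ∀ i : A, R * modeCreate O' i
      = (Real.exp (x' i) : ℂ) • (modeCreate O' i * R) := by
    intro i
    have hc : ∀ a' : A, ∑ a : A, O' a i * Γ a a' = y i * O' a' i := by
      intro a'
      have := congrFun (congrFun hΓA a') i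
      rw [Matrix.mul_apply, Matrix.mul_diagonal] at this
      rw [mul_comm, ← this]
      refine Finset.sum_congr rfl fun a _ => ?_
      rw [Matrix.submatrix_apply, hΓsym, hΓsym, mul_comm]
      congr 1
      exact Finset.sum_congr rfl fun k _ => by ring
    have h1 : R * modeCreate O' i
        = (y i : ℂ) • (R * modeCreate O' i + modeCreate O' i * R) := by
      have e2 : R * modeCreate O' i + modeCreate O' i * R
          = ∑ k : A, (O' k i : ℂ) • (R * create k + create k * R) := by
        simp only [modeCreate, Finset.mul_sum, Finset.sum_mul, Matrix.mul_smul, Matrix.smul_mul,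
          smul_add, Finset.sum_add_distrib]
      calc R * modeCreate O' i = ∑ a : A, (O' a i : ℂ) • (R * create a) := by
            simp only [modeCreate, Finset.mul_sum, Matrix.mul_smul]
        _ = ∑ a : A, ∑ a' : A, ((O' a i * Γ a a' : ℝ) : ℂ) • (R * create a' + create a' * R) := by
            refine Finset.sum_congr rfl fun a _ => ?_
            rw [hred, Finset.smul_sum]
            refine Finset.sum_congr rfl fun k _ => ?_
            rw [smul_smul]; push_cast; rfl
        _ = _ := by
            rw [Finset.sum_comm, e2, Finset.smul_sum]
            refine Finset.sum_congr rfl fun k _ => ?_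
            rw [← Finset.sum_smul, ← Complex.ofReal_sum, hc, smul_smul, Complex.ofReal_mul]
    have hy : (0 : ℝ) < 1 - y i := by linarith [hy1 i]
    have h2 : ((1 - y i : ℝ) : ℂ) • (R * modeCreate O' i) = (y i : ℂ) • (modeCreate O' i * R) := by
      rw [Complex.ofReal_sub, sub_smul, Complex.ofReal_one, one_smul]
      nth_rewrite 1 [h1]
      rw [smul_add]; abel
    have h3 : ((1 - y i : ℝ) : ℂ) ≠ 0 := Complex.ofReal_ne_zero.2 hy.ne'
    rw [hx']
    simp only
    rw [Real.exp_log (div_pos (hy0 i) hy), Complex.ofReal_div, div_eq_inv_mul, mul_smul, ← h2,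
      inv_smul_smul₀ h3]
  have hE'mode : ∀ i : A, E' * modeCreate O' i
      = (Real.exp (x' i) : ℂ) • (modeCreate O' i * E') := exp_quadHam_mul_modeCreate hX'O
  have hu : IsUnit E' := Matrix.isUnit_exp _
  have hL : ∀ D : Matrix (Finset A) (Finset A) ℂ,
      (∀ i, D * modeCreate O' i = (Real.exp (x' i) : ℂ) • (modeCreate O' i * D)) →
      ∀ j : A, D * create j = (∑ i, ((O' j i : ℂ) * (Real.exp (x' i) : ℂ)) • modeCreate O' i) * D := by
    intro D hD j
    conv_lhs => rw [create_eq_sum_modeCreate hOt' j]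
    rw [Finset.mul_sum, Finset.sum_mul]
    refine Finset.sum_congr rfl fun i _ => ?_
    rw [Matrix.mul_smul, hD, smul_smul, Matrix.smul_mul]
  have hfin := eq_smul_of_intertwine hRn hE'n (hE'n.vacuum_ne_zero hu) _ (hL R hredmode)
    (hL E' hE'mode)
  have htr : R.trace = 1 := by
    rw [hR, trace_partialTrace, hρ, Matrix.trace_smul, smul_eq_mul, inv_mul_cancel₀]
    rw [hE, trace_exp_quadHam hO h]
    exact Complex.ofReal_ne_zero.2 (Real.exp_pos _).ne'
  have htr' := congrArg Matrix.trace hfin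
  rw [htr, Matrix.trace_smul, smul_eq_mul] at htr'
  rw [hfin, eq_inv_of_mul_eq_one_left htr'.symm]

/-- The mutual information of a fermionic Gibbs state in terms of the eigenvalues of the correlation
matrix `Γ` and of its diagonal blocks. -/
theorem mutualInformation_gibbsState {N : ℕ} {V O Γ : Matrix (Fin N) (Fin N) ℝ} {v : Fin N → ℝ}
    (hO : Oᵀ * O = 1) (h : V * O = O * Matrix.diagonal v) (β : ℝ)
    (hΓ : Γ * O = O * Matrix.diagonal fun i => logistic (-β * v i)) (A : Finset (Fin N))
    {O₁ : Matrix A A ℝ} {y₁ : A → ℝ} (hO₁ : O₁ᵀ * O₁ = 1) (hy₁ : ∀ i, 0 < y₁ i ∧ y₁ i < 1)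
    (hΓ₁ : Γ.submatrix (↑) (↑) * O₁ = O₁ * Matrix.diagonal y₁)
    {O₂ : Matrix ↥Aᶜ ↥Aᶜ ℝ} {y₂ : ↥Aᶜ → ℝ} (hO₂ : O₂ᵀ * O₂ = 1)
    (hy₂ : ∀ i, 0 < y₂ i ∧ y₂ i < 1)
    (hΓ₂ : Γ.submatrix (↑) (↑) * O₂ = O₂ * Matrix.diagonal y₂) (α : ℝ) :
    mutualInformation α A (gibbsState β (hamiltonian V))
      = (∑ i, modeEntropy α (y₁ i) + ∑ i, modeEntropy α (y₂ i)
          - ∑ i, modeEntropy α (logistic (-β * v i))) / Real.log 2 := by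
  have hX : ((-β) • V) * O = O * Matrix.diagonal (fun i => -β * v i) := by
    rw [Matrix.smul_mul, h, ← Matrix.mul_smul]
    congr 1
    ext i j
    simp [Matrix.diagonal_apply]
  have hρ : gibbsState β (hamiltonian V) = (NormedSpace.exp (quadHam ((-β) • V))).trace⁻¹ •
      NormedSpace.exp (quadHam ((-β) • V)) := by
    rw [gibbsState, hamiltonian_eq_quadHam, quadHam_smul, Complex.ofReal_neg]
  have hred : ∀ (B : Finset (Fin N)) (P : Matrix B B ℝ) (y : B → ℝ), Pᵀ * P = 1 →
      (∀ i, 0 < y i ∧ y i < 1) → Γ.submatrix (↑) (↑) * P = P * Matrix.diagonal y →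
      renyiEntropy α (reducedState B (gibbsState β (hamiltonian V)))
        = (∑ i, modeEntropy α (y i)) / Real.log 2 := by
    intro B P y hP hy hB
    rw [reducedState_eq, hρ, partialTrace_exp_quadHam hO hX hΓ B hP (fun i => (hy i).1)
      (fun i => (hy i).2) hB]
    have h1 := renyiEntropy_exp_quadHam (subsetEquiv B) hP
      (x := fun i => Real.log (y i / (1 - y i)))
      (X := P * Matrix.diagonal (fun i => Real.log (y i / (1 - y i))) * Pᵀ)
      (by rw [Matrix.mul_assoc, hP, Matrix.mul_one]; convert rfl) α
    rw [Finset.sum_congr rfl fun i _ => congrArg (modeEntropy α)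
      (logistic_log (hy i).1 (hy i).2)] at h1
    convert h1 using 2
    convert rfl
  have hfull : renyiEntropy α (gibbsState β (hamiltonian V))
      = (∑ i, modeEntropy α (logistic (-β * v i))) / Real.log 2 := by
    have := renyiEntropy_exp_quadHam (Equiv.refl _) hO hX α
    rw [hρ]
    simpa using this
  rw [mutualInformation, hred A O₁ y₁ hO₁ hy₁ hΓ₁, hred Aᶜ O₂ y₂ hO₂ hy₂ hΓ₂, hfull]
  ring

end Reduced

/-! ### Functions of a symmetric matrix and its blocks -/

section Spectral

variable {n : Type*} [Fintype n] [DecidableEq n] {V : Matrix n n ℝ}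

/-- An orthogonal matrix of eigenvectors of a real symmetric matrix. -/
def eigMat (hV : V.IsHermitian) : Matrix n n ℝ := (hV.eigenvectorUnitary : Matrix n n ℝ)

theorem eigMat_transpose_mul (hV : V.IsHermitian) : (eigMat hV)ᵀ * eigMat hV = 1 := by
  have := (Matrix.mem_unitaryGroup_iff').1 hV.eigenvectorUnitary.2
  rwa [Matrix.star_eq_conjTranspose, Matrix.conjTranspose_eq_transpose_of_trivial] at this

theorem eigMat_mul_transpose (hV : V.IsHermitian) : eigMat hV * (eigMat hV)ᵀ = 1 :=
  mul_eq_one_comm.1 (eigMat_transpose_mul hV)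

/-- The function `φ` of a real symmetric matrix. -/
def funMat (hV : V.IsHermitian) (φ : ℝ → ℝ) : Matrix n n ℝ :=
  eigMat hV * Matrix.diagonal (fun i => φ (hV.eigenvalues i)) * (eigMat hV)ᵀ

theorem funMat_mul_eigMat (hV : V.IsHermitian) (φ : ℝ → ℝ) :
    funMat hV φ * eigMat hV = eigMat hV * Matrix.diagonal (fun i => φ (hV.eigenvalues i)) := by
  rw [funMat, Matrix.mul_assoc, eigMat_transpose_mul, Matrix.mul_one]

theorem funMat_id (hV : V.IsHermitian) : funMat hV (fun x => x) = V := by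
  have h := hV.spectral_theorem
  rw [Unitary.conjStarAlgAut_apply] at h
  conv_rhs => rw [h]
  rfl

theorem mul_eigMat (hV : V.IsHermitian) :
    V * eigMat hV = eigMat hV * Matrix.diagonal hV.eigenvalues := by
  have h := funMat_mul_eigMat hV (fun x => x)
  rwa [funMat_id] at h

theorem funMat_mul (hV : V.IsHermitian) (φ χ : ℝ → ℝ) :
    funMat hV φ * funMat hV χ = funMat hV (fun x => φ x * χ x) := by
  unfold funMat
  rw [Matrix.mul_assoc, ← Matrix.mul_assoc (eigMat hV)ᵀ, ← Matrix.mul_assoc (eigMat hV)ᵀ,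
    eigMat_transpose_mul, Matrix.one_mul, ← Matrix.mul_assoc, Matrix.mul_assoc (eigMat hV),
    Matrix.diagonal_mul_diagonal]

theorem funMat_add (hV : V.IsHermitian) (φ χ : ℝ → ℝ) :
    funMat hV φ + funMat hV χ = funMat hV (fun x => φ x + χ x) := by
  unfold funMat
  rw [← Matrix.add_mul, ← Matrix.mul_add, Matrix.diagonal_add]

theorem funMat_sub (hV : V.IsHermitian) (φ χ : ℝ → ℝ) :
    funMat hV φ - funMat hV χ = funMat hV (fun x => φ x - χ x) := by
  unfold funMat
  rw [← Matrix.sub_mul, ← Matrix.mul_sub, Matrix.diagonal_sub]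

theorem funMat_const (hV : V.IsHermitian) (c : ℝ) :
    funMat hV (fun _ => c) = Matrix.diagonal fun _ => c := by
  unfold funMat
  rw [← Matrix.smul_one_eq_diagonal, Matrix.mul_smul, Matrix.mul_one, Matrix.smul_mul,
    eigMat_mul_transpose]

theorem funMat_pow (hV : V.IsHermitian) (φ : ℝ → ℝ) (m : ℕ) :
    funMat hV φ ^ m = funMat hV (fun x => φ x ^ m) := by
  induction m with
  | zero => simp only [pow_zero]; rw [funMat_const]; exact Matrix.diagonal_one.symm
  | succ m ih => rw [pow_succ, ih, funMat_mul]; rfl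

theorem funMat_transpose (hV : V.IsHermitian) (φ : ℝ → ℝ) : (funMat hV φ)ᵀ = funMat hV φ := by
  unfold funMat
  simp [Matrix.mul_assoc]

theorem funMat_isHermitian (hV : V.IsHermitian) (φ : ℝ → ℝ) : (funMat hV φ).IsHermitian := by
  rw [Matrix.IsHermitian, Matrix.conjTranspose_eq_transpose_of_trivial, funMat_transpose]

theorem funMat_apply_comm (hV : V.IsHermitian) (φ : ℝ → ℝ) (i j : n) :
    funMat hV φ i j = funMat hV φ j i :=
  congrFun (congrFun (funMat_transpose hV φ) j) i

theorem funMat_apply (hV : V.IsHermitian) (φ : ℝ → ℝ) (i j : n) :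
    funMat hV φ i j = ∑ k, eigMat hV i k * φ (hV.eigenvalues k) * eigMat hV j k := by
  rw [funMat, Matrix.mul_apply]
  simp only [Matrix.mul_diagonal, Matrix.transpose_apply]

theorem trace_funMat (hV : V.IsHermitian) (φ : ℝ → ℝ) :
    (funMat hV φ).trace = ∑ i, φ (hV.eigenvalues i) := by
  rw [funMat, Matrix.trace_mul_comm, ← Matrix.mul_assoc, eigMat_transpose_mul, Matrix.one_mul,
    Matrix.trace_diagonal]

theorem sum_eigenvalues_pow (hV : V.IsHermitian) (m : ℕ) :
    ∑ i, hV.eigenvalues i ^ m = (V ^ m).trace := by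
  rw [← trace_funMat hV (fun x => x ^ m), ← funMat_pow hV (fun x => x), funMat_id]

/-- The block of a symmetric matrix with rows and columns in `A` is symmetric. -/
theorem block_isHermitian (hV : V.IsHermitian) (φ : ℝ → ℝ) (A : Finset n) :
    ((funMat hV φ).submatrix ((↑) : A → n) (↑)).IsHermitian :=
  (funMat_isHermitian hV φ).submatrix _

/-- The eigenvalues of a diagonal block of `φ(V)` are averages of the eigenvalues of `φ(V)`. -/
theorem exists_block_weights (hV : V.IsHermitian) (φ : ℝ → ℝ) (A : Finset n) :
    ∃ p : A → n → ℝ, (∀ i k, 0 ≤ p i k) ∧ (∀ i, ∑ k, p i k = 1) ∧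
      (∀ k, ∑ i, p i k = ∑ a ∈ A, eigMat hV a k ^ 2) ∧
      ∀ i, (block_isHermitian hV φ A).eigenvalues i = ∑ k, p i k * φ (hV.eigenvalues k) := by
  set hB := block_isHermitian hV φ A
  set W := eigMat hB
  set U := eigMat hV
  have hW : ∀ i j, ∑ a, W a i * W a j = if i = j then 1 else 0 := by
    intro i j
    have := congrFun (congrFun (eigMat_transpose_mul hB) i) j
    rwa [Matrix.mul_apply, Matrix.one_apply] at this
  have hW' : ∀ a b, ∑ i, W a i * W b i = if a = b then 1 else 0 := by
    intro i j
    have := congrFun (congrFun (eigMat_mul_transpose hB) i) j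
    rwa [Matrix.mul_apply, Matrix.one_apply] at this
  have hU' : ∀ a b, ∑ k, U a k * U b k = if a = b then 1 else 0 := by
    intro i j
    have := congrFun (congrFun (eigMat_mul_transpose hV) i) j
    rwa [Matrix.mul_apply, Matrix.one_apply] at this
  refine ⟨fun i k => (∑ a : A, W a i * U a k) ^ 2, fun i k => sq_nonneg _, fun i => ?_,
    fun k => ?_, fun i => ?_⟩
  · calc ∑ k, (∑ a : A, W a i * U a k) ^ 2
        = ∑ k, ∑ a : A, ∑ b : A, W a i * W b i * (U a k * U b k) := by
          refine Finset.sum_congr rfl fun k _ => ?_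
          rw [sq, Finset.sum_mul_sum]
          exact Finset.sum_congr rfl fun a _ => Finset.sum_congr rfl fun b _ => by ring
      _ = ∑ a : A, ∑ b : A, W a i * W b i * ∑ k, U a k * U b k := by
          rw [Finset.sum_comm]
          refine Finset.sum_congr rfl fun a _ => ?_
          rw [Finset.sum_comm]
          exact Finset.sum_congr rfl fun b _ => (Finset.mul_sum _ _ _).symm
      _ = 1 := by
          simp only [hU', Subtype.coe_inj, mul_ite, mul_one, mul_zero, Finset.sum_ite_eq,
            Finset.mem_univ, if_true]
          rw [hW, if_pos rfl]
  · calc ∑ i, (∑ a : A, W a i * U a k) ^ 2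
        = ∑ i, ∑ a : A, ∑ b : A, U a k * U b k * (W a i * W b i) := by
          refine Finset.sum_congr rfl fun i _ => ?_
          rw [sq, Finset.sum_mul_sum]
          exact Finset.sum_congr rfl fun a _ => Finset.sum_congr rfl fun b _ => by ring
      _ = ∑ a : A, ∑ b : A, U a k * U b k * ∑ i, W a i * W b i := by
          rw [Finset.sum_comm]
          refine Finset.sum_congr rfl fun a _ => ?_
          rw [Finset.sum_comm]
          exact Finset.sum_congr rfl fun b _ => (Finset.mul_sum _ _ _).symm
      _ = ∑ a ∈ A, U a k ^ 2 := by
          simp only [hW', mul_ite, mul_one, mul_zero, Finset.sum_ite_eq, Finset.mem_univ, if_true]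
          rw [Finset.sum_coe_sort A (fun a => U a k * U a k)]
          exact Finset.sum_congr rfl fun a _ => (sq _).symm
  · have h1 : Wᵀ * ((funMat hV φ).submatrix ((↑) : A → n) (↑)) * W
        = Matrix.diagonal hB.eigenvalues := by
      rw [Matrix.mul_assoc, mul_eigMat hB, ← Matrix.mul_assoc, eigMat_transpose_mul, Matrix.one_mul]
    have h2 := congrFun (congrFun h1 i) i
    rw [Matrix.diagonal_apply_eq, Matrix.mul_apply] at h2
    simp only [Matrix.mul_apply, Matrix.transpose_apply, Matrix.submatrix_apply, funMat_apply] at h2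
    rw [← h2]
    calc ∑ b : A, (∑ a : A, W a i * ∑ k, U a k * φ (hV.eigenvalues k) * U b k) * W b i
        = ∑ b : A, ∑ k, ∑ a : A, W a i * U a k * (W b i * U b k) * φ (hV.eigenvalues k) := by
          refine Finset.sum_congr rfl fun b _ => ?_
          rw [Finset.sum_mul, Finset.sum_comm]
          refine Finset.sum_congr rfl fun a _ => ?_
          rw [Finset.mul_sum, Finset.sum_mul]
          exact Finset.sum_congr rfl fun k _ => by ring
      _ = ∑ k, ∑ b : A, ∑ a : A, W a i * U a k * (W b i * U b k) * φ (hV.eigenvalues k) :=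
          Finset.sum_comm
      _ = _ := by
          refine Finset.sum_congr rfl fun k _ => ?_
          simp only
          rw [sq, Finset.sum_mul_sum, Finset.sum_comm, Finset.sum_mul]
          exact Finset.sum_congr rfl fun a _ => (Finset.sum_mul _ _ _).symm

/-- The eigenvalues of a block lie in every convex set that contains those of `φ(V)`. -/
theorem block_eigenvalues_mem {hV : V.IsHermitian} {φ : ℝ → ℝ} {I : Set ℝ} (hI : Convex ℝ I)
    (hφ : ∀ k, φ (hV.eigenvalues k) ∈ I) (A : Finset n) (i : A) :
    (block_isHermitian hV φ A).eigenvalues i ∈ I := by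
  obtain ⟨p, hp0, hp1, -, hp⟩ := exists_block_weights hV φ A
  rw [hp]
  exact hI.sum_mem (fun k _ => hp0 i k) (hp1 i) (fun k _ => hφ k)

/-- The defect `tr g(φ(V)_{AA}) + tr g(φ(V)_{BB}) - tr g(φ(V))` of the block decomposition with
`B = Aᶜ`. -/
def blockDefect (hV : V.IsHermitian) (φ g : ℝ → ℝ) (A : Finset n) : ℝ :=
  ∑ i, g ((block_isHermitian hV φ A).eigenvalues i)
    + ∑ i, g ((block_isHermitian hV φ Aᶜ).eigenvalues i) - ∑ k, g (φ (hV.eigenvalues k))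

theorem blockDefect_add (hV : V.IsHermitian) (φ g h : ℝ → ℝ) (A : Finset n) :
    blockDefect hV φ (fun x => g x + h x) A = blockDefect hV φ g A + blockDefect hV φ h A := by
  simp only [blockDefect, Finset.sum_add_distrib]; ring

theorem blockDefect_const_mul (hV : V.IsHermitian) (φ g : ℝ → ℝ) (c : ℝ) (A : Finset n) :
    blockDefect hV φ (fun x => c * g x) A = c * blockDefect hV φ g A := by
  simp only [blockDefect, ← Finset.mul_sum]; ring

/-- Peierls' inequality for the pinching onto the blocks `A` and `Aᶜ`. -/
theorem blockDefect_nonpos {hV : V.IsHermitian} {φ g : ℝ → ℝ} {I : Set ℝ} (hg : ConvexOn ℝ I g)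
    (hφ : ∀ k, φ (hV.eigenvalues k) ∈ I) (A : Finset n) : blockDefect hV φ g A ≤ 0 := by
  have key : ∀ B : Finset n, ∑ i, g ((block_isHermitian hV φ B).eigenvalues i)
      ≤ ∑ k, (∑ a ∈ B, eigMat hV a k ^ 2) * g (φ (hV.eigenvalues k)) := by
    intro B
    obtain ⟨p, hp0, hp1, hp2, hp⟩ := exists_block_weights hV φ B
    calc ∑ i, g ((block_isHermitian hV φ B).eigenvalues i)
        ≤ ∑ i, ∑ k, p i k * g (φ (hV.eigenvalues k)) := by
          refine Finset.sum_le_sum fun i _ => ?_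
          rw [hp]
          exact hg.map_sum_le (fun k _ => hp0 i k) (hp1 i) (fun k _ => hφ k)
      _ = _ := by
          rw [Finset.sum_comm]
          refine Finset.sum_congr rfl fun k _ => ?_
          rw [← hp2, Finset.sum_mul]
  have h1 := key A
  have h2 := key Aᶜ
  have h3 : ∑ k, (∑ a ∈ A, eigMat hV a k ^ 2) * g (φ (hV.eigenvalues k))
      + ∑ k, (∑ a ∈ Aᶜ, eigMat hV a k ^ 2) * g (φ (hV.eigenvalues k))
      = ∑ k, g (φ (hV.eigenvalues k)) := by
    rw [← Finset.sum_add_distrib]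
    refine Finset.sum_congr rfl fun k _ => ?_
    rw [← add_mul, Finset.sum_add_sum_compl]
    have := congrFun (congrFun (eigMat_transpose_mul hV) k) k
    rw [Matrix.mul_apply, Matrix.one_apply_eq] at this
    simp only [Matrix.transpose_apply, ← sq] at this
    rw [this, one_mul]
  unfold blockDefect
  linarith

theorem blockDefect_pow (hV : V.IsHermitian) (φ : ℝ → ℝ) (m : ℕ) (A : Finset n) :
    blockDefect hV φ (fun x => x ^ m) A
      = (((funMat hV φ).submatrix ((↑) : A → n) (↑)) ^ m).trace
        + (((funMat hV φ).submatrix ((↑) : ↥Aᶜ → n) (↑)) ^ m).trace - (funMat hV φ ^ m).trace := by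
  rw [blockDefect, sum_eigenvalues_pow, sum_eigenvalues_pow, funMat_pow, trace_funMat]

/-- The matrix elements of the projection onto the block `A` between eigenvectors of `V`. -/
def overlap (hV : V.IsHermitian) (A : Finset n) (k l : n) : ℝ :=
  ∑ a ∈ A, eigMat hV a k * eigMat hV a l

/-- The quadratic form `∑_{k,l} |⟨k|P_A|l⟩|² F(v_k, v_l)` over pairs of eigenvectors of `V`. -/
def pairSum (hV : V.IsHermitian) (A : Finset n) (F : ℝ → ℝ → ℝ) : ℝ :=
  ∑ k, ∑ l, overlap hV A k l ^ 2 * F (hV.eigenvalues k) (hV.eigenvalues l)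

theorem pairSum_add (hV : V.IsHermitian) (A : Finset n) (F G : ℝ → ℝ → ℝ) :
    pairSum hV A (fun x y => F x y + G x y) = pairSum hV A F + pairSum hV A G := by
  simp only [pairSum, mul_add, Finset.sum_add_distrib]

theorem pairSum_const_mul (hV : V.IsHermitian) (A : Finset n) (c : ℝ) (F : ℝ → ℝ → ℝ) :
    pairSum hV A (fun x y => c * F x y) = c * pairSum hV A F := by
  simp only [pairSum, Finset.mul_sum]
  exact Finset.sum_congr rfl fun k _ => Finset.sum_congr rfl fun l _ => by ring

theorem pairSum_le {hV : V.IsHermitian} {A : Finset n} {F G : ℝ → ℝ → ℝ}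
    (h : ∀ k l, F (hV.eigenvalues k) (hV.eigenvalues l) ≤ G (hV.eigenvalues k) (hV.eigenvalues l)) :
    pairSum hV A F ≤ pairSum hV A G :=
  Finset.sum_le_sum fun k _ => Finset.sum_le_sum fun l _ =>
    mul_le_mul_of_nonneg_left (h k l) (sq_nonneg _)

theorem pairSum_congr {hV : V.IsHermitian} {A : Finset n} {F G : ℝ → ℝ → ℝ}
    (h : ∀ k l, F (hV.eigenvalues k) (hV.eigenvalues l) = G (hV.eigenvalues k) (hV.eigenvalues l)) :
    pairSum hV A F = pairSum hV A G :=
  Finset.sum_congr rfl fun k _ => Finset.sum_congr rfl fun l _ => by rw [h]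

/-- The pair sum of a product of increments measures the off-diagonal blocks. -/
theorem pairSum_increments (hV : V.IsHermitian) (A : Finset n) (φ χ : ℝ → ℝ) :
    pairSum hV A (fun x y => (φ x - φ y) * (χ x - χ y))
      = 2 * ∑ a ∈ A, ∑ b ∈ Aᶜ, funMat hV φ a b * funMat hV χ a b := by
  set U := eigMat hV
  set v := hV.eigenvalues
  set W := overlap hV A with hW
  have hU : ∀ a b, ∑ k, U a k * U b k = if a = b then 1 else 0 := by
    intro i j
    have := congrFun (congrFun (eigMat_mul_transpose hV) i) j
    rwa [Matrix.mul_apply, Matrix.one_apply] at this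
  have hsymm : ∀ k l, W k l = W l k := fun k l => by
    simp only [hW, overlap]; exact Finset.sum_congr rfl fun a _ => mul_comm _ _
  have hsq : ∀ k, ∑ l, W k l ^ 2 = W k k := by
    intro k
    calc ∑ l, W k l ^ 2
        = ∑ l, ∑ a ∈ A, ∑ b ∈ A, U a k * U b k * (U a l * U b l) := by
          refine Finset.sum_congr rfl fun l _ => ?_
          rw [sq, hW, overlap, Finset.sum_mul_sum]
          exact Finset.sum_congr rfl fun a _ => Finset.sum_congr rfl fun b _ => by ring
      _ = ∑ a ∈ A, ∑ b ∈ A, U a k * U b k * ∑ l, U a l * U b l := by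
          rw [Finset.sum_comm]
          refine Finset.sum_congr rfl fun a _ => ?_
          rw [Finset.sum_comm]
          exact Finset.sum_congr rfl fun b _ => (Finset.mul_sum _ _ _).symm
      _ = W k k := by
          simp only [hU, mul_ite, mul_one, mul_zero, Finset.sum_ite_eq]
          rw [hW, overlap]
          exact Finset.sum_congr rfl fun a ha => if_pos ha
  -- the two sides both equal twice `tr (P φχ) - tr (P φ P χ)`
  have hL : pairSum hV A (fun x y => (φ x - φ y) * (χ x - χ y))
      = 2 * (∑ k, W k k * (φ (v k) * χ (v k)) - ∑ k, ∑ l, W k l ^ 2 * (φ (v k) * χ (v l))) := by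
    have e1 : ∑ k, ∑ l, W k l ^ 2 * (φ (v k) * χ (v k)) = ∑ k, W k k * (φ (v k) * χ (v k)) :=
      Finset.sum_congr rfl fun k _ => by rw [← Finset.sum_mul, hsq]
    have e2 : ∑ k, ∑ l, W k l ^ 2 * (φ (v l) * χ (v l)) = ∑ k, W k k * (φ (v k) * χ (v k)) := by
      rw [Finset.sum_comm, ← e1]
      exact Finset.sum_congr rfl fun k _ => Finset.sum_congr rfl fun l _ => by rw [hsymm]
    have e3 : ∑ k, ∑ l, W k l ^ 2 * (φ (v l) * χ (v k))
        = ∑ k, ∑ l, W k l ^ 2 * (φ (v k) * χ (v l)) := by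
      rw [Finset.sum_comm]
      exact Finset.sum_congr rfl fun k _ => Finset.sum_congr rfl fun l _ => by rw [hsymm]
    calc _ = ∑ k, ∑ l, W k l ^ 2 * (φ (v k) * χ (v k)) + ∑ k, ∑ l, W k l ^ 2 * (φ (v l) * χ (v l))
          - ∑ k, ∑ l, W k l ^ 2 * (φ (v l) * χ (v k))
          - ∑ k, ∑ l, W k l ^ 2 * (φ (v k) * χ (v l)) := by
          simp only [← Finset.sum_add_distrib, ← Finset.sum_sub_distrib, pairSum]
          exact Finset.sum_congr rfl fun k _ => Finset.sum_congr rfl fun l _ => by ring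
      _ = _ := by rw [e1, e2, e3]; ring
  have hR1 : ∑ a ∈ A, ∑ b ∈ A, funMat hV φ a b * funMat hV χ a b
      = ∑ k, ∑ l, W k l ^ 2 * (φ (v k) * χ (v l)) := by
    calc _ = ∑ a ∈ A, ∑ b ∈ A, ∑ k, ∑ l,
            U a k * U b k * (U a l * U b l) * (φ (v k) * χ (v l)) := by
          refine Finset.sum_congr rfl fun a _ => Finset.sum_congr rfl fun b _ => ?_
          rw [funMat_apply, funMat_apply, Finset.sum_mul_sum]
          exact Finset.sum_congr rfl fun k _ => Finset.sum_congr rfl fun l _ => by ring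
      _ = ∑ k, ∑ l, ∑ a ∈ A, ∑ b ∈ A,
            U a k * U b k * (U a l * U b l) * (φ (v k) * χ (v l)) := by
          rw [Finset.sum_congr rfl fun a _ => Finset.sum_comm, Finset.sum_comm]
          refine Finset.sum_congr rfl fun k _ => ?_
          rw [Finset.sum_congr rfl fun a _ => Finset.sum_comm, Finset.sum_comm]
      _ = _ := by
          refine Finset.sum_congr rfl fun k _ => Finset.sum_congr rfl fun l _ => ?_
          rw [sq, hW, overlap, Finset.sum_mul_sum, Finset.sum_mul]
          refine Finset.sum_congr rfl fun a _ => ?_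
          rw [Finset.sum_mul]
          exact Finset.sum_congr rfl fun b _ => by ring
  have hR2 : ∑ a ∈ A, ∑ b, funMat hV φ a b * funMat hV χ a b
      = ∑ k, W k k * (φ (v k) * χ (v k)) := by
    calc _ = ∑ a ∈ A, (funMat hV φ * funMat hV χ) a a := by
          refine Finset.sum_congr rfl fun a _ => ?_
          rw [Matrix.mul_apply]
          exact Finset.sum_congr rfl fun b _ => by rw [funMat_apply_comm hV χ b a]
      _ = ∑ a ∈ A, ∑ k, U a k * U a k * (φ (v k) * χ (v k)) := by
          refine Finset.sum_congr rfl fun a _ => ?_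
          rw [funMat_mul, funMat_apply]
          exact Finset.sum_congr rfl fun k _ => by ring
      _ = _ := by
          rw [Finset.sum_comm]
          refine Finset.sum_congr rfl fun k _ => ?_
          rw [hW, overlap, Finset.sum_mul]
  rw [hL, ← hR1, ← hR2]
  congr 1
  rw [← Finset.sum_sub_distrib]
  refine Finset.sum_congr rfl fun a _ => ?_
  rw [← Finset.sum_add_sum_compl A fun b => funMat hV φ a b * funMat hV χ a b]
  ring

/-- For the square, the block defect is minus the squared Frobenius norm of the off-diagonal blocks. -/
theorem blockDefect_sq (hV : V.IsHermitian) (φ : ℝ → ℝ) (A : Finset n) :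
    blockDefect hV φ (fun x => x ^ 2) A
      = -pairSum hV A (fun x y => (φ x - φ y) * (φ x - φ y)) := by
  rw [blockDefect_pow, pairSum_increments]
  have h1 : ∀ B : Finset n, (((funMat hV φ).submatrix ((↑) : B → n) (↑)) ^ 2).trace
      = ∑ a ∈ B, ∑ b ∈ B, funMat hV φ a b * funMat hV φ a b := by
    intro B
    rw [sq, Matrix.trace, ← Finset.sum_coe_sort B]
    refine Finset.sum_congr rfl fun a _ => ?_
    rw [Matrix.diag_apply, Matrix.mul_apply, ← Finset.sum_coe_sort B]
    refine Finset.sum_congr rfl fun b _ => ?_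
    rw [Matrix.submatrix_apply, Matrix.submatrix_apply, funMat_apply_comm hV φ b a]
  have h2 : (funMat hV φ ^ 2).trace = ∑ a, ∑ b, funMat hV φ a b * funMat hV φ a b := by
    rw [sq, Matrix.trace]
    refine Finset.sum_congr rfl fun a _ => ?_
    rw [Matrix.diag_apply, Matrix.mul_apply]
    exact Finset.sum_congr rfl fun b _ => by rw [funMat_apply_comm hV φ b a]
  rw [h1, h1, h2, ← Finset.sum_add_sum_compl A]
  have h3 : ∀ a, ∑ b, funMat hV φ a b * funMat hV φ a b
      = ∑ b ∈ A, funMat hV φ a b * funMat hV φ a b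
        + ∑ b ∈ Aᶜ, funMat hV φ a b * funMat hV φ a b :=
    fun a => (Finset.sum_add_sum_compl A _).symm
  simp only [h3, Finset.sum_add_distrib]
  have h4 : ∑ a ∈ Aᶜ, ∑ b ∈ A, funMat hV φ a b * funMat hV φ a b
      = ∑ a ∈ A, ∑ b ∈ Aᶜ, funMat hV φ a b * funMat hV φ a b := by
    rw [Finset.sum_comm]
    exact Finset.sum_congr rfl fun a _ => Finset.sum_congr rfl fun b _ => by
      rw [funMat_apply_comm hV φ b a]
  rw [h4]; ring

/-- A second derivative bounded by `C` bounds the block defect by the off-diagonal blocks. -/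
theorem abs_blockDefect_le {hV : V.IsHermitian} {φ g : ℝ → ℝ} {I : Set ℝ} {C : ℝ}
    (hg₁ : ConvexOn ℝ I fun x => C / 2 * x ^ 2 + g x)
    (hg₂ : ConvexOn ℝ I fun x => C / 2 * x ^ 2 + (-1) * g x)
    (hφ : ∀ k, φ (hV.eigenvalues k) ∈ I) (A : Finset n) :
    |blockDefect hV φ g A|
      ≤ C / 2 * pairSum hV A (fun x y => (φ x - φ y) * (φ x - φ y)) := by
  have h1 := blockDefect_nonpos hg₁ hφ A
  have h2 := blockDefect_nonpos hg₂ hφ A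
  rw [blockDefect_add, blockDefect_const_mul, blockDefect_sq] at h1 h2
  rw [blockDefect_const_mul] at h2
  rw [abs_le]
  constructor <;> linarith

end Spectral

/-! ### Banded circulant matrices and closed paths -/

section Circulant

/-- The `N × N` circulant matrix with weight `c k` for a step by `d k`, summed over `k`. -/
def circ (N : ℕ) {κ : Type} [Fintype κ] (d : κ → ℤ) (c : κ → ℝ) : Matrix (Fin N) (Fin N) ℝ :=
  Matrix.of fun i j => ∑ k, if (N : ℤ) ∣ (i : ℤ) + d k - j then c k else 0

theorem existsUnique_fin_dvd {N : ℕ} (hN : 0 < N) (m : ℤ) : ∃ l : Fin N, (N : ℤ) ∣ m - l ∧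
    ∀ l' : Fin N, (N : ℤ) ∣ m - l' → l' = l := by
  have hN' : (0 : ℤ) < N := by exact_mod_cast hN
  have h1 := Int.emod_nonneg m hN'.ne'
  have h2 := Int.emod_lt_of_pos m hN'
  refine ⟨⟨(m % N).toNat, by omega⟩, ?_, ?_⟩
  · simp only [Int.toNat_of_nonneg h1]
    exact Int.dvd_self_sub_emod
  · intro l' hl'
    have h3 : (m % N) = (l' : ℤ) := by
      rw [Int.emod_eq_emod_iff_emod_sub_eq_zero.2 (Int.emod_eq_zero_of_dvd hl'),
        Int.emod_eq_of_lt (by positivity) (by exact_mod_cast l'.2)]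
    ext
    simp only
    omega

theorem circ_mul {N : ℕ} {κ κ' : Type} [Fintype κ] [Fintype κ'] (d : κ → ℤ) (c : κ → ℝ)
    (d' : κ' → ℤ) (c' : κ' → ℝ) :
    circ N d c * circ N d' c'
      = circ N (fun p : κ × κ' => d p.1 + d' p.2) (fun p => c p.1 * c' p.2) := by
  ext i j
  have hN : 0 < N := i.pos
  simp only [Matrix.mul_apply, circ, Matrix.of_apply, Finset.sum_mul_sum]
  rw [Fintype.sum_prod_type, Finset.sum_comm]
  refine Finset.sum_congr rfl fun k _ => ?_
  rw [Finset.sum_comm]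
  refine Finset.sum_congr rfl fun k' _ => ?_
  obtain ⟨l, hl, hl'⟩ := existsUnique_fin_dvd hN ((i : ℤ) + d k)
  rw [Finset.sum_eq_single l]
  · rw [if_pos hl]
    have : (N : ℤ) ∣ (l : ℤ) + d' k' - j ↔ (N : ℤ) ∣ (i : ℤ) + (d k + d' k') - j := by
      rw [← dvd_add_right hl]
      ring_nf
    simp only [this]
    split_ifs <;> simp
  · intro b _ hb
    rw [if_neg (fun h => hb (hl' b h)), zero_mul]
  · simp

theorem circ_equiv {N : ℕ} {κ κ' : Type} [Fintype κ] [Fintype κ'] (e : κ' ≃ κ) (d : κ → ℤ)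
    (c : κ → ℝ) : circ N (d ∘ e) (c ∘ e) = circ N d c := by
  ext i j
  exact e.sum_comp fun k => if (N : ℤ) ∣ (i : ℤ) + d k - j then c k else 0

theorem circ_zero {N : ℕ} {κ : Type} [Unique κ] (c : κ → ℝ) :
    circ N (fun _ : κ => 0) c = Matrix.diagonal fun _ => c default := by
  ext i j
  simp only [circ, Matrix.of_apply, Fintype.sum_unique, add_zero, Matrix.diagonal_apply]
  congr 1
  rw [eq_iff_iff]
  constructor
  · intro h
    have hN : 0 < N := i.pos
    have h1 := Int.eq_zero_of_abs_lt_dvd h (by rw [abs_lt]; omega)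
    ext; omega
  · rintro rfl; simp

theorem circ_add {N : ℕ} {κ κ' : Type} [Fintype κ] [Fintype κ'] (d : κ → ℤ) (c : κ → ℝ)
    (d' : κ' → ℤ) (c' : κ' → ℝ) :
    circ N d c + circ N d' c' = circ N (Sum.elim d d') (Sum.elim c c') := by
  ext i j
  simp only [circ, Matrix.add_apply, Matrix.of_apply, Fintype.sum_sum_type]
  rfl

/-- The total displacement of a path. -/
def disp {κ : Type} (d : κ → ℤ) {n : ℕ} (k : Fin n → κ) : ℤ := ∑ i, d (k i)

/-- The weight of a path. -/
def pathWt {κ : Type} (c : κ → ℝ) {n : ℕ} (k : Fin n → κ) : ℝ := ∏ i, c (k i)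

variable {κ : Type}

theorem disp_cons (d : κ → ℤ) {n : ℕ} (x : κ) (k : Fin n → κ) :
    disp d (Fin.cons x k : Fin (n + 1) → κ) = d x + disp d k := by
  simp [disp, Fin.sum_univ_succ]

theorem pathWt_cons (c : κ → ℝ) {n : ℕ} (x : κ) (k : Fin n → κ) :
    pathWt c (Fin.cons x k : Fin (n + 1) → κ) = c x * pathWt c k := by
  simp [pathWt, Fin.prod_univ_succ]

theorem disp_snoc (d : κ → ℤ) {n : ℕ} (k : Fin n → κ) (x : κ) :
    disp d (Fin.snoc k x : Fin (n + 1) → κ) = disp d k + d x := by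
  simp [disp, Fin.sum_univ_castSucc]

theorem pathWt_snoc (c : κ → ℝ) {n : ℕ} (k : Fin n → κ) (x : κ) :
    pathWt c (Fin.snoc k x : Fin (n + 1) → κ) = pathWt c k * c x := by
  simp [pathWt, Fin.prod_univ_castSucc]

/-- The highest point reached by a path started at `0`. -/
def pmax (d : κ → ℤ) : ∀ {n : ℕ}, (Fin n → κ) → ℤ
  | 0, _ => 0
  | _ + 1, k => max 0 (d (k 0) + pmax d (Fin.tail k))

/-- The lowest point reached by a path started at `0`. -/
def pmin (d : κ → ℤ) : ∀ {n : ℕ}, (Fin n → κ) → ℤ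
  | 0, _ => 0
  | _ + 1, k => min 0 (d (k 0) + pmin d (Fin.tail k))

theorem pmax_zero (d : κ → ℤ) (k : Fin 0 → κ) : pmax d k = 0 := rfl

theorem pmin_zero (d : κ → ℤ) (k : Fin 0 → κ) : pmin d k = 0 := rfl

theorem pmax_cons (d : κ → ℤ) {n : ℕ} (x : κ) (k : Fin n → κ) :
    pmax d (Fin.cons x k : Fin (n + 1) → κ) = max 0 (d x + pmax d k) := by
  rw [pmax, Fin.tail_cons, Fin.cons_zero]

theorem pmin_cons (d : κ → ℤ) {n : ℕ} (x : κ) (k : Fin n → κ) :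
    pmin d (Fin.cons x k : Fin (n + 1) → κ) = min 0 (d x + pmin d k) := by
  rw [pmin, Fin.tail_cons, Fin.cons_zero]

theorem pmax_nonneg (d : κ → ℤ) {n : ℕ} (k : Fin n → κ) : 0 ≤ pmax d k := by
  cases n with
  | zero => exact le_rfl
  | succ n => exact le_max_left _ _

theorem pmin_nonpos (d : κ → ℤ) {n : ℕ} (k : Fin n → κ) : pmin d k ≤ 0 := by
  cases n with
  | zero => exact le_rfl
  | succ n => exact min_le_left _ _

theorem pmax_snoc (d : κ → ℤ) {n : ℕ} (k : Fin n → κ) (x : κ) :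
    pmax d (Fin.snoc k x : Fin (n + 1) → κ) = max (pmax d k) (disp d k + d x) := by
  induction n with
  | zero =>
    have h : pmax d (Fin.snoc k x : Fin (0 + 1) → κ) = max 0 (d x + 0) := rfl
    rw [h, pmax_zero]
    simp [disp]
  | succ n ih =>
    obtain ⟨y, k', rfl⟩ : ∃ y k', k = Fin.cons y k' := ⟨k 0, Fin.tail k, (Fin.cons_self_tail k).symm⟩
    rw [← Fin.cons_snoc_eq_snoc_cons, pmax_cons, pmax_cons, ih, disp_cons]
    have := pmax_nonneg d k'
    omega

theorem pmax_le (d : κ → ℤ) {L : ℤ} (hL0 : 0 ≤ L) (hL : ∀ x, |d x| ≤ L) {n : ℕ} (k : Fin n → κ) :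
    pmax d k ≤ n * L := by
  induction n with
  | zero => simp [pmax_zero]
  | succ n ih =>
    have h1 := ih (Fin.tail k)
    have h2 := (abs_le.1 (hL (k 0))).2
    rw [pmax]
    push_cast
    refine max_le (by positivity) (by linarith)

theorem pmin_eq_neg_pmax (d : κ → ℤ) {σ : κ ≃ κ} (hσ : ∀ x, d (σ x) = -d x) {n : ℕ}
    (k : Fin n → κ) : pmin d k = -pmax d (σ ∘ k) := by
  induction n with
  | zero => simp [pmax_zero, pmin_zero]
  | succ n ih =>
    have h : Fin.tail (σ ∘ k) = σ ∘ Fin.tail k := rfl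
    rw [pmin, pmax, ih, h, Function.comp_apply, hσ]
    omega

theorem abs_disp_le (d : κ → ℤ) {L : ℤ} (hL : ∀ x, |d x| ≤ L) {n : ℕ} (k : Fin n → κ) :
    |disp d k| ≤ n * L := by
  calc |disp d k| ≤ ∑ i, |d (k i)| := Finset.abs_sum_le_sum_abs _ _
    _ ≤ ∑ _i : Fin n, L := Finset.sum_le_sum fun i _ => hL _
    _ = n * L := by simp

theorem disp_comp {d : κ → ℤ} {σ : κ ≃ κ} (hσ : ∀ x, d (σ x) = -d x) {n : ℕ} (k : Fin n → κ) :
    disp d (σ ∘ k) = -disp d k := by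
  simp [disp, hσ]

theorem pathWt_comp {c : κ → ℝ} {σ : κ ≃ κ} (hσ : ∀ x, c (σ x) = c x) {n : ℕ} (k : Fin n → κ) :
    pathWt c (σ ∘ k) = pathWt c k := by
  simp [pathWt, hσ]

variable [Fintype κ]

theorem sum_path_cons {M : Type*} [AddCommMonoid M] {n : ℕ} (f : (Fin (n + 1) → κ) → M) :
    ∑ k, f k = ∑ x, ∑ k : Fin n → κ, f (Fin.cons x k) := by
  rw [← Fintype.sum_prod_type', ← (Fin.consEquiv fun _ => κ).sum_comp]
  rfl

theorem sum_path_snoc {M : Type*} [AddCommMonoid M] {n : ℕ} (f : (Fin (n + 1) → κ) → M) :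
    ∑ k, f k = ∑ x, ∑ k : Fin n → κ, f (Fin.snoc k x) := by
  rw [← Fintype.sum_prod_type', ← (Fin.snocEquiv fun _ => κ).sum_comp]
  rfl

theorem circ_pow {N : ℕ} (d : κ → ℤ) (c : κ → ℝ) (n : ℕ) :
    circ N d c ^ n = circ N (disp d (n := n)) (pathWt c) := by
  induction n with
  | zero =>
    have h : (disp d (n := 0)) = fun _ => 0 := by funext k; simp [disp]
    have h1 : (1 : Matrix (Fin N) (Fin N) ℝ) = Matrix.diagonal fun _ => pathWt c (default : Fin 0 → κ) := by
      simp [pathWt]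
    rw [pow_zero, h, h1, ← circ_zero]
    congr!
  | succ n ih =>
    rw [pow_succ', ih, circ_mul, ← circ_equiv (Fin.consEquiv fun _ => κ) (disp d) (pathWt c)]
    congr 1
    · funext p; exact (disp_cons d p.1 p.2).symm
    · funext p; exact (pathWt_cons c p.1 p.2).symm

/-- The `m × m` Toeplitz matrix with weight `c k` for a step by `d k`, summed over `k`. -/
def toep (m : ℕ) (d : κ → ℤ) (c : κ → ℝ) : Matrix (Fin m) (Fin m) ℝ :=
  Matrix.of fun i j => ∑ k, if (i : ℤ) + d k = j then c k else 0

/-- A power of a Toeplitz matrix counts the paths that stay in `{0, …, m - 1}`. -/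
theorem toep_pow_apply {m : ℕ} (d : κ → ℤ) (c : κ → ℝ) (n : ℕ) (i j : Fin m) :
    (toep m d c ^ n) i j = ∑ k : Fin n → κ,
      if 0 ≤ (i : ℤ) + pmin d k ∧ (i : ℤ) + pmax d k < m ∧ (i : ℤ) + disp d k = j
        then pathWt c k else 0 := by
  induction n generalizing i with
  | zero =>
    simp only [pow_zero, pmin_zero, pmax_zero, add_zero, disp, Finset.univ_eq_empty,
      Finset.sum_empty, pathWt, Finset.prod_empty, Fintype.sum_unique, Matrix.one_apply]
    congr 1
    rw [eq_iff_iff]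
    constructor
    · rintro rfl; exact ⟨by positivity, by exact_mod_cast i.2, rfl⟩
    · rintro ⟨-, -, h⟩; ext; exact_mod_cast h
  | succ n ih =>
    rw [pow_succ', Matrix.mul_apply, sum_path_cons]
    simp only [toep, Matrix.of_apply, Finset.sum_mul]
    rw [Finset.sum_comm]
    refine Finset.sum_congr rfl fun x _ => ?_
    by_cases hx : 0 ≤ (i : ℤ) + d x ∧ (i : ℤ) + d x < m
    · have hl : ((i : ℤ) + d x).toNat < m := by omega
      rw [Finset.sum_eq_single ⟨((i : ℤ) + d x).toNat, hl⟩]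
      · rw [if_pos (by simp only; omega)]
        have := ih ⟨((i : ℤ) + d x).toNat, hl⟩
        unfold toep at this
        rw [this, Finset.mul_sum]
        refine Finset.sum_congr rfl fun k _ => ?_
        simp only [pmax_cons, pmin_cons, disp_cons, pathWt_cons]
        rw [mul_ite, mul_zero]
        congr 1
        have := i.2
        have h1 := pmax_nonneg d k
        have h2 := pmin_nonpos d k
        rw [eq_iff_iff]
        omega
      · intro b _ hb
        rw [if_neg, zero_mul]
        intro h
        apply hb
        ext
        simp only
        omega
      · simp
    · rw [Finset.sum_eq_zero, Finset.sum_eq_zero]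
      · intro k _
        rw [if_neg]
        rintro ⟨h1, h2, -⟩
        rw [pmin_cons] at h1
        rw [pmax_cons] at h2
        have h3 := pmax_nonneg d k
        have h4 := pmin_nonpos d k
        omega
      · intro b _
        rw [if_neg, zero_mul]
        intro h
        have := b.2
        omega

theorem card_fin_shift {m : ℕ} {s t : ℤ} (hs : s ≤ 0) (ht : 0 ≤ t) (hst : t - s ≤ m) :
    (((Finset.univ : Finset (Fin m)).filter
      fun i : Fin m => 0 ≤ (i : ℤ) + s ∧ (i : ℤ) + t < m).card : ℤ) = m - (t - s) := by
  have h : ((Finset.univ : Finset (Fin m)).filter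
      fun i : Fin m => 0 ≤ (i : ℤ) + s ∧ (i : ℤ) + t < m).card
      = (Finset.Ico (-s).toNat ((m : ℤ) - t).toNat).card := by
    refine Finset.card_bij (fun i _ => (i : ℕ)) ?_ ?_ ?_
    · intro i hi
      simp only [Finset.mem_filter, Finset.mem_univ, true_and] at hi
      rw [Finset.mem_Ico]
      omega
    · intro i _ j _ h
      exact Fin.ext h
    · intro b hb
      rw [Finset.mem_Ico] at hb
      refine ⟨⟨b, by omega⟩, ?_, rfl⟩
      simp only [Finset.mem_filter, Finset.mem_univ, true_and]
      omega
  rw [h, Nat.card_Ico]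
  omega

/-- A closed path fits into `{0, …, m - 1}` from `m` minus its height many starting points. -/
theorem trace_toep_pow {m : ℕ} (d : κ → ℤ) (c : κ → ℝ) {L : ℤ} (hL0 : 0 ≤ L)
    (hL : ∀ x, |d x| ≤ L) {σ : κ ≃ κ} (hσ : ∀ x, d (σ x) = -d x) (n : ℕ)
    (hm : 2 * (n * L) ≤ m) :
    (toep m d c ^ n).trace = ∑ k : Fin n → κ,
      if disp d k = 0 then pathWt c k * (m - (pmax d k - pmin d k : ℤ)) else 0 := by
  rw [Matrix.trace]
  simp only [Matrix.diag_apply, toep_pow_apply]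
  rw [Finset.sum_comm]
  refine Finset.sum_congr rfl fun k _ => ?_
  split_ifs with h
  · simp only [h, add_zero, and_true]
    rw [← Finset.sum_filter, Finset.sum_const, nsmul_eq_mul, mul_comm]
    congr 1
    have h1 := pmax_le d hL0 hL k
    have h2 := pmax_le d hL0 hL (σ ∘ k)
    have h3 := pmin_eq_neg_pmax d hσ k
    have := card_fin_shift (m := m) (pmin_nonpos d k) (pmax_nonneg d k) (by linarith)
    exact_mod_cast this
  · refine Finset.sum_eq_zero fun i _ => if_neg ?_
    rintro ⟨-, -, h'⟩
    exact h (by linarith)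

/-- If `N` is large compared with the number of steps, no path winds around the circle. -/
theorem trace_circ_pow {N : ℕ} (d : κ → ℤ) (c : κ → ℝ) {L : ℤ}
    (hL : ∀ x, |d x| ≤ L) (n : ℕ) (hN : n * L < N) :
    (circ N d c ^ n).trace
      = ∑ k : Fin n → κ, if disp d k = 0 then pathWt c k * N else 0 := by
  rw [circ_pow, Matrix.trace]
  simp only [Matrix.diag_apply, circ, Matrix.of_apply]
  rw [Finset.sum_comm]
  refine Finset.sum_congr rfl fun k _ => ?_
  have h : ∀ i : Fin N, ((N : ℤ) ∣ (i : ℤ) + disp d k - i) ↔ disp d k = 0 := by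
    intro i
    rw [add_sub_cancel_left]
    constructor
    · intro h
      exact Int.eq_zero_of_abs_lt_dvd h (by linarith [abs_disp_le d hL k])
    · intro h; rw [h]; exact dvd_zero _
  simp only [h]
  split_ifs <;> simp [mul_comm]

/-! ### Spitzer's identity -/

/-- The weighted sum of the maximum of a path and a function of its endpoint. -/
def maxSum (d : κ → ℤ) (c : κ → ℝ) (n : ℕ) (G : ℤ → ℝ) : ℝ :=
  ∑ k : Fin n → κ, pathWt c k * pmax d k * G (disp d k)

/-- The weighted sum of the positive part of the endpoint and a function of the endpoint. -/
def posSum (d : κ → ℤ) (c : κ → ℝ) (n : ℕ) (G : ℤ → ℝ) : ℝ :=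
  ∑ k : Fin n → κ, pathWt c k * (max (disp d k) 0 : ℤ) * G (disp d k)

/-- The average of `G` after `n` further steps. -/
def stepAvg (d : κ → ℤ) (c : κ → ℝ) (n : ℕ) (G : ℤ → ℝ) : ℤ → ℝ :=
  fun s => ∑ k : Fin n → κ, pathWt c k * G (s + disp d k)

/-- By exchangeability of the steps, the first step contributes an equal share. -/
theorem sum_first_step (d : κ → ℤ) (c : κ → ℝ) (n : ℕ) (H : ℤ → ℝ) :
    ∑ k : Fin (n + 1) → κ, pathWt c k * d (k 0) * H (disp d k)
      = (∑ k : Fin (n + 1) → κ, pathWt c k * disp d k * H (disp d k)) / (n + 1) := by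
  have h : ∀ j : Fin (n + 1), ∑ k : Fin (n + 1) → κ, pathWt c k * d (k j) * H (disp d k)
      = ∑ k : Fin (n + 1) → κ, pathWt c k * d (k 0) * H (disp d k) := by
    intro j
    rw [← ((Equiv.swap 0 j).arrowCongr (Equiv.refl κ)).sum_comp]
    refine Finset.sum_congr rfl fun k _ => ?_
    have e1 : pathWt c ((Equiv.swap 0 j).arrowCongr (Equiv.refl κ) k) = pathWt c k := by
      unfold pathWt
      exact (Equiv.swap 0 j).symm.prod_comp fun i => c (k i)
    have e2 : disp d ((Equiv.swap 0 j).arrowCongr (Equiv.refl κ) k) = disp d k := by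
      unfold disp
      exact (Equiv.swap 0 j).symm.sum_comp fun i => d (k i)
    rw [e1, e2]
    simp [Equiv.arrowCongr]
  rw [eq_div_iff (by positivity)]
  calc _ = ∑ _j : Fin (n + 1), ∑ k : Fin (n + 1) → κ, pathWt c k * d (k 0) * H (disp d k) := by
        simp; ring
    _ = ∑ j : Fin (n + 1), ∑ k : Fin (n + 1) → κ, pathWt c k * d (k j) * H (disp d k) :=
        Finset.sum_congr rfl fun j _ => (h j).symm
    _ = _ := by
        rw [Finset.sum_comm]
        refine Finset.sum_congr rfl fun k _ => ?_
        rw [← Finset.sum_mul, ← Finset.mul_sum]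
        simp [disp]

/-- The recursion for Spitzer's identity: a path that ends above `0` attains its maximum after
the first step, and a path that ends at or below `0` attains it before the last step. -/
theorem maxSum_succ (d : κ → ℤ) (c : κ → ℝ) (n : ℕ) (G : ℤ → ℝ) :
    maxSum d c (n + 1) G = maxSum d c n (stepAvg d c 1 G) + posSum d c (n + 1) G / (n + 1) := by
  set Gp : ℤ → ℝ := fun s => if 0 < s then G s else 0 with hGp
  set Gm : ℤ → ℝ := fun s => if 0 < s then 0 else G s with hGm
  have hG : ∀ s, G s = Gp s + Gm s := by
    intro s; simp only [hGp, hGm]; split_ifs <;> simp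
  have h1 : maxSum d c (n + 1) Gp
      = ∑ x, ∑ k : Fin n → κ, pathWt c k * c x * pmax d k * Gp (disp d k + d x) + posSum d c (n + 1) G / (n + 1) := by
    have e1 : posSum d c (n + 1) G
        = ∑ k : Fin (n + 1) → κ, pathWt c k * disp d k * Gp (disp d k) := by
      refine Finset.sum_congr rfl fun k _ => ?_
      simp only [hGp]
      split_ifs with h
      · rw [max_eq_left h.le]
      · rw [max_eq_right (not_lt.1 h)]; simp
    rw [e1, ← sum_first_step, maxSum, sum_path_cons, sum_path_cons, ← Finset.sum_add_distrib]
    refine Finset.sum_congr rfl fun x _ => ?_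
    rw [← Finset.sum_add_distrib]
    refine Finset.sum_congr rfl fun k _ => ?_
    rw [disp_cons, pathWt_cons, pmax_cons, Fin.cons_zero, add_comm (disp d k)]
    simp only [hGp]
    split_ifs with h
    · have h2 : d x + disp d k ≤ d x + pmax d k := by
        have : ∀ (n : ℕ) (k : Fin n → κ), disp d k ≤ pmax d k := by
          intro n
          induction n with
          | zero => intro k; simp [disp, pmax_zero]
          | succ n ih =>
            intro k
            obtain ⟨y, k', rfl⟩ : ∃ y k', k = Fin.cons y k' :=
              ⟨k 0, Fin.tail k, (Fin.cons_self_tail k).symm⟩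
            rw [disp_cons, pmax_cons]
            have := ih k'
            omega
        linarith [this n k]
      rw [max_eq_right (by linarith)]
      push_cast
      ring
    · simp
  have h2 : maxSum d c (n + 1) Gm
      = ∑ x, ∑ k : Fin n → κ, pathWt c k * c x * pmax d k * Gm (disp d k + d x) := by
    rw [maxSum, sum_path_snoc]
    refine Finset.sum_congr rfl fun x _ => Finset.sum_congr rfl fun k _ => ?_
    rw [disp_snoc, pathWt_snoc, pmax_snoc]
    simp only [hGm]
    split_ifs with h
    · simp
    · rw [max_eq_left (by have := pmax_nonneg d k; omega)]
  have h3 : maxSum d c (n + 1) G = maxSum d c (n + 1) Gp + maxSum d c (n + 1) Gm := by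
    simp only [maxSum, ← Finset.sum_add_distrib]
    exact Finset.sum_congr rfl fun k _ => by rw [hG]; ring
  have h4 : maxSum d c n (stepAvg d c 1 G)
      = ∑ x, ∑ k : Fin n → κ, pathWt c k * c x * pmax d k * G (disp d k + d x) := by
    rw [Finset.sum_comm]
    refine Finset.sum_congr rfl fun k _ => ?_
    rw [stepAvg, Finset.mul_sum, ← (Equiv.funUnique (Fin 1) κ).symm.sum_comp]
    refine Finset.sum_congr rfl fun x _ => ?_
    simp only [pathWt, disp, Fintype.prod_unique, Fintype.sum_unique, Equiv.funUnique_symm_apply,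
      uniqueElim_const]
    ring
  rw [h3, h1, h2, h4]
  have h5 : ∑ x, ∑ k : Fin n → κ, pathWt c k * c x * pmax d k * G (disp d k + d x)
      = ∑ x, ∑ k : Fin n → κ, pathWt c k * c x * pmax d k * Gp (disp d k + d x)
        + ∑ x, ∑ k : Fin n → κ, pathWt c k * c x * pmax d k * Gm (disp d k + d x) := by
    simp only [← Finset.sum_add_distrib]
    exact Finset.sum_congr rfl fun x _ => Finset.sum_congr rfl fun k _ => by rw [hG]; ring
  rw [h5]; ring

theorem stepAvg_stepAvg_one (d : κ → ℤ) (c : κ → ℝ) (n : ℕ) (G : ℤ → ℝ) :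
    stepAvg d c n (stepAvg d c 1 G) = stepAvg d c (n + 1) G := by
  funext s
  simp only [stepAvg]
  rw [sum_path_snoc, Finset.sum_comm]
  refine Finset.sum_congr rfl fun k _ => ?_
  rw [Finset.mul_sum, ← (Equiv.funUnique (Fin 1) κ).symm.sum_comp]
  refine Finset.sum_congr rfl fun x _ => ?_
  rw [disp_snoc, pathWt_snoc]
  simp only [pathWt, disp, Fintype.prod_unique, Fintype.sum_unique, Equiv.funUnique_symm_apply,
    uniqueElim_const]
  rw [add_assoc]
  ring

theorem stepAvg_zero (d : κ → ℤ) (c : κ → ℝ) (G : ℤ → ℝ) : stepAvg d c 0 G = G := by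
  funext s
  simp [stepAvg, pathWt, disp]

/-- **Spitzer's identity**, for weighted paths with a function of the endpoint. -/
theorem maxSum_eq (d : κ → ℤ) (c : κ → ℝ) (n : ℕ) (G : ℤ → ℝ) :
    maxSum d c n G
      = ∑ j ∈ Finset.range n, posSum d c (j + 1) (stepAvg d c (n - (j + 1)) G) / (j + 1) := by
  induction n generalizing G with
  | zero => simp [maxSum, pmax_zero]
  | succ n ih =>
    rw [maxSum_succ, ih, Finset.sum_range_succ, Nat.sub_self, stepAvg_zero]
    congr 1
    refine Finset.sum_congr rfl fun j hj => ?_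
    rw [stepAvg_stepAvg_one]
    congr 3
    have := Finset.mem_range.1 hj
    omega

/-- The sum over closed pairs of paths of `j` and `l` steps, weighted by the distance between their
endpoints. -/
def bondSum (d : κ → ℤ) (c : κ → ℝ) (j l : ℕ) : ℝ :=
  ∑ k : Fin j → κ, ∑ k' : Fin l → κ,
    if disp d k + disp d k' = 0 then pathWt c k * pathWt c k' * (|disp d k| : ℤ) else 0

/-- Under reflection symmetry of the steps, the positive part may be replaced by half the absolute value. -/
theorem posSum_stepAvg {d : κ → ℤ} {c : κ → ℝ} {σ : κ ≃ κ} (hσd : ∀ x, d (σ x) = -d x)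
    (hσc : ∀ x, c (σ x) = c x) (j l : ℕ) :
    posSum d c j (stepAvg d c l fun s => if s = 0 then 1 else 0) = bondSum d c j l / 2 := by
  have h1 : posSum d c j (stepAvg d c l fun s => if s = 0 then 1 else 0)
      = ∑ k : Fin j → κ, ∑ k' : Fin l → κ, if disp d k + disp d k' = 0
        then pathWt c k * pathWt c k' * (max (disp d k) 0 : ℤ) else 0 := by
    refine Finset.sum_congr rfl fun k _ => ?_
    rw [stepAvg, Finset.mul_sum]
    refine Finset.sum_congr rfl fun k' _ => ?_
    split_ifs <;> ring
  have h2 : posSum d c j (stepAvg d c l fun s => if s = 0 then 1 else 0)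
      = ∑ k : Fin j → κ, ∑ k' : Fin l → κ, if disp d k + disp d k' = 0
        then pathWt c k * pathWt c k' * (max (-disp d k) 0 : ℤ) else 0 := by
    rw [h1, ← (Equiv.arrowCongr (Equiv.refl (Fin j)) σ).sum_comp]
    refine Finset.sum_congr rfl fun k _ => ?_
    rw [← (Equiv.arrowCongr (Equiv.refl (Fin l)) σ).sum_comp]
    refine Finset.sum_congr rfl fun k' _ => ?_
    have e1 : ∀ {n : ℕ} (k : Fin n → κ), Equiv.arrowCongr (Equiv.refl (Fin n)) σ k = σ ∘ k :=
      fun k => rfl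
    rw [e1, e1, disp_comp hσd, disp_comp hσd, pathWt_comp hσc, pathWt_comp hσc]
    have : -disp d k + -disp d k' = 0 ↔ disp d k + disp d k' = 0 := by omega
    simp only [this]
  rw [eq_div_iff two_ne_zero, mul_two]
  nth_rewrite 1 [h1]
  rw [h2, ← Finset.sum_add_distrib]
  refine Finset.sum_congr rfl fun k _ => ?_
  rw [← Finset.sum_add_distrib]
  refine Finset.sum_congr rfl fun k' _ => ?_
  split_ifs
  · rw [← mul_add, ← Int.cast_add]
    congr 2
    rcases le_total 0 (disp d k) with h | h
    · rw [abs_of_nonneg h]; omega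
    · rw [abs_of_nonpos h]; omega
  · simp

end Circulant

/-! ### Circulant matrices restricted to the two blocks -/

section Blocks

/-- The block `{0, …, m - 1}` of sites. -/
def lowBlock (N m : ℕ) : Finset (Fin N) := Finset.univ.filter fun i => i.val < m

/-- The increasing enumeration of the block `{0, …, m - 1}`. -/
def lowBlockEquiv {N m : ℕ} (hm : m ≤ N) : Fin m ≃ lowBlock N m where
  toFun i := ⟨⟨i, i.2.trans_le hm⟩, by simp [lowBlock]⟩
  invFun i := ⟨i.1, by have := i.2; simpa [lowBlock] using this⟩
  left_inv i := rfl
  right_inv i := rfl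

/-- The increasing enumeration of the block `{m, …, N - 1}`. -/
def highBlockEquiv {N m : ℕ} (hm : m ≤ N) : Fin (N - m) ≃ ↥(lowBlock N m)ᶜ where
  toFun i := ⟨⟨m + i, by omega⟩, by simp [lowBlock]⟩
  invFun i := ⟨i.1 - m, by
    have h1 := i.2
    have h2 := i.1.2
    simp only [lowBlock, Finset.mem_compl, Finset.mem_filter, Finset.mem_univ, true_and] at h1
    omega⟩
  left_inv i := by ext; simp
  right_inv i := by
    have h1 := i.2
    simp only [lowBlock, Finset.mem_compl, Finset.mem_filter, Finset.mem_univ, true_and] at h1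
    ext
    simp only
    omega

theorem trace_submatrix_equiv_pow {S T : Type*} [Fintype S] [DecidableEq S] [Fintype T]
    [DecidableEq T] (e : S ≃ T) (M : Matrix T T ℝ) (n : ℕ) :
    ((M.submatrix e e) ^ n).trace = (M ^ n).trace := by
  have h : (M.submatrix e e) ^ n = (M ^ n).submatrix e e := by
    have := map_pow (Matrix.reindexAlgEquiv ℝ ℝ e.symm) M n
    simpa [Matrix.coe_reindexAlgEquiv, Matrix.reindex_apply] using this.symm
  rw [h, Matrix.trace, Matrix.trace, ← e.sum_comp]
  rfl

variable {κ κ' : Type} [Fintype κ] [Fintype κ']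

theorem dvd_iff_of_small {N m : ℕ} {L x : ℤ} (hL : |x| ≤ L) (hN : m + L ≤ N) (i j : Fin m) :
    (N : ℤ) ∣ (i : ℤ) + x - j ↔ (i : ℤ) + x = j := by
  constructor
  · intro h
    have := Int.eq_zero_of_abs_lt_dvd h (by
      have h1 := abs_le.1 hL
      have h2 := i.2
      have h3 := j.2
      rw [abs_lt]; constructor <;> omega)
    linarith
  · intro h; rw [h, sub_self]; exact dvd_zero _

/-- A circulant matrix restricted to a block is a Toeplitz matrix, if the remaining sites are too many
for a step across them. -/
theorem circ_lowBlock {N m : ℕ} (hm : m ≤ N) (d : κ → ℤ) (c : κ → ℝ) {L : ℤ}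
    (hL : ∀ x, |d x| ≤ L) (hN : m + L ≤ N) :
    ((circ N d c).submatrix ((↑) : lowBlock N m → Fin N) (↑)).submatrix (lowBlockEquiv hm)
      (lowBlockEquiv hm) = toep m d c := by
  ext i j
  simp only [circ, toep, Matrix.submatrix_apply, Matrix.of_apply, lowBlockEquiv, Equiv.coe_fn_mk]
  exact Finset.sum_congr rfl fun k _ => if_congr (dvd_iff_of_small (hL k) hN i j) rfl rfl

theorem circ_highBlock {N m : ℕ} (hm : m ≤ N) (d : κ → ℤ) (c : κ → ℝ) {L : ℤ}
    (hL : ∀ x, |d x| ≤ L) (hN : L ≤ m) :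
    ((circ N d c).submatrix ((↑) : ↥(lowBlock N m)ᶜ → Fin N) (↑)).submatrix (highBlockEquiv hm)
      (highBlockEquiv hm) = toep (N - m) d c := by
  ext i j
  simp only [circ, toep, Matrix.submatrix_apply, Matrix.of_apply, highBlockEquiv, Equiv.coe_fn_mk]
  refine Finset.sum_congr rfl fun k _ => if_congr ?_ rfl rfl
  rw [← dvd_iff_of_small (m := N - m) (N := N) (hL k) (by omega) i j]
  push_cast
  ring_nf

variable {N : ℕ} {V : Matrix (Fin N) (Fin N) ℝ}

/-- The block defect of `xⁿ` is a sum over closed paths, with the height of the path as weight. -/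
theorem blockDefect_pow_circ (hV : V.IsHermitian) {φ : ℝ → ℝ} {m : ℕ} (hm : m ≤ N) {d : κ → ℤ}
    {c : κ → ℝ} {L : ℤ} (hL0 : 0 < L) (hL : ∀ x, |d x| ≤ L) {σ : κ ≃ κ}
    (hσd : ∀ x, d (σ x) = -d x) (hσc : ∀ x, c (σ x) = c x) (hM : funMat hV φ = circ N d c) (n : ℕ)
    (h1 : 2 * (n * L) + L ≤ m) (h2 : m + (2 * (n * L) + L) ≤ N) :
    blockDefect hV φ (fun x => x ^ n) (lowBlock N m)
      = -2 * ∑ j ∈ Finset.range n, bondSum d c (j + 1) (n - (j + 1)) / (j + 1) := by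
  have hnL : 0 ≤ n * L := by positivity
  have hcast : ((N - m : ℕ) : ℤ) = N - m := by omega
  have hcast' : ((N - m : ℕ) : ℝ) = N - m := by exact_mod_cast hcast
  rw [blockDefect_pow, hM, ← trace_submatrix_equiv_pow (lowBlockEquiv hm),
    ← trace_submatrix_equiv_pow (highBlockEquiv hm), circ_lowBlock hm d c hL (by linarith),
    circ_highBlock hm d c hL (by linarith), trace_toep_pow d c hL0.le hL hσd n (by linarith),
    trace_toep_pow d c hL0.le hL hσd n (by rw [hcast]; linarith),
    trace_circ_pow d c hL n (by linarith), ← Finset.sum_add_distrib, ← Finset.sum_sub_distrib]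
  have e1 : ∑ k : Fin n → κ, (if disp d k = 0 then pathWt c k * (pmin d k : ℤ) else 0)
      = -∑ k : Fin n → κ, (if disp d k = 0 then pathWt c k * (pmax d k : ℤ) else 0) := by
    rw [← (Equiv.arrowCongr (Equiv.refl (Fin n)) σ).sum_comp, ← Finset.sum_neg_distrib]
    refine Finset.sum_congr rfl fun k _ => ?_
    have e : Equiv.arrowCongr (Equiv.refl (Fin n)) σ k = σ ∘ k := rfl
    have e' : σ ∘ σ ∘ k = fun i => σ (σ (k i)) := rfl
    have e2 : pmax d (σ ∘ σ ∘ k) = pmax d k := by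
      have : ∀ (n : ℕ) (k k' : Fin n → κ), (∀ i, d (k i) = d (k' i)) → pmax d k = pmax d k' := by
        intro n
        induction n with
        | zero => intro k k' _; rfl
        | succ n ih =>
          intro k k' h
          rw [pmax, pmax, h, ih (Fin.tail k) (Fin.tail k') fun i => h i.succ]
      exact this n _ _ fun i => by simp [hσd]
    rw [e, disp_comp hσd, pathWt_comp hσc, pmin_eq_neg_pmax d hσd, e2]
    simp only [neg_eq_zero]
    split_ifs <;> push_cast <;> ring
  have e2 : maxSum d c n (fun s => if s = 0 then 1 else 0)
      = ∑ k : Fin n → κ, (if disp d k = 0 then pathWt c k * (pmax d k : ℤ) else 0) :=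
    Finset.sum_congr rfl fun k _ => by by_cases h : disp d k = 0 <;> simp [h]
  have e3 : maxSum d c n (fun s => if s = 0 then 1 else 0)
      = ∑ j ∈ Finset.range n, bondSum d c (j + 1) (n - (j + 1)) / 2 / (j + 1) := by
    rw [maxSum_eq]
    exact Finset.sum_congr rfl fun j _ => by rw [posSum_stepAvg hσd hσc]
  calc _ = -2 * ((∑ k : Fin n → κ, if disp d k = 0 then pathWt c k * (pmax d k : ℤ) else 0)
        - ∑ k : Fin n → κ, if disp d k = 0 then pathWt c k * (pmin d k : ℤ) else 0) := by
        rw [← Finset.sum_sub_distrib, Finset.mul_sum]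
        refine Finset.sum_congr rfl fun k _ => ?_
        rw [hcast']
        split_ifs
        · push_cast; ring
        · ring
    _ = -4 * maxSum d c n (fun s => if s = 0 then 1 else 0) := by rw [e1, e2]; ring
    _ = _ := by
        rw [e3, Finset.mul_sum, Finset.mul_sum]
        exact Finset.sum_congr rfl fun j _ => by ring

/-- The sum over pairs of opposite steps, weighted by their length. -/
def bond (d : κ → ℤ) (c : κ → ℝ) (d' : κ' → ℤ) (c' : κ' → ℝ) : ℝ :=
  ∑ k, ∑ k', if d k + d' k' = 0 then c k * c' k' * (|d k| : ℤ) else 0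

/-- The off-diagonal blocks are crossed at the two ends of the block. -/
theorem pairSum_circ (hV : V.IsHermitian) {φ χ : ℝ → ℝ} {m : ℕ} (hm : m ≤ N) {d : κ → ℤ}
    {c : κ → ℝ} {d' : κ' → ℤ} {c' : κ' → ℝ} {L : ℤ} (hL : ∀ x, |d x| ≤ L)
    (hL' : ∀ x, |d' x| ≤ L) (hM : funMat hV φ = circ N d c) (hM' : funMat hV χ = circ N d' c')
    (hL0 : 0 < L) (h1 : L ≤ m) (h2 : m + 2 * L ≤ N) :
    pairSum hV (lowBlock N m) (fun x y => (φ x - φ y) * (χ x - χ y)) = 2 * bond d c d' c' := by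
  rw [pairSum_increments]
  congr 1
  have e1 : ∀ a : Fin N, ∑ b, funMat hV φ a b * funMat hV χ a b
      = ∑ k, ∑ k', if d k + d' k' = 0 then c k * c' k' else 0 := by
    intro a
    calc _ = (circ N d c * circ N d' c') a a := by
          rw [Matrix.mul_apply, ← hM, ← hM']
          exact Finset.sum_congr rfl fun b _ => by rw [funMat_apply_comm hV χ a b]
      _ = _ := by
          rw [circ_mul]
          simp only [circ, Matrix.of_apply, Fintype.sum_prod_type]
          refine Finset.sum_congr rfl fun k _ => Finset.sum_congr rfl fun k' _ => ?_
          refine if_congr ?_ rfl rfl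
          rw [add_sub_cancel_left]
          constructor
          · intro h
            refine Int.eq_zero_of_abs_lt_dvd h ((abs_add_le _ _).trans_lt ?_)
            linarith [hL k, hL' k']
          · intro h; rw [h]; exact dvd_zero _
  have e2 : ∑ a ∈ lowBlock N m, ∑ b ∈ lowBlock N m, funMat hV φ a b * funMat hV χ a b
      = ∑ k, ∑ k', if d k + d' k' = 0 then c k * c' k' * (m - |d k| : ℤ) else 0 := by
    have e3 : ∀ (κ : Type) [Fintype κ] (d : κ → ℤ) (c : κ → ℝ) (_ : ∀ x, |d x| ≤ L) (i j : Fin m),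
        circ N d c (lowBlockEquiv hm i) (lowBlockEquiv hm j) = toep m d c i j := by
      intro κ _ d c hd i j
      exact congrFun (congrFun (circ_lowBlock hm d c hd (by linarith)) i) j
    rw [← Finset.sum_coe_sort (lowBlock N m), ← (lowBlockEquiv hm).sum_comp]
    calc _ = ∑ i : Fin m, ∑ j : Fin m, toep m d c i j * toep m d' c' j i := by
          refine Finset.sum_congr rfl fun i _ => ?_
          rw [← Finset.sum_coe_sort (lowBlock N m), ← (lowBlockEquiv hm).sum_comp]
          refine Finset.sum_congr rfl fun j _ => ?_
          rw [funMat_apply_comm hV χ, hM, hM', e3 κ d c hL, e3 κ' d' c' hL']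
      _ = ∑ i : Fin m, ∑ k, ∑ k', if d k + d' k' = 0 ∧ 0 ≤ (i : ℤ) + min (d k) 0 ∧
            (i : ℤ) + max (d k) 0 < m then c k * c' k' else 0 := by
          refine Finset.sum_congr rfl fun i _ => ?_
          simp only [toep, Matrix.of_apply, Finset.sum_mul_sum]
          rw [Finset.sum_comm]
          refine Finset.sum_congr rfl fun k _ => ?_
          rw [Finset.sum_comm]
          refine Finset.sum_congr rfl fun k' _ => ?_
          have hi := i.2
          by_cases hx : 0 ≤ (i : ℤ) + d k ∧ (i : ℤ) + d k < m
          · have hl : ((i : ℤ) + d k).toNat < m := by omega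
            rw [Finset.sum_eq_single ⟨((i : ℤ) + d k).toNat, hl⟩]
            · rw [if_pos (by simp only; omega), mul_ite, mul_zero]
              refine if_congr ?_ rfl rfl
              simp only
              omega
            · intro b _ hb
              rw [if_neg, zero_mul]
              intro h
              apply hb
              ext
              simp only
              omega
            · simp
          · rw [if_neg (by omega)]
            refine Finset.sum_eq_zero fun b _ => ?_
            have := b.2
            rw [if_neg (by omega), zero_mul]
      _ = _ := by
          rw [Finset.sum_comm]
          refine Finset.sum_congr rfl fun k _ => ?_
          rw [Finset.sum_comm]
          refine Finset.sum_congr rfl fun k' _ => ?_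
          by_cases h : d k + d' k' = 0
          · simp only [h, true_and, if_true]
            rw [← Finset.sum_filter, Finset.sum_const, nsmul_eq_mul, mul_comm]
            congr 1
            have hk := hL k
            have habs : max (d k) 0 - min (d k) 0 = |d k| := by
              rcases le_total 0 (d k) with h | h
              · rw [abs_of_nonneg h]; omega
              · rw [abs_of_nonpos h]; omega
            have := card_fin_shift (m := m) (min_le_right (d k) 0) (le_max_right (d k) 0)
              (by rw [habs]; linarith)
            rw [habs] at this
            exact_mod_cast this
          · simp [h]
  have hcard : (lowBlock N m).card = m := by
    rw [← Fintype.card_coe, ← Fintype.card_congr (lowBlockEquiv hm), Fintype.card_fin]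
  have e4 : ∀ a, ∑ b ∈ (lowBlock N m)ᶜ, funMat hV φ a b * funMat hV χ a b
      = (∑ k, ∑ k', if d k + d' k' = 0 then c k * c' k' else 0)
        - ∑ b ∈ lowBlock N m, funMat hV φ a b * funMat hV χ a b := by
    intro a
    rw [← e1 a, ← Finset.sum_add_sum_compl (lowBlock N m)]
    ring
  simp only [e4, Finset.sum_sub_distrib]
  rw [e2, Finset.sum_const, hcard, nsmul_eq_mul, Finset.mul_sum, ← Finset.sum_sub_distrib, bond]
  refine Finset.sum_congr rfl fun k _ => ?_
  rw [Finset.mul_sum, ← Finset.sum_sub_distrib]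
  refine Finset.sum_congr rfl fun k' _ => ?_
  split_ifs
  · push_cast; ring
  · ring

/-- The kernel of the quadratic form that equals the block defect of `xⁿ`. -/
def powKernel (n : ℕ) (x y : ℝ) : ℝ :=
  -∑ j ∈ Finset.range n, (x ^ (j + 1) - y ^ (j + 1)) * (x ^ (n - (j + 1)) - y ^ (n - (j + 1))) /
    (j + 1)

theorem pairSum_neg_sum {ι : Type*} (hV : V.IsHermitian) (A : Finset (Fin N)) (s : Finset ι)
    (F : ι → ℝ → ℝ → ℝ) (c : ι → ℝ) :
    pairSum hV A (fun x y => -∑ j ∈ s, F j x y / c j) = -∑ j ∈ s, pairSum hV A (F j) / c j := by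
  simp only [pairSum, mul_neg, Finset.sum_neg_distrib, Finset.mul_sum, Finset.sum_div]
  congr 1
  rw [Finset.sum_comm' (t' := Finset.univ) (s' := fun _ => Finset.univ) (by simp)]
  rw [Finset.sum_comm]
  conv_rhs => rw [Finset.sum_comm]
  refine Finset.sum_congr rfl fun k _ => ?_
  rw [Finset.sum_comm]
  exact Finset.sum_congr rfl fun j _ => Finset.sum_congr rfl fun l _ => by ring

/-- The pair sum of the power kernel has the same value as the block defect in
`blockDefect_pow_circ`. -/
theorem pairSum_powKernel_circ (hV : V.IsHermitian) {φ : ℝ → ℝ} {m : ℕ} (hm : m ≤ N) {d : κ → ℤ}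
    {c : κ → ℝ} {L : ℤ} (hL0 : 0 < L) (hL : ∀ x, |d x| ≤ L) (hM : funMat hV φ = circ N d c)
    (n : ℕ) (h1 : n * L + L ≤ m) (h2 : m + (2 * (n * L) + 2 * L) ≤ N) :
    pairSum hV (lowBlock N m) (fun x y => powKernel n (φ x) (φ y))
      = -2 * ∑ j ∈ Finset.range n, bondSum d c (j + 1) (n - (j + 1)) / (j + 1) := by
  simp only [powKernel]
  rw [pairSum_neg_sum hV _ _ (fun j x y => (φ x ^ (j + 1) - φ y ^ (j + 1)) *
    (φ x ^ (n - (j + 1)) - φ y ^ (n - (j + 1)))), neg_mul, Finset.mul_sum]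
  congr 1
  refine Finset.sum_congr rfl fun j hj => ?_
  have hj' := Finset.mem_range.1 hj
  have hpow : ∀ i : ℕ, funMat hV (fun x => φ x ^ i) = circ N (disp d (n := i)) (pathWt c) := by
    intro i; rw [← funMat_pow, hM, circ_pow]
  have hle : ∀ i : ℕ, i ≤ n → ∀ k : Fin i → κ, |disp d k| ≤ n * L + L := by
    intro i hi k
    have h3 := abs_disp_le d hL k
    have h4 : (i : ℤ) * L ≤ n * L := by gcongr
    linarith
  rw [pairSum_circ hV hm (hle (j + 1) (by omega)) (hle (n - (j + 1)) (by omega)) (hpow _) (hpow _)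
    (by positivity) h1 (by linarith), mul_div_assoc]
  rfl

end Blocks

/-! ### Polynomials of the coupling matrix -/

section Polynomials

theorem couplingXX_isHermitian (a b : ℝ) (N : ℕ) : (couplingXX a b N).IsHermitian := by
  ext i j
  simp only [couplingXX, Matrix.conjTranspose_apply, Matrix.of_apply, star_trivial]
  simp only [eq_comm (a := j) (b := i), or_comm]

/-- The steps of the coupling matrix: `0`, `1` and `-1`. -/
def hopStep : Fin 3 → ℤ := ![0, 1, -1]

theorem circ_hopStep_apply (a b : ℝ) {N : ℕ} (i j : Fin N) :
    circ N hopStep ![a, b, b] i j = (if (N : ℤ) ∣ (i : ℤ) + 0 - j then a else 0)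
      + (if (N : ℤ) ∣ (i : ℤ) + 1 - j then b else 0)
      + (if (N : ℤ) ∣ (i : ℤ) + (-1) - j then b else 0) := by
  rw [circ, Matrix.of_apply, Fin.sum_univ_three]
  rfl

/-- For `N ≥ 3` the sites `j + 1` and `j - 1` are distinct, and the coupling matrix is circulant in the
sense of `circ`. -/
theorem couplingXX_eq_circ (a b : ℝ) {N : ℕ} (hN : 3 ≤ N) :
    couplingXX a b N = circ N hopStep ![a, b, b] := by
  ext i j
  have hi := i.2
  have hj := j.2
  have key : ∀ x : ℤ, |x| ≤ 1 → ((N : ℤ) ∣ (i : ℤ) + x - j ↔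
      (i : ℤ) + x = j ∨ (i : ℤ) + x = j + N ∨ (i : ℤ) + x = j - N) := by
    intro x hx
    have hx' := abs_le.1 hx
    constructor
    · rintro ⟨t, ht⟩
      have h1 : t < 2 := by by_contra h; push Not at h; nlinarith
      have h2 : -2 < t := by by_contra h; push Not at h; nlinarith
      interval_cases t <;> omega
    · rintro (h | h | h)
      · exact ⟨0, by linarith⟩
      · exact ⟨1, by linarith⟩
      · exact ⟨-1, by linarith⟩
  have hmod : ∀ x y : Fin N, (x.val + 1) % N = y.val ↔
      ((x : ℤ) + 1 = y ∨ (x : ℤ) + 1 = y + N) := by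
    intro x y
    have hx := x.2
    have hy := y.2
    rcases Nat.lt_or_ge (x.val + 1) N with h | h
    · rw [Nat.mod_eq_of_lt h]; omega
    · have : x.val + 1 = N := by omega
      rw [this, Nat.mod_self]; omega
  rw [circ_hopStep_apply]
  simp only [couplingXX, Matrix.of_apply, hmod]
  rw [if_congr (key 0 (by simp)) rfl rfl, if_congr (key 1 (by simp)) rfl rfl,
    if_congr (key (-1) (by simp)) rfl rfl]
  by_cases h : i = j
  · subst h
    rw [if_pos rfl, if_pos (by omega), if_neg (by omega), if_neg (by omega)]
    ring
  · have h' : (i : ℤ) ≠ j := fun h' => h (Fin.ext (by exact_mod_cast h'))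
    rw [if_neg h, if_neg (c := (i : ℤ) + 0 = j ∨ _) (by omega)]
    by_cases h1 : (i : ℤ) + 1 = j ∨ (i : ℤ) + 1 = j + N
    · rw [if_pos (Or.inl h1), if_pos (by omega), if_neg (by omega)]
      ring
    · by_cases h2 : (j : ℤ) + 1 = i ∨ (j : ℤ) + 1 = i + N
      · rw [if_pos (Or.inr h2), if_neg (by omega), if_pos (by omega)]
        ring
      · rw [if_neg (by tauto), if_neg (by omega), if_neg (by omega)]
        ring

/-- A polynomial of the coupling matrix is circulant, with steps and weights that do not depend on
the number of sites, and with the same steps and weights as the Fourier series of the dispersion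
relation. -/
theorem exists_circ_polynomial (a b : ℝ) (p : Polynomial ℝ) :
    ∃ (κ : Type) (_ : Fintype κ) (d : κ → ℤ) (c : κ → ℝ) (σ : κ ≃ κ),
      (∀ x, d (σ x) = -d x) ∧ (∀ x, c (σ x) = c x) ∧
      (∀ N, 3 ≤ N → funMat (couplingXX_isHermitian a b N) p.eval = circ N d c) ∧
      ∀ θ : ℝ, p.eval (a + 2 * b * Real.cos θ) = ∑ k, c k * Real.cos (d k * θ) := by
  induction p using Polynomial.induction_on with
  | C x =>
    refine ⟨Unit, inferInstance, fun _ => 0, fun _ => x, Equiv.refl _, by simp, by simp, ?_, ?_⟩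
    · intro N _
      simp only [Polynomial.eval_C]
      rw [funMat_const, circ_zero]
    · intro θ; simp
  | add p q hp hq =>
    obtain ⟨κ, _, d, c, σ, h1, h2, h3, h4⟩ := hp
    obtain ⟨κ', _, d', c', σ', h1', h2', h3', h4'⟩ := hq
    refine ⟨κ ⊕ κ', inferInstance, Sum.elim d d', Sum.elim c c', Equiv.sumCongr σ σ', ?_, ?_, ?_,
      ?_⟩
    · rintro (x | x) <;> simp [h1, h1']
    · rintro (x | x) <;> simp [h2, h2']
    · intro N hN
      rw [← circ_add, ← h3 N hN, ← h3' N hN, funMat_add]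
      simp only [Polynomial.eval_add]
    · intro θ; simp [h4, h4']
  | monomial n x hp =>
    obtain ⟨κ, _, d, c, σ, h1, h2, h3, h4⟩ := hp
    refine ⟨κ × Fin 3, inferInstance, fun k => d k.1 + hopStep k.2,
      fun k => c k.1 * (![a, b, b] : Fin 3 → ℝ) k.2,
      Equiv.prodCongr σ (Equiv.swap 1 2), ?_, ?_, ?_, ?_⟩
    · rintro ⟨x, i⟩
      have : hopStep (Equiv.swap 1 2 i) = -hopStep i := by fin_cases i <;> decide
      simp only [Equiv.prodCongr_apply, Prod.map_apply, h1, this]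
      ring
    · rintro ⟨x, i⟩
      have : (![a, b, b] : Fin 3 → ℝ) (Equiv.swap 1 2 i) = (![a, b, b] : Fin 3 → ℝ) i := by
        fin_cases i
        · rw [Equiv.swap_apply_of_ne_of_ne] <;> decide
        · simp
        · simp
      simp only [Equiv.prodCongr_apply, Prod.map_apply, h2, this]
    · intro N hN
      rw [← circ_mul, ← h3 N hN, ← couplingXX_eq_circ a b hN]
      nth_rewrite 3 [← funMat_id (couplingXX_isHermitian a b N)]
      rw [funMat_mul]
      congr 1
      funext y
      simp [pow_succ, mul_assoc]
    · intro θ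
      have h0 : ∑ k, c k * Real.sin (d k * θ) = 0 := by
        have : ∑ k, c k * Real.sin (d k * θ) = -∑ k, c k * Real.sin (d k * θ) := by
          nth_rewrite 1 [← σ.sum_comp]
          rw [← Finset.sum_neg_distrib]
          exact Finset.sum_congr rfl fun k _ => by
            rw [h1, h2]; push_cast; rw [neg_mul, Real.sin_neg, mul_neg]
        linarith
      have h5 : Polynomial.eval (a + 2 * b * Real.cos θ) (Polynomial.C x * Polynomial.X ^ (n + 1))
          = Polynomial.eval (a + 2 * b * Real.cos θ) (Polynomial.C x * Polynomial.X ^ n)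
            * (a + 2 * b * Real.cos θ) := by
        simp [pow_succ, mul_assoc]
      rw [h5, h4, Fintype.sum_prod_type]
      calc _ = ∑ k, c k * Real.cos (d k * θ) * (a + 2 * b * Real.cos θ)
            - 0 * 0 := by rw [Finset.sum_mul]; ring
        _ = _ := by
          rw [mul_zero, sub_zero]
          refine Finset.sum_congr rfl fun k _ => ?_
          simp only [Fin.sum_univ_three, hopStep, Matrix.cons_val_zero, Matrix.cons_val_one,
            Matrix.cons_val]
          push_cast
          simp only [add_mul, Real.cos_add, zero_mul, one_mul, neg_mul, Real.cos_zero,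
            Real.sin_zero, Real.cos_neg, Real.sin_neg]
          ring

theorem exists_step_bound {κ : Type} [Fintype κ] (d : κ → ℤ) :
    ∃ L : ℤ, 0 < L ∧ ∀ x, |d x| ≤ L :=
  ⟨1 + ∑ x, |d x|, by positivity, fun x =>
    (Finset.single_le_sum (f := fun x => |d x|) (fun i _ => abs_nonneg _)
      (Finset.mem_univ x)).trans (by linarith)⟩

theorem block_eq_lowBlock (q : ℝ) (N : ℕ) : block q N = lowBlock N ⌈q * N⌉₊ := rfl

open Filter in
theorem eventually_block_large {q : ℝ} (hq0 : 0 < q) (hq1 : q < 1) (M : ℤ) :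
    ∀ᶠ N : ℕ in atTop, M ≤ ⌈q * N⌉₊ ∧ ⌈q * N⌉₊ + M ≤ N ∧ ⌈q * N⌉₊ ≤ N := by
  have h1 : Tendsto (fun N : ℕ => q * N) atTop atTop :=
    tendsto_natCast_atTop_atTop.const_mul_atTop hq0
  have h2 : Tendsto (fun N : ℕ => (1 - q) * N) atTop atTop :=
    tendsto_natCast_atTop_atTop.const_mul_atTop (by linarith)
  filter_upwards [h1.eventually_ge_atTop (M : ℝ), h2.eventually_ge_atTop (M + 1 : ℝ),
    h2.eventually_ge_atTop 1, eventually_ge_atTop 0] with N h3 h4 h5 _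
  have h6 := Nat.le_ceil (q * N)
  have h7 := Nat.ceil_lt_add_one (a := q * N) (by positivity)
  refine ⟨?_, ?_, ?_⟩
  · have : (M : ℝ) ≤ ⌈q * N⌉₊ := by linarith
    exact_mod_cast this
  · have : (⌈q * N⌉₊ : ℝ) + M ≤ N := by nlinarith
    exact_mod_cast this
  · have : (⌈q * N⌉₊ : ℝ) ≤ N := by nlinarith
    exact_mod_cast this

open Filter in
/-- For polynomial symbols and powers, the block defect and the pair sum of the power kernel are
eventually equal to the same constant. -/
theorem eventually_blockDefect_pow_polynomial (a b : ℝ) (p : Polynomial ℝ) (n : ℕ) :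
    ∃ ℓ : ℝ, ∀ q : ℝ, 0 < q → q < 1 → ∀ᶠ N in atTop,
      blockDefect (couplingXX_isHermitian a b N) p.eval (fun x => x ^ n) (block q N) = ℓ ∧
      pairSum (couplingXX_isHermitian a b N) (block q N)
        (fun x y => powKernel n (p.eval x) (p.eval y)) = ℓ := by
  obtain ⟨κ, _, d, c, σ, h1, h2, h3, -⟩ := exists_circ_polynomial a b p
  obtain ⟨L, hL0, hL⟩ := exists_step_bound d
  refine ⟨-2 * ∑ j ∈ Finset.range n, bondSum d c (j + 1) (n - (j + 1)) / (j + 1),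
    fun q hq0 hq1 => ?_⟩
  filter_upwards [eventually_block_large hq0 hq1 (2 * (n * L) + 2 * L), eventually_ge_atTop 3]
    with N ⟨h4, h5, h6⟩ hN
  have h7 : 0 ≤ n * L := by positivity
  rw [block_eq_lowBlock]
  exact ⟨blockDefect_pow_circ _ h6 hL0 hL h1 h2 (h3 N hN) n (by linarith) (by linarith),
    pairSum_powKernel_circ _ h6 hL0 hL (h3 N hN) n (by linarith) (by linarith)⟩

open Filter in
theorem eventually_pairSum_polynomial (a b : ℝ) (p : Polynomial ℝ) :
    ∃ (κ : Type) (_ : Fintype κ) (d : κ → ℤ) (c : κ → ℝ) (σ : κ ≃ κ),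
      (∀ x, d (σ x) = -d x) ∧ (∀ x, c (σ x) = c x) ∧
      (∀ θ : ℝ, p.eval (a + 2 * b * Real.cos θ) = ∑ k, c k * Real.cos (d k * θ)) ∧
      ∀ q : ℝ, 0 < q → q < 1 → ∀ᶠ N in atTop,
        pairSum (couplingXX_isHermitian a b N) (block q N)
          (fun x y => (p.eval x - p.eval y) * (p.eval x - p.eval y)) = 2 * bond d c d c := by
  obtain ⟨κ, _, d, c, σ, h1, h2, h3, h4⟩ := exists_circ_polynomial a b p
  obtain ⟨L, hL0, hL⟩ := exists_step_bound d
  refine ⟨κ, _, d, c, σ, h1, h2, h4, fun q hq0 hq1 => ?_⟩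
  filter_upwards [eventually_block_large hq0 hq1 (2 * L), eventually_ge_atTop 3]
    with N ⟨h5, h6, h7⟩ hN
  rw [block_eq_lowBlock]
  exact pairSum_circ _ h7 hL hL (h3 N hN) (h3 N hN) hL0 (by linarith) (by linarith)

open Filter in
/-- For the coupling matrix itself the off-diagonal blocks have two bonds, at both ends of the block. -/
theorem eventually_pairSum_sub_sq (a b : ℝ) {q : ℝ} (hq0 : 0 < q) (hq1 : q < 1) :
    ∀ᶠ N in atTop, pairSum (couplingXX_isHermitian a b N) (block q N)
      (fun x y => (x - y) * (x - y)) = 4 * b ^ 2 := by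
  have hL : ∀ x, |hopStep x| ≤ 1 := by intro x; fin_cases x <;> decide
  filter_upwards [eventually_block_large hq0 hq1 2, eventually_ge_atTop 3] with N ⟨h5, h6, h7⟩ hN
  rw [block_eq_lowBlock]
  have hM : funMat (couplingXX_isHermitian a b N) (fun x => x) = circ N hopStep ![a, b, b] := by
    rw [funMat_id, couplingXX_eq_circ a b hN]
  rw [pairSum_circ _ h7 hL hL hM hM one_pos (by linarith) (by linarith)]
  simp [bond, Fin.sum_univ_three, hopStep]
  ring

/-- The spectrum lies in the band `[a - 2 b, a + 2 b]`. -/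
theorem eigenvalues_mem_band {a b : ℝ} (hb : 0 < b) {N : ℕ} (hN : 3 ≤ N) (k : Fin N) :
    (couplingXX_isHermitian a b N).eigenvalues k ∈ Set.Icc (a - 2 * b) (a + 2 * b) := by
  set hV := couplingXX_isHermitian a b N
  have h1 : Module.End.HasEigenvalue (Matrix.toLin' (couplingXX a b N)) (hV.eigenvalues k) := by
    refine Module.End.hasEigenvalue_of_hasEigenvector (x := hV.eigenvectorBasis k) ⟨?_, ?_⟩
    · rw [Module.End.mem_eigenspace_iff]
      exact hV.mulVec_eigenvectorBasis k
    · intro h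
      have := hV.eigenvectorBasis.orthonormal.ne_zero k
      apply this
      ext i
      exact congrFun h i
  obtain ⟨i, hi⟩ := eigenvalue_mem_ball h1
  have hne : ∀ x : ℤ, x = 1 ∨ x = -1 →
      ∑ j ∈ Finset.univ.erase i, (if (N : ℤ) ∣ (i : ℤ) + x - j then b else 0) ≤ b := by
    intro x _
    obtain ⟨l, -, hl⟩ := existsUnique_fin_dvd i.pos ((i : ℤ) + x)
    calc _ ≤ ∑ j : Fin N, (if (N : ℤ) ∣ (i : ℤ) + x - j then b else 0) :=
          Finset.sum_le_sum_of_subset_of_nonneg (Finset.subset_univ _)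
            fun j _ _ => by split_ifs <;> linarith
      _ ≤ ∑ j : Fin N, (if j = l then b else 0) := by
          refine Finset.sum_le_sum fun j _ => ?_
          split_ifs with h1 h2
          · exact le_rfl
          · exact absurd (hl j h1) h2
          · exact hb.le
          · exact le_rfl
      _ = b := by simp
  have h2 : ∑ j ∈ Finset.univ.erase i, ‖couplingXX a b N i j‖ ≤ 2 * b := by
    calc _ ≤ ∑ j ∈ Finset.univ.erase i, ((if (N : ℤ) ∣ (i : ℤ) + 1 - j then b else 0)
          + (if (N : ℤ) ∣ (i : ℤ) + (-1) - j then b else 0)) := by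
          refine Finset.sum_le_sum fun j hj => ?_
          have hij := (Finset.mem_erase.1 hj).1
          rw [couplingXX_eq_circ a b hN, circ_hopStep_apply, if_neg]
          · rw [zero_add, Real.norm_of_nonneg]
            refine add_nonneg ?_ ?_ <;> split_ifs <;> linarith
          · intro h
            have h1 := i.2
            have h2 := j.2
            have := Int.eq_zero_of_abs_lt_dvd h (by rw [abs_lt]; constructor <;> omega)
            exact hij (Fin.ext (by omega))
      _ ≤ b + b := by
          rw [Finset.sum_add_distrib]
          exact add_le_add (hne 1 (Or.inl rfl)) (hne (-1) (Or.inr rfl))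
      _ = 2 * b := by ring
  have h3 : couplingXX a b N i i = a := by simp [couplingXX]
  rw [Metric.mem_closedBall, Real.dist_eq, h3] at hi
  have := abs_le.1 (hi.trans h2)
  constructor <;> linarith

end Polynomials

/-! ### Stability of the block defect of powers -/

section Stability

open scoped Matrix.Norms.Frobenius

variable {n : Type*} [Fintype n] [DecidableEq n]

theorem sq_frobenius_norm (X : Matrix n n ℝ) : ‖X‖ ^ 2 = ∑ i, ∑ j, X i j ^ 2 := by
  have h0 : 0 ≤ ∑ i, ∑ j, ‖X i j‖ ^ (2 : ℝ) := by positivity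
  rw [Matrix.frobenius_norm_def, ← Real.sqrt_eq_rpow, Real.sq_sqrt h0]
  simp

theorem frobenius_norm_le {X : Matrix n n ℝ} {r : ℝ} (hr : 0 ≤ r)
    (h : ∑ i, ∑ j, X i j ^ 2 ≤ r ^ 2) : ‖X‖ ≤ r :=
  le_of_sq_le_sq (by rwa [sq_frobenius_norm]) hr

theorem abs_trace_mul_le (X Y : Matrix n n ℝ) : |(X * Y).trace| ≤ ‖X‖ * ‖Y‖ := by
  have h1 : (X * Y).trace = ∑ p : n × n, X p.1 p.2 * Y p.2 p.1 := by
    rw [Fintype.sum_prod_type]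
    rfl
  have h2 := Finset.sum_mul_sq_le_sq_mul_sq (Finset.univ : Finset (n × n)) (fun p => X p.1 p.2)
    (fun p => Y p.2 p.1)
  have h3 : ∑ p : n × n, X p.1 p.2 ^ 2 = ‖X‖ ^ 2 := by
    rw [sq_frobenius_norm, Fintype.sum_prod_type]
  have h4 : ∑ p : n × n, Y p.2 p.1 ^ 2 = ‖Y‖ ^ 2 := by
    rw [sq_frobenius_norm, Fintype.sum_prod_type, Finset.sum_comm]
  rw [h3, h4, ← h1, ← mul_pow] at h2
  exact abs_le_of_sq_le_sq h2 (by positivity)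

/-- `X` has operator norm at most `R`, expressed through multiplication of Frobenius norms. -/
def OpBound (R : ℝ) (X : Matrix n n ℝ) : Prop :=
  0 ≤ R ∧ ∀ Y : Matrix n n ℝ, ‖X * Y‖ ≤ R * ‖Y‖ ∧ ‖Y * X‖ ≤ R * ‖Y‖

theorem OpBound.mono {R R' : ℝ} {X : Matrix n n ℝ} (h : OpBound R X) (hR : R ≤ R') :
    OpBound R' X :=
  ⟨h.1.trans hR, fun Y => ⟨(h.2 Y).1.trans (by gcongr), (h.2 Y).2.trans (by gcongr)⟩⟩

theorem OpBound.mul {R R' : ℝ} {X X' : Matrix n n ℝ} (h : OpBound R X) (h' : OpBound R' X') :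
    OpBound (R * R') (X * X') := by
  refine ⟨mul_nonneg h.1 h'.1, fun Y => ⟨?_, ?_⟩⟩
  · rw [Matrix.mul_assoc, mul_assoc R]
    exact ((h.2 _).1).trans (mul_le_mul_of_nonneg_left (h'.2 Y).1 h.1)
  · rw [← Matrix.mul_assoc, mul_comm R, mul_assoc R']
    exact ((h'.2 _).2).trans (mul_le_mul_of_nonneg_left (h.2 Y).2 h'.1)

theorem OpBound.add {R R' : ℝ} {X X' : Matrix n n ℝ} (h : OpBound R X) (h' : OpBound R' X') :
    OpBound (R + R') (X + X') := by
  refine ⟨add_nonneg h.1 h'.1, fun Y => ⟨?_, ?_⟩⟩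
  · rw [add_mul, add_mul]
    exact (norm_add_le _ _).trans (add_le_add (h.2 Y).1 (h'.2 Y).1)
  · rw [mul_add, add_mul]
    exact (norm_add_le _ _).trans (add_le_add (h.2 Y).2 (h'.2 Y).2)

theorem opBound_zero : OpBound 0 (0 : Matrix n n ℝ) := ⟨le_rfl, fun Y => by simp⟩

theorem opBound_one : OpBound 1 (1 : Matrix n n ℝ) := ⟨zero_le_one, fun Y => by simp⟩

theorem opBound_diagonal {R : ℝ} (hR : 0 ≤ R) {w : n → ℝ} (hw : ∀ i, |w i| ≤ R) :
    OpBound R (Matrix.diagonal w) := by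
  have h : ∀ i (x : ℝ), (w i * x) ^ 2 ≤ R ^ 2 * x ^ 2 := fun i x => by
    rw [mul_pow]
    exact mul_le_mul_of_nonneg_right (sq_le_sq.2 (by rw [abs_of_nonneg hR]; exact hw i))
      (sq_nonneg x)
  refine ⟨hR, fun Y => ⟨?_, ?_⟩⟩
  · refine frobenius_norm_le (by positivity) ?_
    rw [mul_pow, sq_frobenius_norm, Finset.mul_sum]
    refine Finset.sum_le_sum fun i _ => ?_
    rw [Finset.mul_sum]
    refine Finset.sum_le_sum fun j _ => ?_
    rw [Matrix.diagonal_mul]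
    exact h i _
  · refine frobenius_norm_le (by positivity) ?_
    rw [mul_pow, sq_frobenius_norm, Finset.mul_sum]
    refine Finset.sum_le_sum fun i _ => ?_
    rw [Finset.mul_sum]
    refine Finset.sum_le_sum fun j _ => ?_
    rw [Matrix.mul_diagonal, mul_comm]
    exact h j _

theorem opBound_of_orthogonal {U : Matrix n n ℝ} (h₁ : Uᵀ * U = 1) (h₂ : U * Uᵀ = 1) :
    OpBound 1 U := by
  have key : ∀ X : Matrix n n ℝ, ‖X‖ ^ 2 = (Xᵀ * X).trace := by
    intro X
    rw [sq_frobenius_norm, Finset.sum_comm, Matrix.trace]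
    refine Finset.sum_congr rfl fun j _ => ?_
    rw [Matrix.diag_apply, Matrix.mul_apply]
    exact Finset.sum_congr rfl fun i _ => by rw [Matrix.transpose_apply, sq]
  have key' : ∀ X : Matrix n n ℝ, ‖X‖ ^ 2 = (X * Xᵀ).trace := by
    intro X
    rw [key, Matrix.trace_mul_comm]
  refine ⟨zero_le_one, fun Y => ⟨?_, ?_⟩⟩
  · rw [one_mul]
    refine le_of_sq_le_sq (le_of_eq ?_) (norm_nonneg _)
    rw [key, key, Matrix.transpose_mul, Matrix.mul_assoc, ← Matrix.mul_assoc Uᵀ, h₁,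
      Matrix.one_mul]
  · rw [one_mul]
    refine le_of_sq_le_sq (le_of_eq ?_) (norm_nonneg _)
    rw [key', key', Matrix.transpose_mul, Matrix.mul_assoc, ← Matrix.mul_assoc U, h₂,
      Matrix.one_mul]

/-- The operator norm of `φ(V)` is at most the supremum of `φ` over the spectrum. -/
theorem opBound_funMat {V : Matrix n n ℝ} (hV : V.IsHermitian) {φ : ℝ → ℝ} {R : ℝ} (hR : 0 ≤ R)
    (hφ : ∀ k, |φ (hV.eigenvalues k)| ≤ R) : OpBound R (funMat hV φ) := by
  have h1 : OpBound 1 (eigMat hV) :=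
    opBound_of_orthogonal (eigMat_transpose_mul hV) (eigMat_mul_transpose hV)
  have h2 : OpBound 1 (eigMat hV)ᵀ :=
    opBound_of_orthogonal (by rw [Matrix.transpose_transpose]; exact eigMat_mul_transpose hV)
      (by rw [Matrix.transpose_transpose]; exact eigMat_transpose_mul hV)
  have h3 : funMat hV φ
      = eigMat hV * Matrix.diagonal (fun i => φ (hV.eigenvalues i)) * (eigMat hV)ᵀ := by
    rw [← funMat_mul_eigMat, Matrix.mul_assoc, eigMat_mul_transpose, Matrix.mul_one]
  rw [h3]
  simpa using (h1.mul (opBound_diagonal hR hφ)).mul h2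

/-- Two matrices of operator norm at most `R` at distance at most `δ R`. -/
def OpClose (δ R : ℝ) (X X' : Matrix n n ℝ) : Prop :=
  OpBound R X ∧ OpBound R X' ∧ OpBound (δ * R) (X - X')

/-- Two matrices of Frobenius norm at most `R` at distance at most `δ R`. -/
def HsClose (δ R : ℝ) (X X' : Matrix n n ℝ) : Prop :=
  ‖X‖ ≤ R ∧ ‖X'‖ ≤ R ∧ ‖X - X'‖ ≤ δ * R

variable {δ R R' : ℝ} {X X' Y Y' : Matrix n n ℝ}

theorem OpClose.refl (hδ : 0 ≤ δ) (h : OpBound R X) : OpClose δ R X X :=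
  ⟨h, h, by rw [sub_self]; exact opBound_zero.mono (mul_nonneg hδ h.1)⟩

theorem OpClose.mul (hX : OpClose δ R X X') (hY : OpClose δ R' Y Y') :
    OpClose δ (2 * R * R') (X * Y) (X' * Y') := by
  have hR := hX.1.1
  have hR' := hY.1.1
  have h : R * R' ≤ 2 * R * R' := by nlinarith [mul_nonneg hR hR']
  refine ⟨(hX.1.mul hY.1).mono h, (hX.2.1.mul hY.2.1).mono h, ?_⟩
  have e : X * Y - X' * Y' = (X - X') * Y + X' * (Y - Y') := by noncomm_ring
  rw [e]
  exact ((hX.2.2.mul hY.1).add (hX.2.1.mul hY.2.2)).mono (by linarith)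

theorem OpClose.add (hX : OpClose δ R X X') (hY : OpClose δ R' Y Y') :
    OpClose δ (R + R') (X + Y) (X' + Y') := by
  refine ⟨hX.1.add hY.1, hX.2.1.add hY.2.1, ?_⟩
  rw [add_sub_add_comm, mul_add]
  exact hX.2.2.add hY.2.2

theorem OpClose.pow (hδ : 0 ≤ δ) (hX : OpClose δ R X X') (k : ℕ) :
    OpClose δ ((2 * R) ^ k) (X ^ k) (X' ^ k) := by
  induction k with
  | zero => simpa using OpClose.refl hδ (opBound_one (n := n))
  | succ k ih =>
    rw [pow_succ', pow_succ', pow_succ']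
    exact hX.mul ih

theorem OpClose.mul_hs (hX : OpClose δ R X X') (hδ : 0 ≤ δ) (hY : HsClose δ R' Y Y') :
    HsClose δ (2 * R * R') (X * Y) (X' * Y') := by
  have hR := hX.1.1
  have hR' := (norm_nonneg _).trans hY.1
  have h : R * R' ≤ 2 * R * R' := by nlinarith [mul_nonneg hR hR']
  refine ⟨((hX.1.2 Y).1.trans (by gcongr; exact hY.1)).trans h,
    ((hX.2.1.2 Y').1.trans (by gcongr; exact hY.2.1)).trans h, ?_⟩
  have e : X * Y - X' * Y' = (X - X') * Y + X' * (Y - Y') := by noncomm_ring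
  rw [e]
  calc _ ≤ δ * R * ‖Y‖ + R * ‖Y - Y'‖ :=
        (norm_add_le _ _).trans (add_le_add (hX.2.2.2 _).1 (hX.2.1.2 _).1)
    _ ≤ δ * R * R' + R * (δ * R') := by
        gcongr
        · exact hY.1
        · exact hY.2.2
    _ = _ := by ring

theorem HsClose.mul_op (hY : HsClose δ R' Y Y') (hδ : 0 ≤ δ) (hX : OpClose δ R X X') :
    HsClose δ (2 * R' * R) (Y * X) (Y' * X') := by
  have hR := hX.1.1
  have hR' := (norm_nonneg _).trans hY.1
  have h : R * R' ≤ 2 * R' * R := by nlinarith [mul_nonneg hR hR']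
  refine ⟨((hX.1.2 Y).2.trans (by gcongr; exact hY.1)).trans h,
    ((hX.2.1.2 Y').2.trans (by gcongr; exact hY.2.1)).trans h, ?_⟩
  have e : Y * X - Y' * X' = Y * (X - X') + (Y - Y') * X' := by noncomm_ring
  rw [e]
  calc _ ≤ δ * R * ‖Y‖ + R * ‖Y - Y'‖ :=
        (norm_add_le _ _).trans (add_le_add (hX.2.2.2 _).2 (hX.2.1.2 _).2)
    _ ≤ δ * R * R' + R * (δ * R') := by
        gcongr
        · exact hY.1
        · exact hY.2.2
    _ = _ := by ring

theorem HsClose.add (hX : HsClose δ R X X') (hY : HsClose δ R' Y Y') :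
    HsClose δ (R + R') (X + Y) (X' + Y') := by
  refine ⟨(norm_add_le _ _).trans (add_le_add hX.1 hY.1),
    (norm_add_le _ _).trans (add_le_add hX.2.1 hY.2.1), ?_⟩
  rw [add_sub_add_comm, mul_add]
  exact (norm_add_le _ _).trans (add_le_add hX.2.2 hY.2.2)

theorem HsClose.abs_trace_sub_le (hδ : 0 ≤ δ) (hX : HsClose δ R X X') (hY : HsClose δ R' Y Y') :
    |(X * Y).trace - (X' * Y').trace| ≤ δ * (2 * R * R') := by
  have hR := (norm_nonneg _).trans hX.1
  have e : (X * Y).trace - (X' * Y').trace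
      = ((X - X') * Y).trace + (X' * (Y - Y')).trace := by
    rw [← Matrix.trace_sub, ← Matrix.trace_add]
    congr 1
    noncomm_ring
  rw [e]
  calc _ ≤ ‖X - X'‖ * ‖Y‖ + ‖X'‖ * ‖Y - Y'‖ :=
        (abs_add_le _ _).trans (add_le_add (abs_trace_mul_le _ _) (abs_trace_mul_le _ _))
    _ ≤ δ * R * R' + R * (δ * R') := by
        gcongr
        · exact hX.2.2
        · exact hY.1
        · exact hX.2.1
        · exact hY.2.2
    _ = _ := by ring

/-- The commutator with `S` of a power only needs a Frobenius bound for the commutator of the base, so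
that the estimate does not involve the size of the matrices. -/
theorem OpClose.commutator_pow {S M M' : Matrix n n ℝ} (hMM : OpClose δ R M M') (hδ : 0 ≤ δ)
    (hC : HsClose δ (2 * R) (S * M - M * S) (S * M' - M' * S)) (l : ℕ) :
    HsClose δ (l * (2 * (2 * R) ^ l)) (S * M ^ l - M ^ l * S) (S * M' ^ l - M' ^ l * S) := by
  induction l with
  | zero => simp [HsClose]
  | succ l ih =>
    have e : ∀ M : Matrix n n ℝ, S * M ^ (l + 1) - M ^ (l + 1) * S
        = (S * M - M * S) * M ^ l + M * (S * M ^ l - M ^ l * S) := by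
      intro M; rw [pow_succ']; noncomm_ring
    rw [e, e]
    have h := (hC.mul_op hδ (hMM.pow hδ l)).add (hMM.mul_hs hδ ih)
    have e' : 2 * (2 * R) * (2 * R) ^ l + 2 * R * (l * (2 * (2 * R) ^ l))
        = ((l + 1 : ℕ) : ℝ) * (2 * (2 * R) ^ (l + 1)) := by push_cast; ring
    rwa [e'] at h

/-- The reflection that is `1` on the block `A` and `-1` on its complement. -/
def signMat (A : Finset n) : Matrix n n ℝ := Matrix.diagonal fun i => if i ∈ A then 1 else -1

/-- The pinching of `M` to the blocks `A` and `Aᶜ`. -/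
def pinch (A : Finset n) (M : Matrix n n ℝ) : Matrix n n ℝ :=
  Matrix.diagonal (fun _ => (1 / 2 : ℝ)) * (M + signMat A * M * signMat A)

theorem signMat_mul_self (A : Finset n) : signMat A * signMat A = 1 := by
  rw [signMat, Matrix.diagonal_mul_diagonal, ← Matrix.diagonal_one]
  congr 1
  funext i
  split_ifs <;> norm_num

theorem opBound_signMat (A : Finset n) : OpBound 1 (signMat A) :=
  opBound_diagonal zero_le_one fun i => by split_ifs <;> simp

theorem pinch_apply (A : Finset n) (M : Matrix n n ℝ) (i j : n) :
    pinch A M i j = if (i ∈ A ↔ j ∈ A) then M i j else 0 := by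
  rw [pinch, Matrix.diagonal_mul, Matrix.add_apply, signMat, Matrix.mul_diagonal,
    Matrix.diagonal_mul]
  by_cases hi : i ∈ A <;> by_cases hj : j ∈ A <;> simp [hi, hj] <;> ring

theorem pinch_pow_apply {A B : Finset n} (M : Matrix n n ℝ)
    (hB : ∀ a ∈ B, ∀ c, (a ∈ A ↔ c ∈ A) ↔ c ∈ B) (k : ℕ) (a b : B) :
    (pinch A M ^ k) a b = ((M.submatrix ((↑) : B → n) (↑)) ^ k) a b := by
  induction k generalizing a with
  | zero =>
    rw [pow_zero, pow_zero, Matrix.one_apply, Matrix.one_apply]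
    exact if_congr Subtype.ext_iff.symm rfl rfl
  | succ k ih =>
    rw [pow_succ', pow_succ', Matrix.mul_apply, Matrix.mul_apply]
    simp only [pinch_apply, hB a a.2, ite_mul, zero_mul]
    rw [← Finset.sum_filter, Finset.filter_mem_eq_inter, Finset.univ_inter, ← Finset.sum_coe_sort B]
    exact Finset.sum_congr rfl fun c _ => by rw [ih, Matrix.submatrix_apply]

theorem trace_pinch_pow (A : Finset n) (M : Matrix n n ℝ) (k : ℕ) :
    (pinch A M ^ k).trace = ((M.submatrix ((↑) : A → n) (↑)) ^ k).trace
      + ((M.submatrix ((↑) : ↥Aᶜ → n) (↑)) ^ k).trace := by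
  rw [Matrix.trace, ← Finset.sum_add_sum_compl A, ← Finset.sum_coe_sort A,
    ← Finset.sum_coe_sort Aᶜ]
  congr 1
  · exact Finset.sum_congr rfl fun a _ =>
      pinch_pow_apply M (fun a ha c => by simp [ha]) k a a
  · exact Finset.sum_congr rfl fun a _ =>
      pinch_pow_apply M (fun a ha c => by rw [Finset.mem_compl] at ha ⊢; simp [ha]) k a a

theorem pow_sub_pinch_pow (X Y : Matrix n n ℝ) (k : ℕ) :
    Y ^ k - X ^ k = ∑ j ∈ Finset.range k, X ^ j * (Y - X) * Y ^ (k - (j + 1)) := by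
  induction k with
  | zero => simp
  | succ k ih =>
    rw [Finset.sum_range_succ']
    have e : Y ^ (k + 1) - X ^ (k + 1) = X * (Y ^ k - X ^ k) + (Y - X) * Y ^ k := by
      rw [pow_succ', pow_succ']; noncomm_ring
    rw [e, ih, Finset.mul_sum]
    congr 1
    · refine Finset.sum_congr rfl fun j _ => ?_
      rw [pow_succ' X j, Nat.add_sub_add_right]
      simp only [Matrix.mul_assoc]
    · simp

/-- The trace of a power splits off the pinched part; the remainder only involves commutators. -/
theorem trace_pinch_pow_sub (A : Finset n) (M : Matrix n n ℝ) (k : ℕ) :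
    (pinch A M ^ k).trace - (M ^ k).trace = -∑ j ∈ Finset.range k,
      (pinch A M ^ j * ((signMat A * M - M * signMat A) * signMat A) *
        ((signMat A * M ^ (k - (j + 1)) - M ^ (k - (j + 1)) * signMat A) * signMat A)).trace / 4 := by
  set S := signMat A
  have hS : S * S = 1 := signMat_mul_self A
  have hD : Matrix.diagonal (fun _ : n => (1 / 2 : ℝ)) = (1 / 2 : ℝ) • 1 := by
    ext i j; simp [Matrix.diagonal_apply, Matrix.one_apply]
  have hp : pinch A M = (1 / 2 : ℝ) • (M + S * M * S) := by
    rw [pinch, hD, Matrix.smul_mul, Matrix.one_mul]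
  have hcomm : S * pinch A M = pinch A M * S := by
    rw [hp, Matrix.mul_smul, Matrix.smul_mul, mul_add, add_mul]
    congr 1
    rw [Matrix.mul_assoc (S * M) S S, hS, Matrix.mul_assoc S M S, ← Matrix.mul_assoc S S, hS]
    simp [add_comm]
  have hcomm' : ∀ j, S * pinch A M ^ j = pinch A M ^ j * S := fun j =>
    ((show Commute S (pinch A M) from hcomm).pow_right j)
  have hE : M - pinch A M = (1 / 2 : ℝ) • (M - S * M * S) := by
    rw [hp]; module
  have hES : (S * M - M * S) * S = -(M - S * M * S) := by
    rw [sub_mul, Matrix.mul_assoc M, hS]; simp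
  have hanti : S * (M - pinch A M) * S = -(M - pinch A M) := by
    rw [hE, Matrix.mul_smul, Matrix.smul_mul, ← smul_neg]
    congr 1
    rw [mul_sub, sub_mul, ← Matrix.mul_assoc, ← Matrix.mul_assoc S S, hS, Matrix.mul_assoc _ S S,
      hS]
    simp
  have h1 : (M ^ k).trace - (pinch A M ^ k).trace = ∑ j ∈ Finset.range k,
      (pinch A M ^ j * (M - pinch A M) * M ^ (k - (j + 1))).trace := by
    rw [← Matrix.trace_sub, pow_sub_pinch_pow, Matrix.trace_sum]
  rw [← neg_sub, h1, neg_inj]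
  refine Finset.sum_congr rfl fun j _ => ?_
  set W := pinch A M ^ j
  set E := M - pinch A M
  set Z := M ^ (k - (j + 1))
  have hW : S * W = W * S := hcomm' j
  have h2 : (W * E * (S * Z * S)).trace = -(W * E * Z).trace := by
    calc (W * E * (S * Z * S)).trace = (S * (W * E) * (S * Z)).trace := by
          rw [← Matrix.mul_assoc, Matrix.trace_mul_comm, ← Matrix.mul_assoc, ← Matrix.mul_assoc]
      _ = (W * (S * E * S) * Z).trace := by
          congr 1
          rw [← Matrix.mul_assoc S W E, hW]
          simp only [Matrix.mul_assoc]
      _ = _ := by rw [hanti]; simp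
  have h3 : (S * Z - Z * S) * S = -(Z - S * Z * S) := by
    rw [sub_mul, Matrix.mul_assoc Z, hS]; simp
  have h4 : M - S * M * S = (2 : ℝ) • E := by rw [hE]; module
  have h5 : W * -((2 : ℝ) • E) * -(Z - S * Z * S)
      = (2 : ℝ) • (W * E * Z - W * E * (S * Z * S)) := by
    rw [Matrix.mul_neg, Matrix.mul_neg, Matrix.neg_mul, neg_neg, Matrix.mul_smul, Matrix.smul_mul, mul_sub]
  rw [hES, h3, h4, h5, Matrix.trace_smul, Matrix.trace_sub, h2, smul_eq_mul]
  ring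

variable {V : Matrix n n ℝ}

theorem sum_offDiagonal (A : Finset n) (f : n → n → ℝ) (hf : ∀ i j, f i j = f j i) :
    ∑ i, ∑ j, (if (i ∈ A ↔ j ∈ A) then 0 else f i j) = 2 * ∑ i ∈ A, ∑ j ∈ Aᶜ, f i j := by
  have e1 : ∑ i ∈ A, ∑ j, (if (i ∈ A ↔ j ∈ A) then 0 else f i j) = ∑ i ∈ A, ∑ j ∈ Aᶜ, f i j := by
    refine Finset.sum_congr rfl fun i hi => ?_
    rw [← Finset.sum_add_sum_compl A, Finset.sum_eq_zero, zero_add]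
    · refine Finset.sum_congr rfl fun j hj => ?_
      rw [Finset.mem_compl] at hj
      rw [if_neg (by tauto)]
    · intro j hj
      rw [if_pos (by tauto)]
  have e2 : ∑ i ∈ Aᶜ, ∑ j, (if (i ∈ A ↔ j ∈ A) then 0 else f i j) = ∑ i ∈ A, ∑ j ∈ Aᶜ, f i j := by
    rw [Finset.sum_comm' (s := A) (t' := Aᶜ) (s' := fun _ => A) (by simp)]
    refine Finset.sum_congr rfl fun i hi => ?_
    rw [← Finset.sum_add_sum_compl A, Finset.sum_eq_zero (s := Aᶜ), add_zero]
    · refine Finset.sum_congr rfl fun j hj => ?_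
      rw [Finset.mem_compl] at hi
      rw [if_neg (by tauto), hf]
    · intro j hj
      rw [Finset.mem_compl] at hi hj
      rw [if_pos (by tauto)]
  rw [← Finset.sum_add_sum_compl A, e1, e2]
  ring

theorem norm_commutator_le (hV : V.IsHermitian) (A : Finset n) {φ : ℝ → ℝ} (hR : 0 ≤ R)
    (hφ : pairSum hV A (fun x y => (φ x - φ y) * (φ x - φ y)) ≤ R ^ 2) :
    ‖signMat A * funMat hV φ - funMat hV φ * signMat A‖ ≤ 2 * R := by
  refine frobenius_norm_le (by positivity) ?_
  have h1 : ∀ i j, (signMat A * funMat hV φ - funMat hV φ * signMat A) i j ^ 2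
      = if (i ∈ A ↔ j ∈ A) then 0 else 4 * (funMat hV φ i j * funMat hV φ i j) := by
    intro i j
    rw [Matrix.sub_apply, signMat, Matrix.mul_diagonal, Matrix.diagonal_mul]
    by_cases hi : i ∈ A <;> by_cases hj : j ∈ A <;> simp [hi, hj] <;> ring
  have h2 := sum_offDiagonal A (fun i j => 4 * (funMat hV φ i j * funMat hV φ i j))
    (fun i j => by rw [funMat_apply_comm hV φ])
  simp only [h1]
  rw [h2]
  simp only [← Finset.mul_sum]
  rw [pairSum_increments] at hφ
  nlinarith

/-- The constant of the stability estimate for the block defect. -/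
def stabilityConst (k : ℕ) (R : ℝ) : ℝ :=
  ∑ j ∈ Finset.range k,
    2 * (2 * (2 * (5 * R)) ^ j * (2 * (2 * R) * 1)) *
      (2 * ((k - (j + 1) : ℕ) * (2 * (2 * R) ^ (k - (j + 1)))) * 1) / 4

/-- Two symbols of size at most `R` at distance at most `δ R`, with increments that satisfy the same
bounds in the pair sum. -/
structure SymbolClose (hV : V.IsHermitian) (A : Finset n) (δ R : ℝ) (φ χ : ℝ → ℝ) : Prop where
  delta_nonneg : 0 ≤ δ
  nonneg : 0 ≤ R
  left : ∀ k, |φ (hV.eigenvalues k)| ≤ R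
  right : ∀ k, |χ (hV.eigenvalues k)| ≤ R
  sub : ∀ k, |φ (hV.eigenvalues k) - χ (hV.eigenvalues k)| ≤ δ * R
  pairSum_left : pairSum hV A (fun x y => (φ x - φ y) * (φ x - φ y)) ≤ R ^ 2
  pairSum_right : pairSum hV A (fun x y => (χ x - χ y) * (χ x - χ y)) ≤ R ^ 2
  pairSum_sub : pairSum hV A
    (fun x y => ((φ x - χ x) - (φ y - χ y)) * ((φ x - χ x) - (φ y - χ y))) ≤ (δ * R) ^ 2

theorem SymbolClose.opClose {hV : V.IsHermitian} {A : Finset n} {φ χ : ℝ → ℝ}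
    (h : SymbolClose hV A δ R φ χ) : OpClose δ R (funMat hV φ) (funMat hV χ) := by
  refine ⟨opBound_funMat hV h.nonneg h.left, opBound_funMat hV h.nonneg h.right, ?_⟩
  rw [funMat_sub]
  exact opBound_funMat hV (mul_nonneg h.delta_nonneg h.nonneg) h.sub

theorem SymbolClose.hsClose {hV : V.IsHermitian} {A : Finset n} {φ χ : ℝ → ℝ}
    (h : SymbolClose hV A δ R φ χ) :
    HsClose δ (2 * R) (signMat A * funMat hV φ - funMat hV φ * signMat A)
      (signMat A * funMat hV χ - funMat hV χ * signMat A) := by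
  refine ⟨norm_commutator_le hV A h.nonneg h.pairSum_left,
    norm_commutator_le hV A h.nonneg h.pairSum_right, ?_⟩
  have e : signMat A * funMat hV φ - funMat hV φ * signMat A
      - (signMat A * funMat hV χ - funMat hV χ * signMat A)
      = signMat A * (funMat hV φ - funMat hV χ) - (funMat hV φ - funMat hV χ) * signMat A := by
    noncomm_ring
  rw [e, funMat_sub]
  exact (norm_commutator_le hV A (mul_nonneg h.delta_nonneg h.nonneg) h.pairSum_sub).trans_eq
    (by ring)

theorem SymbolClose.abs_blockDefect_pow_sub_le {hV : V.IsHermitian} {A : Finset n} {φ χ : ℝ → ℝ}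
    (h : SymbolClose hV A δ R φ χ) (k : ℕ) :
    |blockDefect hV φ (fun x => x ^ k) A - blockDefect hV χ (fun x => x ^ k) A|
      ≤ δ * stabilityConst k R := by
  have hδ := h.delta_nonneg
  have hMM := h.opClose
  have hC := h.hsClose
  set S := signMat A with hS
  set M := funMat hV φ with hM
  set M' := funMat hV χ with hM'
  have hSS : OpClose δ 1 S S := OpClose.refl hδ (opBound_signMat A)
  have hpinch : OpClose δ (5 * R) (pinch A M) (pinch A M') := by
    have h1 := (OpClose.refl hδ (opBound_diagonal (n := n) (w := fun _ => (1 / 2 : ℝ))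
      (by norm_num : (0 : ℝ) ≤ 1 / 2) (fun i => by norm_num)))
    have h2 := hMM.add ((hSS.mul hMM).mul hSS)
    have h3 := h1.mul h2
    have e : 2 * (1 / 2) * (R + 2 * (2 * 1 * R) * 1) = 5 * R := by ring
    rwa [e] at h3
  have hT : ∀ φ : ℝ → ℝ, blockDefect hV φ (fun x => x ^ k) A
      = (pinch A (funMat hV φ) ^ k).trace - (funMat hV φ ^ k).trace := by
    intro φ; rw [blockDefect_pow, trace_pinch_pow]
  rw [hT, hT, trace_pinch_pow_sub, trace_pinch_pow_sub, ← hM, ← hM', ← hS, neg_sub_neg,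
    ← Finset.sum_sub_distrib, stabilityConst, Finset.mul_sum]
  refine (Finset.abs_sum_le_sum_abs _ _).trans (Finset.sum_le_sum fun j _ => ?_)
  have h := ((hpinch.pow hδ j).mul_hs hδ (hC.mul_op hδ hSS)).abs_trace_sub_le hδ
    (((hMM.commutator_pow hδ hC (k - (j + 1)))).mul_op hδ hSS)
  rw [abs_sub_comm, ← sub_div, abs_div, abs_of_pos (by norm_num : (0 : ℝ) < 4), ← mul_div_assoc]
  refine div_le_div_of_nonneg_right (h.trans_eq ?_) (by norm_num)
  ring

theorem trace_commutator_mul (hV : V.IsHermitian) (A : Finset n) (φ χ : ℝ → ℝ) :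
    ((signMat A * funMat hV φ - funMat hV φ * signMat A) *
      (signMat A * funMat hV χ - funMat hV χ * signMat A)).trace
      = -4 * pairSum hV A (fun x y => (φ x - φ y) * (χ x - χ y)) := by
  have h1 : ∀ i j, (signMat A * funMat hV φ - funMat hV φ * signMat A) i j *
      (signMat A * funMat hV χ - funMat hV χ * signMat A) j i
      = if (i ∈ A ↔ j ∈ A) then 0 else -4 * (funMat hV φ i j * funMat hV χ i j) := by
    intro i j
    rw [Matrix.sub_apply, Matrix.sub_apply, signMat, Matrix.mul_diagonal, Matrix.diagonal_mul,
      Matrix.mul_diagonal, Matrix.diagonal_mul, funMat_apply_comm hV χ j i]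
    by_cases hi : i ∈ A <;> by_cases hj : j ∈ A <;> simp [hi, hj] <;> ring
  have h2 := sum_offDiagonal A (fun i j => -4 * (funMat hV φ i j * funMat hV χ i j))
    (fun i j => by rw [funMat_apply_comm hV φ, funMat_apply_comm hV χ])
  rw [pairSum_increments, Matrix.trace]
  simp only [Matrix.diag_apply, Matrix.mul_apply, h1]
  rw [h2]
  simp only [← Finset.mul_sum]
  ring

theorem SymbolClose.abs_pairSum_pow_sub_le {hV : V.IsHermitian} {A : Finset n} {φ χ : ℝ → ℝ}
    (h : SymbolClose hV A δ R φ χ) (j l : ℕ) :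
    |pairSum hV A (fun x y => (φ x ^ j - φ y ^ j) * (φ x ^ l - φ y ^ l))
        - pairSum hV A (fun x y => (χ x ^ j - χ y ^ j) * (χ x ^ l - χ y ^ l))|
      ≤ δ * (2 * (j * (2 * (2 * R) ^ j)) * (l * (2 * (2 * R) ^ l)) / 4) := by
  have h1 := (h.opClose.commutator_pow h.delta_nonneg h.hsClose j).abs_trace_sub_le h.delta_nonneg
    (h.opClose.commutator_pow h.delta_nonneg h.hsClose l)
  simp only [funMat_pow, trace_commutator_mul] at h1
  rw [← mul_sub, abs_mul, abs_of_neg (by norm_num : (-4 : ℝ) < 0)] at h1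
  linarith

end Stability

/-! ### The kernel of the limiting quadratic form -/

section Kernel

/-- The average of `h` over the segment from `s` to `t`. -/
def segmentAvg (h : ℝ → ℝ) (s t : ℝ) : ℝ := ∫ r in (0 : ℝ)..1, h ((1 - r) * s + r * t)

/-- Half the integral over the square `[x, y]²` of the average of `h` over segments. For `h = -g''`
this is the functional `∫₀¹ (g((1 - t) x + t y) - (1 - t) g(x) - t g(y)) / (t (1 - t)) dt` of
Widom's trace formula. -/
def widomKernel (h : ℝ → ℝ) (x y : ℝ) : ℝ := (∫ s in x..y, ∫ t in x..y, segmentAvg h s t) / 2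

variable {h h₁ h₂ : ℝ → ℝ} {x y : ℝ}

theorem continuous_segmentAvg (hh : Continuous h) :
    Continuous fun p : ℝ × ℝ => segmentAvg h p.1 p.2 := by
  unfold segmentAvg
  apply intervalIntegral.continuous_parametric_intervalIntegral_of_continuous'
  fun_prop

theorem continuous_integral_segmentAvg (hh : Continuous h) (x y : ℝ) :
    Continuous fun s => ∫ t in x..y, segmentAvg h s t := by
  have := continuous_segmentAvg hh
  apply intervalIntegral.continuous_parametric_intervalIntegral_of_continuous'
  exact this

theorem segmentAvg_add (hh₁ : Continuous h₁) (hh₂ : Continuous h₂) (s t : ℝ) :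
    segmentAvg (fun x => h₁ x + h₂ x) s t = segmentAvg h₁ s t + segmentAvg h₂ s t := by
  unfold segmentAvg
  exact intervalIntegral.integral_add (Continuous.intervalIntegrable (by fun_prop) _ _)
    (Continuous.intervalIntegrable (by fun_prop) _ _)

theorem segmentAvg_const_mul (c : ℝ) (h : ℝ → ℝ) (s t : ℝ) :
    segmentAvg (fun x => c * h x) s t = c * segmentAvg h s t := by
  simp only [segmentAvg, intervalIntegral.integral_const_mul]

theorem widomKernel_add (hh₁ : Continuous h₁) (hh₂ : Continuous h₂) (x y : ℝ) :
    widomKernel (fun x => h₁ x + h₂ x) x y = widomKernel h₁ x y + widomKernel h₂ x y := by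
  have e : ∀ s, ∫ t in x..y, segmentAvg (fun x => h₁ x + h₂ x) s t
      = (∫ t in x..y, segmentAvg h₁ s t) + ∫ t in x..y, segmentAvg h₂ s t := by
    intro s
    simp only [segmentAvg_add hh₁ hh₂]
    have e1 := continuous_segmentAvg hh₁
    have e2 := continuous_segmentAvg hh₂
    exact intervalIntegral.integral_add
      (Continuous.intervalIntegrable (e1.comp (Continuous.prodMk_right s)) _ _)
      (Continuous.intervalIntegrable (e2.comp (Continuous.prodMk_right s)) _ _)
  simp only [widomKernel, e]
  rw [intervalIntegral.integral_add
    ((continuous_integral_segmentAvg hh₁ x y).intervalIntegrable _ _)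
    ((continuous_integral_segmentAvg hh₂ x y).intervalIntegrable _ _)]
  ring

theorem widomKernel_const_mul (c : ℝ) (h : ℝ → ℝ) (x y : ℝ) :
    widomKernel (fun x => c * h x) x y = c * widomKernel h x y := by
  simp only [widomKernel, segmentAvg_const_mul, intervalIntegral.integral_const_mul]
  ring

theorem widomKernel_symm (h : ℝ → ℝ) (x y : ℝ) : widomKernel h x y = widomKernel h y x := by
  have e : ∀ s, ∫ t in x..y, segmentAvg h s t = -∫ t in y..x, segmentAvg h s t :=
    fun s => intervalIntegral.integral_symm _ _
  simp only [widomKernel, e, intervalIntegral.integral_neg]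
  rw [intervalIntegral.integral_symm y x, neg_neg]

theorem segmentAvg_mono (hh₁ : Continuous h₁) (hh₂ : Continuous h₂) {I : Set ℝ} (hI : Convex ℝ I)
    (hle : ∀ x ∈ I, h₁ x ≤ h₂ x) {s t : ℝ} (hs : s ∈ I) (ht : t ∈ I) :
    segmentAvg h₁ s t ≤ segmentAvg h₂ s t := by
  refine intervalIntegral.integral_mono_on zero_le_one
    (Continuous.intervalIntegrable (by fun_prop) _ _)
    (Continuous.intervalIntegrable (by fun_prop) _ _) fun r hr => hle _ ?_
  exact hI hs ht (by linarith [hr.2]) hr.1 (by ring)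

/-- A bound of the segment averages by products of derivatives bounds the kernel by squared
increments. -/
theorem widomKernel_le_sq (hh : Continuous h) {ψ₁ ψ₂ ψ₁' ψ₂' : ℝ → ℝ}
    (h₁ : ∀ s ∈ Set.uIcc x y, HasDerivAt ψ₁ (ψ₁' s) s)
    (h₂ : ∀ s ∈ Set.uIcc x y, HasDerivAt ψ₂ (ψ₂' s) s)
    (hc₁ : ContinuousOn ψ₁' (Set.uIcc x y)) (hc₂ : ContinuousOn ψ₂' (Set.uIcc x y))
    (hle : ∀ s ∈ Set.uIcc x y, ∀ t ∈ Set.uIcc x y,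
      segmentAvg h s t ≤ ψ₁' s * ψ₁' t + ψ₂' s * ψ₂' t) :
    widomKernel h x y ≤ ((ψ₁ x - ψ₁ y) ^ 2 + (ψ₂ x - ψ₂ y) ^ 2) / 2 := by
  wlog hxy : x ≤ y generalizing x y
  · rw [widomKernel_symm, sub_sq_comm (ψ₁ x), sub_sq_comm (ψ₂ x)]
    rw [Set.uIcc_comm] at *
    exact this h₁ h₂ hc₁ hc₂ hle (le_of_not_ge hxy)
  have i₁ : IntervalIntegrable ψ₁' MeasureTheory.volume x y := hc₁.intervalIntegrable
  have i₂ : IntervalIntegrable ψ₂' MeasureTheory.volume x y := hc₂.intervalIntegrable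
  have e₁ := intervalIntegral.integral_eq_sub_of_hasDerivAt h₁ i₁
  have e₂ := intervalIntegral.integral_eq_sub_of_hasDerivAt h₂ i₂
  have hinner : ∀ s ∈ Set.Icc x y, ∫ t in x..y, segmentAvg h s t
      ≤ ψ₁' s * (ψ₁ y - ψ₁ x) + ψ₂' s * (ψ₂ y - ψ₂ x) := by
    intro s hs
    rw [← e₁, ← e₂, ← intervalIntegral.integral_const_mul, ← intervalIntegral.integral_const_mul,
      ← intervalIntegral.integral_add (i₁.const_mul _) (i₂.const_mul _)]
    rw [← Set.uIcc_of_le hxy] at hs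
    refine intervalIntegral.integral_mono_on hxy (Continuous.intervalIntegrable
      ((continuous_segmentAvg hh).comp (Continuous.prodMk_right s)) _ _)
      ((i₁.const_mul _).add (i₂.const_mul _)) fun t ht => ?_
    rw [← Set.uIcc_of_le hxy] at ht
    exact hle s hs t ht
  have houter : ∫ s in x..y, ∫ t in x..y, segmentAvg h s t
      ≤ ∫ s in x..y, (ψ₁' s * (ψ₁ y - ψ₁ x) + ψ₂' s * (ψ₂ y - ψ₂ x)) :=
    intervalIntegral.integral_mono_on hxy
      ((continuous_integral_segmentAvg hh x y).intervalIntegrable _ _)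
      ((i₁.mul_const _).add (i₂.mul_const _)) hinner
  rw [intervalIntegral.integral_add (i₁.mul_const _) (i₂.mul_const _),
    intervalIntegral.integral_mul_const, intervalIntegral.integral_mul_const, e₁, e₂] at houter
  rw [widomKernel]
  nlinarith

theorem widomKernel_le_of_le {C : ℝ} (hh : Continuous h) (hC : 0 ≤ C)
    (hle : ∀ s ∈ Set.uIcc x y, h s ≤ C) : widomKernel h x y ≤ C / 2 * ((x - y) * (x - y)) := by
  have hsq : Real.sqrt C * Real.sqrt C = C := Real.mul_self_sqrt hC
  have := widomKernel_le_sq (x := x) (y := y) hh (ψ₁ := fun s => Real.sqrt C * s)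
    (ψ₁' := fun _ => Real.sqrt C) (ψ₂ := fun _ => 0) (ψ₂' := fun _ => 0)
    (fun s _ => by simpa using (hasDerivAt_id s).const_mul (Real.sqrt C))
    (fun s _ => hasDerivAt_const s 0) continuousOn_const continuousOn_const (by
      intro s hs t ht
      have e := segmentAvg_mono hh (continuous_const (y := C)) (convex_uIcc x y) hle hs ht
      have e' : segmentAvg (fun _ => C) s t = C := by simp [segmentAvg]
      rw [hsq]
      linarith)
  calc _ ≤ _ := this
    _ = Real.sqrt C * Real.sqrt C / 2 * ((x - y) * (x - y)) := by ring
    _ = _ := by rw [hsq]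

theorem abs_widomKernel_le {C : ℝ} (hh : Continuous h)
    (hle : ∀ s ∈ Set.uIcc x y, |h s| ≤ C) : |widomKernel h x y| ≤ C / 2 * ((x - y) * (x - y)) := by
  have hC : 0 ≤ C := (abs_nonneg _).trans (hle x Set.left_mem_uIcc)
  have h1 := widomKernel_le_of_le hh hC fun s hs => (abs_le.1 (hle s hs)).2
  have h2 := widomKernel_le_of_le (h := fun x => -1 * h x) (continuous_const.mul hh) hC
    fun s hs => by linarith [(abs_le.1 (hle s hs)).1]
  rw [widomKernel_const_mul] at h2
  exact abs_le.2 ⟨by linarith, h1⟩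

theorem segmentAvg_pow (k : ℕ) (s t : ℝ) :
    segmentAvg (fun x => (k + 1) * x ^ k) s t
      = ∑ i ∈ Finset.range (k + 1), t ^ i * s ^ (k - i) := by
  unfold segmentAvg
  rcases eq_or_ne s t with rfl | hst
  · have e : ∀ r : ℝ, (1 - r) * s + r * s = s := fun r => by ring
    simp only [e, ← pow_add]
    rw [Finset.sum_congr rfl fun i hi => by
      rw [Nat.add_sub_cancel' (Nat.lt_succ_iff.1 (Finset.mem_range.1 hi))]]
    simp
  · have hd : ∀ r ∈ Set.uIcc (0 : ℝ) 1, HasDerivAt (fun r => ((1 - r) * s + r * t) ^ (k + 1))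
        ((k + 1) * ((1 - r) * s + r * t) ^ k * (t - s)) r := by
      intro r _
      have h1 : HasDerivAt (fun r : ℝ => (1 - r) * s + r * t) (t - s) r :=
        ((((hasDerivAt_id r).const_sub 1).mul_const s).add
          ((hasDerivAt_id r).mul_const t)).congr_deriv (by ring)
      exact (h1.pow (k + 1)).congr_deriv (by push_cast; simp)
    have h1 := intervalIntegral.integral_eq_sub_of_hasDerivAt hd
      (Continuous.intervalIntegrable (by fun_prop) _ _)
    rw [intervalIntegral.integral_mul_const] at h1
    have h2 := geom_sum₂_mul t s (k + 1)
    have h3 : t - s ≠ 0 := sub_ne_zero.2 hst.symm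
    apply mul_right_cancel₀ h3
    rw [h1]
    simp only [Nat.add_sub_cancel] at h2
    rw [h2]
    simp

/-- For `g(x) = xⁿ` the kernel is the one that arises from counting paths. -/
theorem widomKernel_pow (n : ℕ) (x y : ℝ) :
    widomKernel (fun x => -(n * (n - 1 : ℕ) * x ^ (n - 2))) x y = powKernel n x y := by
  rcases n with - | - | k
  · simp [widomKernel, segmentAvg, powKernel]
  · simp [widomKernel, segmentAvg, powKernel]
  have h1 : ∀ s t, segmentAvg (fun x => -(((k + 2 : ℕ) : ℝ) * (k + 2 - 1 : ℕ) * x ^ (k + 2 - 2))) s t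
      = -(k + 2) * ∑ i ∈ Finset.range (k + 1), t ^ i * s ^ (k - i) := by
    intro s t
    rw [← segmentAvg_pow, ← segmentAvg_const_mul]
    congr 1
    funext x
    simp only [Nat.add_sub_cancel, show k + 2 - 1 = k + 1 from rfl]
    push_cast
    ring
  set P : ℕ → ℝ := fun i => (y ^ (i + 1) - x ^ (i + 1)) * (y ^ (k - i + 1) - x ^ (k - i + 1)) with hP
  have h2 : widomKernel (fun x => -(((k + 2 : ℕ) : ℝ) * (k + 2 - 1 : ℕ) * x ^ (k + 2 - 2))) x y
      = -(k + 2) / 2 * ∑ i ∈ Finset.range (k + 1), P i / ((i + 1) * ((k - i : ℕ) + 1)) := by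
    rw [widomKernel]
    simp only [h1, intervalIntegral.integral_const_mul]
    have e : ∀ s : ℝ, ∫ t in x..y, ∑ i ∈ Finset.range (k + 1), t ^ i * s ^ (k - i)
        = ∑ i ∈ Finset.range (k + 1), (y ^ (i + 1) - x ^ (i + 1)) / (i + 1) * s ^ (k - i) := by
      intro s
      rw [intervalIntegral.integral_finsetSum fun i _ =>
        Continuous.intervalIntegrable (by fun_prop) _ _]
      simp only [intervalIntegral.integral_mul_const, integral_pow]
    simp only [e]
    rw [intervalIntegral.integral_finsetSum fun i _ =>
        Continuous.intervalIntegrable (by fun_prop) _ _]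
    simp only [intervalIntegral.integral_const_mul, integral_pow]
    rw [mul_div_right_comm]
    congr 1
    exact Finset.sum_congr rfl fun i _ => by simp only [hP]; field_simp
  have h3 : ∑ i ∈ Finset.range (k + 1), P i / ((k - i : ℕ) + 1)
      = ∑ i ∈ Finset.range (k + 1), P i / (i + 1) := by
    rw [← Finset.sum_range_reflect]
    refine Finset.sum_congr rfl fun i hi => ?_
    have hi' := Nat.lt_succ_iff.1 (Finset.mem_range.1 hi)
    have e1 : k + 1 - 1 - i = k - i := by omega
    have e2 : k - (k - i) = i := by omega
    simp only [hP, e1, e2]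
    ring
  have h4 : powKernel (k + 2) x y = -∑ i ∈ Finset.range (k + 1), P i / (i + 1) := by
    rw [powKernel, Finset.sum_range_succ]
    simp only [Nat.sub_self, pow_zero, sub_self, mul_zero, zero_div, add_zero]
    congr 1
    refine Finset.sum_congr rfl fun i hi => ?_
    have hi' := Nat.lt_succ_iff.1 (Finset.mem_range.1 hi)
    have e1 : k + 2 - (i + 1) = k - i + 1 := by omega
    simp only [hP, e1]
    ring
  have h5 : ∑ i ∈ Finset.range (k + 1), (k + 2) * (P i / ((i + 1) * ((k - i : ℕ) + 1)))
      = ∑ i ∈ Finset.range (k + 1), (P i / (i + 1) + P i / ((k - i : ℕ) + 1)) := by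
    refine Finset.sum_congr rfl fun i hi => ?_
    have hi' := Nat.lt_succ_iff.1 (Finset.mem_range.1 hi)
    have e : ((k - i : ℕ) : ℝ) = k - i := by push_cast [hi']; ring
    have e0 : (0 : ℝ) < (k - i : ℕ) + 1 := by positivity
    have e3 : (k + 2 : ℝ) = (i + 1) + ((k - i : ℕ) + 1) := by rw [e]; ring
    rw [e3]
    field_simp
    ring
  rw [← Finset.mul_sum, Finset.sum_add_distrib, h3] at h5
  rw [h2, h4]
  linarith

end Kernel

/-! ### The limit of the block defect -/

section Limit

open Filter Topology

/-- Two quantities that depend on the ratio and the number of sites tend to a common limit, which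
does not depend on the ratio. -/
def BothTendTo (F G : ℝ → ℕ → ℝ) (ℓ : ℝ) : Prop :=
  ∀ q : ℝ, 0 < q → q < 1 → Tendsto (F q) atTop (𝓝 ℓ) ∧ Tendsto (G q) atTop (𝓝 ℓ)

/-- Existence of a common limit is preserved under uniform approximation. -/
theorem exists_bothTendTo_of_approx {F G : ℝ → ℕ → ℝ}
    (h : ∀ ε > 0, ∃ F' G' ℓ', BothTendTo F' G' ℓ' ∧ ∀ q : ℝ, 0 < q → q < 1 → ∀ᶠ N in atTop,
      |F q N - F' q N| ≤ ε ∧ |G q N - G' q N| ≤ ε) : ∃ ℓ, BothTendTo F G ℓ := by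
  have key : ∀ ε > 0, ∃ ℓ' : ℝ, ∀ q : ℝ, 0 < q → q < 1 → ∀ᶠ N in atTop,
      |F q N - ℓ'| ≤ ε ∧ |G q N - ℓ'| ≤ ε := by
    intro ε hε
    obtain ⟨F', G', ℓ', h1, h2⟩ := h (ε / 2) (by positivity)
    refine ⟨ℓ', fun q hq0 hq1 => ?_⟩
    have h3 := (Metric.tendsto_nhds.1 (h1 q hq0 hq1).1) (ε / 2) (by positivity)
    have h4 := (Metric.tendsto_nhds.1 (h1 q hq0 hq1).2) (ε / 2) (by positivity)
    filter_upwards [h2 q hq0 hq1, h3, h4] with N ⟨h5, h6⟩ h7 h8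
    rw [Real.dist_eq] at h7 h8
    constructor
    · calc |F q N - ℓ'| ≤ |F q N - F' q N| + |F' q N - ℓ'| := abs_sub_le _ _ _
        _ ≤ ε := by linarith
    · calc |G q N - ℓ'| ≤ |G q N - G' q N| + |G' q N - ℓ'| := abs_sub_le _ _ _
        _ ≤ ε := by linarith
  have hcauchy : CauchySeq (F (1 / 2)) := by
    rw [Metric.cauchySeq_iff']
    intro ε hε
    obtain ⟨ℓ', h1⟩ := key (ε / 3) (by positivity)
    obtain ⟨N₀, h2⟩ := eventually_atTop.1 (h1 (1 / 2) (by norm_num) (by norm_num))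
    refine ⟨N₀, fun N hN => ?_⟩
    rw [Real.dist_eq]
    have h3 := (h2 N hN).1
    have h4 := (h2 N₀ le_rfl).1
    rw [abs_sub_comm] at h4
    calc _ ≤ |F (1 / 2) N - ℓ'| + |ℓ' - F (1 / 2) N₀| := abs_sub_le _ _ _
      _ < ε := by linarith
  obtain ⟨ℓ, hℓ⟩ := cauchySeq_tendsto_of_complete hcauchy
  refine ⟨ℓ, fun q hq0 hq1 => ?_⟩
  have key2 : ∀ ε > 0, ∀ᶠ N in atTop, |F q N - ℓ| < ε ∧ |G q N - ℓ| < ε := by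
    intro ε hε
    obtain ⟨ℓ', h1⟩ := key (ε / 3) (by positivity)
    have h2 : |ℓ - ℓ'| ≤ ε / 3 := by
      have h3 : Tendsto (fun N => |F (1 / 2) N - ℓ'|) atTop (𝓝 |ℓ - ℓ'|) :=
        (hℓ.sub_const ℓ').abs
      exact le_of_tendsto h3 ((h1 (1 / 2) (by norm_num) (by norm_num)).mono fun N h => h.1)
    rw [abs_sub_comm] at h2
    filter_upwards [h1 q hq0 hq1] with N ⟨h3, h4⟩
    constructor
    · calc _ ≤ |F q N - ℓ'| + |ℓ' - ℓ| := abs_sub_le _ _ _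
        _ < ε := by linarith
    · calc _ ≤ |G q N - ℓ'| + |ℓ' - ℓ| := abs_sub_le _ _ _
        _ < ε := by linarith
  exact ⟨Metric.tendsto_nhds.2 fun ε hε => (key2 ε hε).mono fun N h => h.1,
    Metric.tendsto_nhds.2 fun ε hε => (key2 ε hε).mono fun N h => h.2⟩

/-- The block defect of the coupling matrix. -/
abbrev chainDefect (a b : ℝ) (φ g : ℝ → ℝ) (q : ℝ) (N : ℕ) : ℝ :=
  blockDefect (couplingXX_isHermitian a b N) φ g (block q N)

/-- The pair sum of the coupling matrix. -/
abbrev chainPairSum (a b : ℝ) (F : ℝ → ℝ → ℝ) (q : ℝ) (N : ℕ) : ℝ :=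
  pairSum (couplingXX_isHermitian a b N) (block q N) F

/-- The energy band. -/
def band (a b : ℝ) : Set ℝ := Set.Icc (a - 2 * b) (a + 2 * b)

theorem exists_antiderivative (p : Polynomial ℝ) :
    ∃ P : Polynomial ℝ, Polynomial.derivative P = p := by
  induction p using Polynomial.induction_on' with
  | add p q hp hq =>
    obtain ⟨P, rfl⟩ := hp
    obtain ⟨Q, rfl⟩ := hq
    exact ⟨P + Q, Polynomial.derivative_add⟩
  | monomial n c =>
    refine ⟨Polynomial.monomial (n + 1) (c / (n + 1)), ?_⟩
    rw [Polynomial.derivative_monomial]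
    simp only [Nat.add_sub_cancel]
    congr 1
    push_cast
    field_simp

/-- Approximation by polynomials in `C¹`. -/
theorem exists_polynomial_near_deriv {φ φ' : ℝ → ℝ} (hφ : ∀ x, HasDerivAt φ (φ' x) x)
    (hφ' : Continuous φ') {a b η : ℝ} (hb : 0 < b) (hη : 0 < η) :
    ∃ p : Polynomial ℝ,
      (∀ x ∈ band a b, ∀ y ∈ band a b, |(φ x - p.eval x) - (φ y - p.eval y)| ≤ η * |x - y|) ∧
      (∀ x ∈ band a b, |φ x - p.eval x| ≤ η * (2 * b)) ∧
      ∀ x ∈ band a b, |φ' x - (Polynomial.derivative p).eval x| ≤ η := by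
  obtain ⟨r, hr⟩ := exists_polynomial_near_of_continuousOn (a - 2 * b) (a + 2 * b) φ'
    hφ'.continuousOn η hη
  obtain ⟨P, rfl⟩ := exists_antiderivative r
  have hlip : ∀ x ∈ band a b, ∀ y ∈ band a b, |(φ x - (P.eval x + (φ a - P.eval a)))
      - (φ y - (P.eval y + (φ a - P.eval a)))| ≤ η * |x - y| := by
    intro x hx y hy
    refine (convex_Icc (a - 2 * b) (a + 2 * b)).norm_image_sub_le_of_norm_hasDerivWithin_le
      (f := fun x => φ x - (P.eval x + (φ a - P.eval a)))
      (f' := fun x => φ' x - (Polynomial.derivative P).eval x)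
      (fun z _ => ((hφ z).sub ((P.hasDerivAt z).add_const _)).hasDerivWithinAt) ?_ hy hx
    intro z hz
    rw [Real.norm_eq_abs, abs_sub_comm]
    exact (hr z hz).le
  refine ⟨P + Polynomial.C (φ a - P.eval a), ?_, ?_, fun x hx => ?_⟩
  · simpa only [Polynomial.eval_add, Polynomial.eval_C] using hlip
  · intro x hx
    have h := hlip x hx a ⟨by linarith, by linarith⟩
    simp only [add_sub_cancel, sub_self, sub_zero] at h
    rw [Polynomial.eval_add, Polynomial.eval_C]
    refine h.trans (mul_le_mul_of_nonneg_left ?_ hη.le)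
    rw [abs_le]
    constructor <;> linarith [hx.1, hx.2]
  · rw [Polynomial.derivative_add, Polynomial.derivative_C, add_zero, abs_sub_comm]
    exact (hr x hx).le

variable {a b : ℝ} {φ φ' : ℝ → ℝ}

/-- Any pair sum whose summand is at most a multiple of `(x - y)²` on the band is bounded uniformly in
the number of sites. -/
theorem eventually_pairSum_sq_le (hb : 0 < b) {q : ℝ} (hq0 : 0 < q) (hq1 : q < 1) :
    ∀ᶠ N in atTop, (∀ k, (couplingXX_isHermitian a b N).eigenvalues k ∈ band a b) ∧
      ∀ (F : ℝ → ℝ → ℝ) (C : ℝ),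
        (∀ x ∈ band a b, ∀ y ∈ band a b, F x y ≤ C * ((x - y) * (x - y))) →
        chainPairSum a b F q N ≤ C * (4 * b ^ 2) := by
  filter_upwards [eventually_pairSum_sub_sq a b hq0 hq1, eventually_ge_atTop 3] with N h hN
  have hmem : ∀ k, (couplingXX_isHermitian a b N).eigenvalues k ∈ band a b :=
    eigenvalues_mem_band hb hN
  refine ⟨hmem, fun F C hF => ?_⟩
  rw [← h, ← pairSum_const_mul]
  exact pairSum_le fun k l => hF _ (hmem k) _ (hmem l)

theorem exists_band_bound (hφ : ∀ x, HasDerivAt φ (φ' x) x) (hφ' : Continuous φ') (a b : ℝ) :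
    ∃ B : ℝ, 0 ≤ B ∧ (∀ x ∈ band a b, |φ x| ≤ B) ∧
      ∀ x ∈ band a b, ∀ y ∈ band a b, |φ x - φ y| ≤ B * |x - y| := by
  obtain ⟨B₁, h1⟩ := isCompact_Icc.exists_bound_of_continuousOn (s := band a b)
    (f := φ) (fun x _ => (hφ x).continuousAt.continuousWithinAt)
  obtain ⟨B₂, h2⟩ := isCompact_Icc.exists_bound_of_continuousOn (s := band a b)
    (f := φ') hφ'.continuousOn
  refine ⟨max 0 (max B₁ B₂), le_max_left _ _, fun x hx => ?_, fun x hx y hy => ?_⟩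
  · exact (h1 x hx).trans ((le_max_left _ _).trans (le_max_right _ _))
  · exact (convex_Icc (a - 2 * b) (a + 2 * b)).norm_image_sub_le_of_norm_hasDerivWithin_le
      (fun z _ => (hφ z).hasDerivWithinAt)
      (fun z hz => (h2 z hz).trans ((le_max_right _ _).trans (le_max_right _ _))) hy hx

theorem mul_self_le_of_abs_le {u B x y : ℝ} (h : |u| ≤ B * |x - y|) :
    u * u ≤ B ^ 2 * ((x - y) * (x - y)) := by
  have h1 := mul_self_le_mul_self (abs_nonneg u) h
  rw [abs_mul_abs_self] at h1
  have h2 := abs_mul_abs_self (x - y)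
  nlinarith

/-- The limit for powers: approximate the symbol by a polynomial in `C¹`, for which both sequences are
eventually constant, and use the stability estimates. -/
theorem exists_bothTendTo_pow (hb : 0 < b) (hφ : ∀ x, HasDerivAt φ (φ' x) x)
    (hφ' : Continuous φ') (n : ℕ) :
    ∃ ℓ, BothTendTo (chainDefect a b φ fun x => x ^ n)
      (chainPairSum a b fun x y => powKernel n (φ x) (φ y)) ℓ := by
  obtain ⟨B, hB0, hB, hBL⟩ := exists_band_bound hφ hφ' a b
  set R := (B + 1) * (2 * b + 1) with hR
  have hR0 : 0 ≤ R := by positivity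
  set C := stabilityConst n R + ∑ j ∈ Finset.range n,
    2 * (((j + 1 : ℕ) : ℝ) * (2 * (2 * R) ^ (j + 1))) *
      ((n - (j + 1) : ℕ) * (2 * (2 * R) ^ (n - (j + 1)))) / 4 / (j + 1) with hC
  have hC1 : 0 ≤ stabilityConst n R :=
    Finset.sum_nonneg fun j _ => by positivity
  have hC2 : 0 ≤ ∑ j ∈ Finset.range n,
    2 * (((j + 1 : ℕ) : ℝ) * (2 * (2 * R) ^ (j + 1))) *
      ((n - (j + 1) : ℕ) * (2 * (2 * R) ^ (n - (j + 1)))) / 4 / (j + 1) :=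
    Finset.sum_nonneg fun j _ => by positivity
  apply exists_bothTendTo_of_approx
  intro ε hε
  set η := min 1 (ε / (C + 1)) with hη
  have hη0 : 0 < η := lt_min one_pos (by positivity)
  have hη1 : η ≤ 1 := min_le_left _ _
  have hηC : η * C ≤ ε := by
    calc η * C ≤ ε / (C + 1) * (C + 1) := by
          apply mul_le_mul (min_le_right _ _) (by linarith) (by positivity) (by positivity)
      _ = ε := div_mul_cancel₀ _ (by positivity)
  obtain ⟨p, hp1, hp2, -⟩ := exists_polynomial_near_deriv (a := a) hφ hφ' hb hη0
  obtain ⟨ℓ, hℓ⟩ := eventually_blockDefect_pow_polynomial a b p n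
  refine ⟨chainDefect a b p.eval fun x => x ^ n,
    chainPairSum a b fun x y => powKernel n (p.eval x) (p.eval y), ℓ, ?_, ?_⟩
  · intro q hq0 hq1
    exact ⟨tendsto_const_nhds.congr' ((hℓ q hq0 hq1).mono fun N h => h.1.symm),
      tendsto_const_nhds.congr' ((hℓ q hq0 hq1).mono fun N h => h.2.symm)⟩
  intro q hq0 hq1
  filter_upwards [eventually_pairSum_sq_le (a := a) hb hq0 hq1] with N ⟨hmem, hsq⟩
  have hclose : SymbolClose (couplingXX_isHermitian a b N) (block q N) η R φ p.eval := by
    refine ⟨hη0.le, hR0, fun k => ?_, fun k => ?_, fun k => ?_, ?_, ?_, ?_⟩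
    · exact (hB _ (hmem k)).trans (by nlinarith)
    · have h1 := hB _ (hmem k)
      have h2 := hp2 _ (hmem k)
      have h3 := abs_sub_abs_le_abs_sub (p.eval ((couplingXX_isHermitian a b N).eigenvalues k))
        (φ ((couplingXX_isHermitian a b N).eigenvalues k))
      rw [abs_sub_comm] at h3
      nlinarith
    · exact (hp2 _ (hmem k)).trans (by gcongr; nlinarith)
    · refine (hsq _ (B ^ 2) fun x hx y hy => mul_self_le_of_abs_le (hBL x hx y hy)).trans ?_
      calc B ^ 2 * (4 * b ^ 2) = (B * (2 * b)) ^ 2 := by ring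
        _ ≤ R ^ 2 := by gcongr; nlinarith
    · refine (hsq _ ((B + 1) ^ 2) fun x hx y hy => mul_self_le_of_abs_le ?_).trans ?_
      · have h1 := hBL x hx y hy
        have h2 := hp1 x hx y hy
        have h3 := abs_sub_abs_le_abs_sub (p.eval x - p.eval y) (φ x - φ y)
        rw [show p.eval x - p.eval y - (φ x - φ y) = -((φ x - p.eval x) - (φ y - p.eval y)) by ring,
          abs_neg] at h3
        nlinarith [abs_nonneg (x - y)]
      · calc (B + 1) ^ 2 * (4 * b ^ 2) = ((B + 1) * (2 * b)) ^ 2 := by ring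
          _ ≤ R ^ 2 := by gcongr; nlinarith
    · refine (hsq _ (η ^ 2) fun x hx y hy => mul_self_le_of_abs_le (hp1 x hx y hy)).trans ?_
      calc η ^ 2 * (4 * b ^ 2) = (η * (2 * b)) ^ 2 := by ring
        _ ≤ (η * R) ^ 2 := by gcongr; nlinarith
  constructor
  · refine (hclose.abs_blockDefect_pow_sub_le n).trans (le_trans ?_ hηC)
    gcongr
    linarith
  · refine le_trans ?_ hηC
    have e : ∀ χ : ℝ → ℝ, chainPairSum a b (fun x y => powKernel n (χ x) (χ y)) q N
        = -∑ j ∈ Finset.range n, chainPairSum a b (fun x y => (χ x ^ (j + 1) - χ y ^ (j + 1)) *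
          (χ x ^ (n - (j + 1)) - χ y ^ (n - (j + 1)))) q N / (j + 1) := by
      intro χ
      exact pairSum_neg_sum _ _ _ (fun j x y => (χ x ^ (j + 1) - χ y ^ (j + 1)) *
          (χ x ^ (n - (j + 1)) - χ y ^ (n - (j + 1)))) _
    rw [e, e, neg_sub_neg, ← Finset.sum_sub_distrib]
    refine (Finset.abs_sum_le_sum_abs _ _).trans ?_
    calc _ ≤ ∑ j ∈ Finset.range n, η * (2 * (((j + 1 : ℕ) : ℝ) * (2 * (2 * R) ^ (j + 1))) *
      ((n - (j + 1) : ℕ) * (2 * (2 * R) ^ (n - (j + 1)))) / 4 / (j + 1)) := by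
          refine Finset.sum_le_sum fun j _ => ?_
          have h0 : (0 : ℝ) < j + 1 := by positivity
          rw [abs_sub_comm, ← sub_div, abs_div, abs_of_pos h0, ← mul_div_assoc]
          exact div_le_div_of_nonneg_right (hclose.abs_pairSum_pow_sub_le (j + 1) (n - (j + 1)))
            h0.le
      _ ≤ η * C := by
          rw [← Finset.mul_sum]
          gcongr
          linarith

theorem exists_bothTendTo_polynomial (hb : 0 < b) (hφ : ∀ x, HasDerivAt φ (φ' x) x)
    (hφ' : Continuous φ') (g : Polynomial ℝ) :
    ∃ ℓ, BothTendTo (chainDefect a b φ g.eval) (chainPairSum a b fun x y =>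
      widomKernel (fun z => -(Polynomial.derivative (Polynomial.derivative g)).eval z)
        (φ x) (φ y)) ℓ := by
  induction g using Polynomial.induction_on' with
  | add g₁ g₂ h₁ h₂ =>
    obtain ⟨ℓ₁, h₁⟩ := h₁
    obtain ⟨ℓ₂, h₂⟩ := h₂
    refine ⟨ℓ₁ + ℓ₂, fun q hq0 hq1 => ⟨?_, ?_⟩⟩
    · refine ((h₁ q hq0 hq1).1.add (h₂ q hq0 hq1).1).congr fun N => ?_
      rw [← blockDefect_add]
      simp only [Polynomial.eval_add]
    · refine ((h₁ q hq0 hq1).2.add (h₂ q hq0 hq1).2).congr fun N => ?_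
      rw [← pairSum_add]
      refine pairSum_congr fun k l => ?_
      rw [← widomKernel_add (by fun_prop) (by fun_prop)]
      simp only [Polynomial.derivative_add, Polynomial.eval_add, neg_add]
  | monomial n c =>
    obtain ⟨ℓ, h⟩ := exists_bothTendTo_pow (a := a) hb hφ hφ' n
    refine ⟨c * ℓ, fun q hq0 hq1 => ⟨?_, ?_⟩⟩
    · refine ((h q hq0 hq1).1.const_mul c).congr fun N => ?_
      rw [← blockDefect_const_mul]
      simp only [Polynomial.eval_monomial]
    · refine ((h q hq0 hq1).2.const_mul c).congr fun N => ?_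
      rw [← pairSum_const_mul]
      refine pairSum_congr fun k l => ?_
      rw [← widomKernel_pow, ← widomKernel_const_mul]
      congr 1
      funext z
      simp only [Polynomial.derivative_monomial, Polynomial.eval_monomial, Nat.sub_sub,
        Nat.reduceAdd]
      ring

/-- The limit of the block defect for a `C¹` symbol and a `C²` function. -/
theorem exists_bothTendTo (hb : 0 < b) (hφ : ∀ x, HasDerivAt φ (φ' x) x) (hφ' : Continuous φ')
    {c d : ℝ} (hcd : ∀ x ∈ band a b, φ x ∈ Set.Icc c d) {g g' h : ℝ → ℝ} (hh : Continuous h)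
    (hg : ∀ x ∈ Set.Icc c d, HasDerivAt g (g' x) x)
    (hg' : ∀ x ∈ Set.Ioo c d, HasDerivAt g' (-h x) x) :
    ∃ ℓ, BothTendTo (chainDefect a b φ g)
      (chainPairSum a b fun x y => widomKernel h (φ x) (φ y)) ℓ := by
  obtain ⟨B, hB0, -, hBL⟩ := exists_band_bound hφ hφ' a b
  apply exists_bothTendTo_of_approx
  intro ε hε
  set η := ε / (B ^ 2 * (4 * b ^ 2) + 1) with hη
  have hη0 : 0 < η := by positivity
  have hηε : η / 2 * (B ^ 2 * (4 * b ^ 2)) ≤ ε := by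
    have : η * (B ^ 2 * (4 * b ^ 2) + 1) = ε := by rw [hη]; field_simp
    have h0 : 0 ≤ B ^ 2 * (4 * b ^ 2) := by positivity
    nlinarith
  obtain ⟨r, hr⟩ := exists_polynomial_near_of_continuousOn c d h hh.continuousOn η hη0
  obtain ⟨P, hP⟩ := exists_antiderivative (-r)
  obtain ⟨Q, hQ⟩ := exists_antiderivative P
  obtain ⟨ℓ, hℓ⟩ := exists_bothTendTo_polynomial (a := a) hb hφ hφ' Q
  have hr' : ∀ x, -(Polynomial.derivative (Polynomial.derivative Q)).eval x = r.eval x := by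
    intro x; rw [hQ, hP]; simp
  simp only [hr'] at hℓ
  refine ⟨_, _, ℓ, hℓ, fun q hq0 hq1 => ?_⟩
  filter_upwards [eventually_pairSum_sq_le (a := a) hb hq0 hq1] with N ⟨hmem, hsq⟩
  have hsq' := hsq (fun x y => (φ x - φ y) * (φ x - φ y)) (B ^ 2)
    fun x hx y hy => mul_self_le_of_abs_le (hBL x hx y hy)
  constructor
  · have e : chainDefect a b φ g q N - chainDefect a b φ Q.eval q N
        = chainDefect a b φ (fun x => g x + (-1) * Q.eval x) q N := by
      simp only [chainDefect]
      rw [blockDefect_add, blockDefect_const_mul]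
      ring
    rw [e]
    have hconv : ∀ σ : ℝ, |σ| = 1 →
        ConvexOn ℝ (Set.Icc c d) fun x => η / 2 * x ^ 2 + σ * (g x + (-1) * Q.eval x) := by
      intro σ hσ
      refine convexOn_of_hasDerivWithinAt2_nonneg (convex_Icc c d)
        (f' := fun x => η * x + σ * (g' x + (-1) * P.eval x))
        (f'' := fun x => η + σ * (-h x + r.eval x)) ?_ ?_ ?_ ?_
      · intro x hx
        refine ContinuousAt.continuousWithinAt (ContinuousAt.add (by fun_prop)
          (continuousAt_const.mul ((hg x hx).continuousAt.add (by fun_prop))))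
      · intro x hx
        have hx' := interior_subset hx
        refine HasDerivAt.hasDerivWithinAt ?_
        have h1 := ((hasDerivAt_id x).pow 2).const_mul (η / 2)
        have h2 := Q.hasDerivAt x
        rw [hQ] at h2
        exact (h1.add (((hg x hx').add (h2.const_mul (-1))).const_mul σ)).congr_deriv
          (by simp; ring)
      · intro x hx
        rw [interior_Icc] at hx
        refine HasDerivAt.hasDerivWithinAt ?_
        have h2 := P.hasDerivAt x
        rw [hP] at h2
        exact (((hasDerivAt_id x).const_mul η).add
          (((hg' x hx).add (h2.const_mul (-1))).const_mul σ)).congr_deriv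
          (by simp)
      · intro x hx
        have h1 := hr x (interior_subset hx)
        have h2 : |σ * (-h x + r.eval x)| ≤ η := by
          rw [abs_mul, hσ, one_mul, neg_add_eq_sub]
          exact h1.le
        linarith [(abs_le.1 h2).1]
    have h1 := hconv 1 (by simp)
    have h2 := hconv (-1) (by simp)
    simp only [one_mul] at h1
    refine (abs_blockDefect_le h1 h2 (fun k => hcd _ (hmem k)) _).trans (le_trans ?_ hηε)
    gcongr
  · have e : chainPairSum a b (fun x y => widomKernel h (φ x) (φ y)) q N
        - chainPairSum a b (fun x y => widomKernel r.eval (φ x) (φ y)) q N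
        = chainPairSum a b (fun x y => widomKernel (fun z => h z + (-1) * r.eval z) (φ x) (φ y))
          q N := by
      have e1 : ∀ x y, widomKernel (fun z => h z + (-1) * r.eval z) (φ x) (φ y)
          = widomKernel h (φ x) (φ y) + (-1) * widomKernel r.eval (φ x) (φ y) := by
        intro x y
        rw [widomKernel_add hh (by fun_prop), widomKernel_const_mul]
      simp only [chainPairSum, e1]
      rw [pairSum_add, pairSum_const_mul]
      ring
    rw [e]
    have hab : ∀ x ∈ band a b, ∀ y ∈ band a b,
        |widomKernel (fun z => h z + (-1) * r.eval z) (φ x) (φ y)|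
          ≤ (η / 2 * B ^ 2) * ((x - y) * (x - y)) := by
      intro x hx y hy
      refine (abs_widomKernel_le (C := η) (by fun_prop) fun s hs => ?_).trans ?_
      · have hs' := Set.uIcc_subset_Icc (hcd x hx) (hcd y hy) hs
        have := (hr s hs').le
        rw [abs_sub_comm] at this
        rwa [neg_one_mul, ← sub_eq_add_neg]
      · rw [mul_assoc]
        exact mul_le_mul_of_nonneg_left (mul_self_le_of_abs_le (hBL x hx y hy)) (by positivity)
    rw [abs_le]
    constructor
    · have h1 := hsq (fun x y => -1 * widomKernel (fun z => h z + (-1) * r.eval z) (φ x) (φ y))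
        (η / 2 * B ^ 2) fun x hx y hy => by linarith [(abs_le.1 (hab x hx y hy)).1]
      rw [chainPairSum, pairSum_const_mul] at h1
      rw [chainPairSum]
      linarith
    · have h1 := hsq _ (η / 2 * B ^ 2) fun x hx y hy => (abs_le.1 (hab x hx y hy)).2
      linarith

end Limit

/-! ### Derivatives of the entropy of a mode -/

section EntropyDerivatives

/-- The sum `x ^ α + (1 - x) ^ α`. -/
def normPow (α x : ℝ) : ℝ := x ^ α + (1 - x) ^ α

/-- The difference `x ^ (α - 1) - (1 - x) ^ (α - 1)`. -/
def diffPow (α x : ℝ) : ℝ := x ^ (α - 1) - (1 - x) ^ (α - 1)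

/-- The derivative of the entropy of a mode. -/
def entropyDeriv (α x : ℝ) : ℝ :=
  if α = 1 then Real.log (1 - x) - Real.log x else (1 - α)⁻¹ * (α * diffPow α x / normPow α x)

/-- Minus the second derivative of the entropy of a mode. -/
def entropyCurv (α x : ℝ) : ℝ :=
  α / normPow α x ^ 2 * ((x * (1 - x)) ^ (α - 2) + (1 - α)⁻¹ * diffPow α x ^ 2)

variable {α x : ℝ}

theorem normPow_pos (hx0 : 0 < x) (hx1 : x < 1) : 0 < normPow α x :=
  add_pos (Real.rpow_pos_of_pos hx0 _) (Real.rpow_pos_of_pos (by linarith) _)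

theorem rpow_eq_rpow_sub_one_mul (hx : 0 < x) (α : ℝ) : x ^ α = x ^ (α - 1) * x := by
  rw [← Real.rpow_add_one hx.ne', sub_add_cancel]

theorem rpow_sub_one_eq (hx : 0 < x) (α : ℝ) : x ^ (α - 1) = x ^ (α - 2) * x := by
  rw [← Real.rpow_add_one hx.ne']; congr 1; ring

theorem diffPow_sq_add (hx0 : 0 < x) (hx1 : x < 1) :
    (x ^ (α - 2) + (1 - x) ^ (α - 2)) * normPow α x
      = diffPow α x ^ 2 + (x * (1 - x)) ^ (α - 2) := by
  have hz : 0 < 1 - x := by linarith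
  rw [normPow, diffPow, Real.mul_rpow hx0.le hz.le, rpow_eq_rpow_sub_one_mul hx0 α,
    rpow_eq_rpow_sub_one_mul hz α, rpow_sub_one_eq hx0 α, rpow_sub_one_eq hz α]
  ring

theorem hasDerivAt_rpow_compl (hx1 : x < 1) (α : ℝ) :
    HasDerivAt (fun x : ℝ => (1 - x) ^ α) (-(α * (1 - x) ^ (α - 1))) x := by
  have h := (Real.hasDerivAt_rpow_const (x := 1 - x) (p := α) (Or.inl (by linarith))).comp x
    ((hasDerivAt_id x).const_sub 1)
  exact h.congr_deriv (by simp)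

theorem hasDerivAt_normPow (hx0 : 0 < x) (hx1 : x < 1) :
    HasDerivAt (normPow α) (α * diffPow α x) x := by
  have h := (Real.hasDerivAt_rpow_const (x := x) (p := α) (Or.inl hx0.ne')).add
    (hasDerivAt_rpow_compl hx1 α)
  exact h.congr_deriv (by rw [diffPow]; ring)

theorem hasDerivAt_diffPow (hx0 : 0 < x) (hx1 : x < 1) :
    HasDerivAt (diffPow α) ((α - 1) * (x ^ (α - 2) + (1 - x) ^ (α - 2))) x := by
  have h := (Real.hasDerivAt_rpow_const (x := x) (p := α - 1) (Or.inl hx0.ne')).sub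
    (hasDerivAt_rpow_compl hx1 (α - 1))
  have e : α - 1 - 1 = α - 2 := by ring
  rw [e] at h
  exact h.congr_deriv (by ring)

theorem hasDerivAt_modeEntropy (hx0 : 0 < x) (hx1 : x < 1) :
    HasDerivAt (modeEntropy α) (entropyDeriv α x) x := by
  have hz : 0 < 1 - x := by linarith
  by_cases hα : α = 1
  · subst hα
    have h1 := (Real.hasDerivAt_mul_log hx0.ne').neg
    have h2 := (Real.hasDerivAt_mul_log hz.ne').comp x ((hasDerivAt_id x).const_sub 1)
    have h3 := h1.sub h2
    have e : modeEntropy 1 = (-fun x => x * Real.log x) - (fun x => x * Real.log x) ∘ fun x => 1 - x := by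
      funext y; simp [modeEntropy]
    rw [e]
    refine h3.congr_deriv ?_
    rw [entropyDeriv, if_pos rfl]
    ring
  · have h := ((hasDerivAt_normPow (α := α) hx0 hx1).log (normPow_pos hx0 hx1).ne').const_mul
      (1 - α)⁻¹
    have e : modeEntropy α = fun x => (1 - α)⁻¹ * Real.log (normPow α x) := by
      funext y; simp [modeEntropy, hα, normPow]
    rw [e]
    refine h.congr_deriv ?_
    rw [entropyDeriv, if_neg hα]

theorem hasDerivAt_entropyDeriv (hx0 : 0 < x) (hx1 : x < 1) :
    HasDerivAt (entropyDeriv α) (-entropyCurv α x) x := by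
  have hz : 0 < 1 - x := by linarith
  by_cases hα : α = 1
  · subst hα
    have h1 := (Real.hasDerivAt_log hz.ne').comp x ((hasDerivAt_id x).const_sub 1)
    have h2 := h1.sub (Real.hasDerivAt_log hx0.ne')
    have e : entropyDeriv 1 = (Real.log ∘ fun x => 1 - x) - Real.log := by
      funext y; simp [entropyDeriv]
    rw [e]
    refine h2.congr_deriv ?_
    have e2 : (1 : ℝ) - 2 = -1 := by norm_num
    rw [entropyCurv, normPow, e2, Real.rpow_one, Real.rpow_one, Real.rpow_neg_one]
    simp
    field_simp
    ring
  · have hn := (normPow_pos (α := α) hx0 hx1).ne'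
    have h := (((hasDerivAt_diffPow (α := α) hx0 hx1).const_mul α).div
      (hasDerivAt_normPow (α := α) hx0 hx1) hn).const_mul (1 - α)⁻¹
    have e : entropyDeriv α = fun x => (1 - α)⁻¹ * (α * diffPow α x / normPow α x) := by
      funext y; simp [entropyDeriv, hα]
    rw [e]
    refine h.congr_deriv ?_
    have h1 := diffPow_sq_add (α := α) hx0 hx1
    have h2 : 1 - α ≠ 0 := sub_ne_zero.2 (Ne.symm hα)
    have h3 : (x * (1 - x)) ^ (α - 2)
        = (x ^ (α - 2) + (1 - x) ^ (α - 2)) * normPow α x - diffPow α x ^ 2 := by linarith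
    rw [entropyCurv, h3]
    field_simp
    ring

theorem continuousOn_entropyCurv : ContinuousOn (entropyCurv α) (Set.Ioo 0 1) := by
  intro x hx
  have hz : (1 : ℝ) - x ≠ 0 := by linarith [hx.2]
  refine ContinuousAt.continuousWithinAt ?_
  have hn : ContinuousAt (normPow α) x := (hasDerivAt_normPow hx.1 hx.2).continuousAt
  have hd : ContinuousAt (diffPow α) x := (hasDerivAt_diffPow hx.1 hx.2).continuousAt
  have hp : ContinuousAt (fun x : ℝ => (x * (1 - x)) ^ (α - 2)) x :=
    ContinuousAt.rpow_const (by fun_prop) (Or.inl (mul_ne_zero hx.1.ne' hz))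
  exact (continuousAt_const.div (hn.pow 2) (pow_ne_zero _ (normPow_pos hx.1 hx.2).ne')).mul
    (hp.add (continuousAt_const.mul (hd.pow 2)))

/-! ### Bounds for the second derivative of the entropy -/

/-- Convexity of `sinh` on `[0, ∞)`, where it vanishes at `0`. -/
theorem sinh_mul_le {c τ : ℝ} (hc0 : 0 ≤ c) (hc1 : c ≤ 1) (hτ : 0 ≤ τ) :
    Real.sinh (c * τ) ≤ c * Real.sinh τ := by
  have hd : ∀ t : ℝ, HasDerivAt (fun t => c * Real.sinh t - Real.sinh (c * t))
      (c * Real.cosh t - Real.cosh (c * t) * c) t := fun t =>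
    ((Real.hasDerivAt_sinh t).const_mul c).sub
      (((Real.hasDerivAt_sinh (c * t)).comp t ((hasDerivAt_id t).const_mul c)).congr_deriv
        (by simp))
  have hm : MonotoneOn (fun t => c * Real.sinh t - Real.sinh (c * t)) (Set.Ici 0) := by
    refine monotoneOn_of_deriv_nonneg (convex_Ici 0)
      (fun t _ => (hd t).continuousAt.continuousWithinAt)
      (fun t _ => (hd t).differentiableAt.differentiableWithinAt) fun t ht => ?_
    rw [interior_Ici, Set.mem_Ioi] at ht
    rw [(hd t).deriv]
    have : Real.cosh (c * t) ≤ Real.cosh t := by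
      rw [Real.cosh_le_cosh, abs_of_nonneg (by positivity), abs_of_pos ht]
      nlinarith
    nlinarith
  have := hm (Set.mem_Ici.2 le_rfl) (Set.mem_Ici.2 hτ) hτ
  simp only [mul_zero, Real.sinh_zero, sub_zero] at this
  linarith

theorem sinh_mul_sq_le {c : ℝ} (hc0 : 0 ≤ c) (hc1 : c ≤ 1) (τ : ℝ) :
    Real.sinh (c * τ) ^ 2 ≤ c ^ 2 * Real.sinh τ ^ 2 := by
  wlog hτ : 0 ≤ τ generalizing τ
  · have := this (-τ) (by linarith)
    simpa [Real.sinh_neg] using this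
  rw [← mul_pow]
  exact pow_le_pow_left₀ (Real.sinh_nonneg_iff.2 (by positivity)) (sinh_mul_le hc0 hc1 hτ) 2

/-- In terms of `τ = (log x - log (1 - x)) / 2` the powers become hyperbolic functions. -/
theorem exists_hyperbolic (hx0 : 0 < x) (hx1 : x < 1) (α : ℝ) : ∃ τ : ℝ,
    diffPow α x ^ 2 = (x * (1 - x)) ^ (α - 1) * (4 * Real.sinh ((α - 1) * τ) ^ 2) ∧
    (x * (1 - x)) ^ (α - 2) = (x * (1 - x)) ^ (α - 1) * (4 * Real.cosh τ ^ 2) := by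
  have hz : 0 < 1 - x := by linarith
  refine ⟨(Real.log x - Real.log (1 - x)) / 2, ?_, ?_⟩
  · rw [diffPow, Real.mul_rpow hx0.le hz.le, Real.rpow_def_of_pos hx0, Real.rpow_def_of_pos hz,
      Real.sinh_eq]
    set l := Real.log x
    set l' := Real.log (1 - x)
    have e1 : Real.exp (l * (α - 1))
        = Real.exp ((α - 1) * ((l + l') / 2)) * Real.exp ((α - 1) * ((l - l') / 2)) := by
      rw [← Real.exp_add]; congr 1; ring
    have e2 : Real.exp (l' * (α - 1))
        = Real.exp ((α - 1) * ((l + l') / 2)) * Real.exp (-((α - 1) * ((l - l') / 2))) := by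
      rw [← Real.exp_add]; congr 1; ring
    have e3 : Real.exp ((α - 1) * ((l - l') / 2)) * Real.exp (-((α - 1) * ((l - l') / 2))) = 1 := by
      rw [← Real.exp_add, add_neg_cancel, Real.exp_zero]
    rw [e1, e2]
    set E := Real.exp ((α - 1) * ((l + l') / 2))
    set p := Real.exp ((α - 1) * ((l - l') / 2))
    set m := Real.exp (-((α - 1) * ((l - l') / 2)))
    linear_combination -(E ^ 2 * (p - m) ^ 2) * e3
  · have hP : 0 < x * (1 - x) := mul_pos hx0 hz
    rw [rpow_sub_one_eq hP, mul_assoc]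
    nth_rewrite 1 [← mul_one ((x * (1 - x)) ^ (α - 2))]
    congr 1
    have e1 : Real.exp ((Real.log x - Real.log (1 - x)) / 2) ^ 2 = x / (1 - x) := by
      rw [← Real.exp_nat_mul, ← Real.exp_log (div_pos hx0 hz), Real.log_div hx0.ne' hz.ne']
      congr 1; push_cast; ring
    have e2 : Real.exp (-((Real.log x - Real.log (1 - x)) / 2)) ^ 2 = (1 - x) / x := by
      rw [Real.exp_neg, inv_pow, e1, inv_div]
    have e3 : Real.exp ((Real.log x - Real.log (1 - x)) / 2) *
        Real.exp (-((Real.log x - Real.log (1 - x)) / 2)) = 1 := by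
      rw [← Real.exp_add, add_neg_cancel, Real.exp_zero]
    rw [Real.cosh_eq]
    have e4 : 4 * ((Real.exp ((Real.log x - Real.log (1 - x)) / 2) +
        Real.exp (-((Real.log x - Real.log (1 - x)) / 2))) / 2) ^ 2
        = x / (1 - x) + (1 - x) / x + 2 := by
      rw [← e1, ← e2]; linear_combination 2 * e3
    rw [e4]
    field_simp
    ring

theorem one_le_normPow (hα1 : α ≤ 1) (hx0 : 0 < x) (hx1 : x < 1) :
    1 ≤ normPow α x := by
  have h1 := Real.rpow_le_rpow_of_exponent_ge hx0 hx1.le hα1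
  have h2 := Real.rpow_le_rpow_of_exponent_ge (x := 1 - x) (by linarith) (by linarith) hα1
  rw [Real.rpow_one] at h1 h2
  rw [normPow]
  linarith

theorem entropyCurv_nonneg_of_le_one (hα0 : 0 < α) (hα1 : α ≤ 1) (hx0 : 0 < x) (hx1 : x < 1) :
    0 ≤ entropyCurv α x := by
  have h1 : 0 ≤ (1 - α)⁻¹ := inv_nonneg.2 (by linarith)
  have h2 : 0 ≤ (x * (1 - x)) ^ (α - 2) :=
    Real.rpow_nonneg (mul_nonneg hx0.le (by linarith)) _
  unfold entropyCurv
  positivity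

/-- For `α < 1` the second derivative is controlled by `x ^ (α - 2) + (1 - x) ^ (α - 2)`. -/
theorem entropyCurv_le_of_lt_one (hα0 : 0 < α) (hα1 : α < 1) (hx0 : 0 < x) (hx1 : x < 1) :
    entropyCurv α x
      ≤ min (α / (1 - α)) (2 * α) * (x ^ (α - 2) + (1 - x) ^ (α - 2)) := by
  have hc : 0 < 1 - α := by linarith
  have hn := one_le_normPow hα1.le hx0 hx1
  have hS := diffPow_sq_add (α := α) hx0 hx1
  obtain ⟨τ, hD, hP⟩ := exists_hyperbolic hx0 hx1 α
  set S := x ^ (α - 2) + (1 - x) ^ (α - 2)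
  set D := diffPow α x
  set P := (x * (1 - x)) ^ (α - 2)
  set h₀ := normPow α x
  have hP0 : 0 ≤ P := Real.rpow_nonneg (mul_nonneg hx0.le (by linarith)) _
  have hE0 : 0 ≤ (x * (1 - x)) ^ (α - 1) :=
    Real.rpow_nonneg (mul_nonneg hx0.le (by linarith)) _
  have hS0 : 0 ≤ S := add_nonneg (Real.rpow_nonneg hx0.le _) (Real.rpow_nonneg (by linarith) _)
  have hDP : D ^ 2 ≤ (1 - α) * P := by
    have h1 := sinh_mul_sq_le hc.le (by linarith) τ
    have h2 : Real.sinh ((α - 1) * τ) ^ 2 = Real.sinh ((1 - α) * τ) ^ 2 := by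
      rw [← neg_sub, neg_mul, Real.sinh_neg, neg_sq]
    have h3 := Real.cosh_sq τ
    rw [hD, hP, h2]
    have h4 : Real.sinh ((1 - α) * τ) ^ 2 ≤ (1 - α) * Real.cosh τ ^ 2 := by
      have h5 : (1 - α) ^ 2 ≤ 1 - α := by nlinarith
      nlinarith [sq_nonneg (Real.sinh τ)]
    nlinarith
  have hle : ∀ C : ℝ, α * P + α / (1 - α) * D ^ 2 ≤ C * (D ^ 2 + P) → entropyCurv α x ≤ C * S := by
    intro C hC
    have h1 : entropyCurv α x = (α * P + α / (1 - α) * D ^ 2) / h₀ ^ 2 := by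
      have e : entropyCurv α x = α / h₀ ^ 2 * (P + (1 - α)⁻¹ * D ^ 2) := rfl
      rw [e]; field_simp
    have h0 : 0 ≤ α * P + α / (1 - α) * D ^ 2 := by positivity
    rw [h1, div_le_iff₀ (by positivity)]
    rw [← hS] at hC
    have h2 : h₀ ≤ h₀ ^ 2 := by nlinarith
    have hC0 : 0 ≤ C * S := by
      by_contra h
      push Not at h
      have : C * (S * h₀) < 0 := by nlinarith
      linarith
    nlinarith
  rw [min_mul_of_nonneg _ _ hS0]
  refine le_min (hle _ ?_) (hle _ ?_)
  · have : α ≤ α / (1 - α) := by rw [le_div_iff₀ hc]; nlinarith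
    nlinarith
  · have h1 : α / (1 - α) * D ^ 2 ≤ α * P := by
      rw [div_mul_eq_mul_div, div_le_iff₀ hc]
      nlinarith
    nlinarith [sq_nonneg D]

/-- For `α ≥ 1` the second derivative is controlled by `x⁻¹ + (1 - x)⁻¹`. -/
theorem entropyCurv_le_of_one_le (hα1 : 1 ≤ α) (hx0 : 0 < x) (hx1 : x < 1) :
    entropyCurv α x ≤ α * (x⁻¹ + (1 - x)⁻¹) := by
  have hz : 0 < 1 - x := by linarith
  have hS := diffPow_sq_add (α := α) hx0 hx1
  have hn := normPow_pos (α := α) hx0 hx1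
  have hinv : (1 - α)⁻¹ ≤ 0 := inv_nonpos.2 (by linarith)
  have h1 : (x * (1 - x)) ^ (α - 2) + (1 - α)⁻¹ * diffPow α x ^ 2
      ≤ (x ^ (α - 2) + (1 - x) ^ (α - 2)) * normPow α x := by
    nlinarith [sq_nonneg (diffPow α x)]
  have h2 : (x ^ (α - 2) + (1 - x) ^ (α - 2)) * (x * (1 - x)) ≤ normPow α x := by
    rw [normPow, rpow_eq_rpow_sub_one_mul hx0 α, rpow_eq_rpow_sub_one_mul hz α, rpow_sub_one_eq hx0 α,
      rpow_sub_one_eq hz α]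
    set u := x ^ (α - 2) with hu
    set v := (1 - x) ^ (α - 2) with hv
    have h3 : 0 ≤ (u * x - v * (1 - x)) * (x - (1 - x)) := by
      rw [hu, hv, ← rpow_sub_one_eq hx0 α, ← rpow_sub_one_eq hz α]
      rcases le_total x (1 - x) with h | h
      · exact mul_nonneg_of_nonpos_of_nonpos
          (sub_nonpos.2 (Real.rpow_le_rpow hx0.le h (by linarith))) (sub_nonpos.2 h)
      · exact mul_nonneg (sub_nonneg.2 (Real.rpow_le_rpow hz.le h (by linarith)))
          (sub_nonneg.2 h)
    nlinarith
  have h3 : x⁻¹ + (1 - x)⁻¹ = (x * (1 - x))⁻¹ := by field_simp; ring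
  have h4 : 0 < x * (1 - x) := mul_pos hx0 hz
  rw [entropyCurv, h3, div_mul_eq_mul_div, div_le_iff₀ (by positivity), mul_assoc]
  refine mul_le_mul_of_nonneg_left ?_ (by linarith)
  rw [← div_eq_inv_mul (normPow α x ^ 2), le_div_iff₀ h4]
  calc _ ≤ (x ^ (α - 2) + (1 - x) ^ (α - 2)) * normPow α x * (x * (1 - x)) := by gcongr
    _ = (x ^ (α - 2) + (1 - x) ^ (α - 2)) * (x * (1 - x)) * normPow α x := by ring
    _ ≤ normPow α x * normPow α x := by gcongr
    _ = _ := by ring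

/-- The normalized power `x ^ α / (x ^ α + (1 - x) ^ α)`. -/
def escort (α x : ℝ) : ℝ := x ^ α / normPow α x

/-- The derivative of the normalized power. -/
def escortDeriv (α x : ℝ) : ℝ := α / normPow α x ^ 2 * (x * (1 - x)) ^ (α - 1)

theorem hasDerivAt_escort (hx0 : 0 < x) (hx1 : x < 1) :
    HasDerivAt (escort α) (escortDeriv α x) x := by
  have hz : 0 < 1 - x := by linarith
  have hn := (normPow_pos (α := α) hx0 hx1).ne'
  have h := (Real.hasDerivAt_rpow_const (x := x) (p := α) (Or.inl hx0.ne')).div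
    (hasDerivAt_normPow (α := α) hx0 hx1) hn
  refine h.congr_deriv ?_
  rw [escortDeriv, Real.mul_rpow hx0.le hz.le, div_mul_eq_mul_div]
  congr 1
  rw [normPow, diffPow, rpow_eq_rpow_sub_one_mul hx0 α, rpow_eq_rpow_sub_one_mul hz α]
  ring

theorem escortDeriv_nonneg (hα : 0 ≤ α) (hx0 : 0 < x) (hx1 : x < 1) : 0 ≤ escortDeriv α x :=
  mul_nonneg (div_nonneg hα (sq_nonneg _))
    (Real.rpow_nonneg (mul_nonneg hx0.le (by linarith)) _)

theorem continuousOn_escortDeriv : ContinuousOn (escortDeriv α) (Set.Ioo 0 1) := by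
  intro x hx
  have hz : (1 : ℝ) - x ≠ 0 := by linarith [hx.2]
  have hn : ContinuousAt (normPow α) x := (hasDerivAt_normPow hx.1 hx.2).continuousAt
  refine ContinuousAt.continuousWithinAt ?_
  exact (continuousAt_const.div (hn.pow 2) (pow_ne_zero _ (normPow_pos hx.1 hx.2).ne')).mul
    (ContinuousAt.rpow_const (by fun_prop) (Or.inl (mul_ne_zero hx.1.ne' hz)))

/-- For `α ≥ 2` the second derivative is controlled by the derivative of the normalized power. -/
theorem entropyCurv_le_of_two_le (hα : 2 ≤ α) (hx0 : 0 < x) (hx1 : x < 1) :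
    entropyCurv α x ≤ 4 * escortDeriv α x := by
  have hn := normPow_pos (α := α) hx0 hx1
  obtain ⟨τ, hD, hP⟩ := exists_hyperbolic hx0 hx1 α
  have hE0 : 0 ≤ (x * (1 - x)) ^ (α - 1) :=
    Real.rpow_nonneg (mul_nonneg hx0.le (by linarith)) _
  have hc : 1 ≤ α - 1 := by linarith
  have h1 : Real.sinh τ ^ 2 ≤ (1 - α)⁻¹ * (-Real.sinh ((α - 1) * τ) ^ 2) := by
    have h := sinh_mul_sq_le (c := (α - 1)⁻¹) (by positivity) (inv_le_one_of_one_le₀ hc)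
      ((α - 1) * τ)
    rw [inv_mul_cancel_left₀ (by linarith)] at h
    have e : (1 - α)⁻¹ * (-Real.sinh ((α - 1) * τ) ^ 2)
        = (α - 1)⁻¹ * Real.sinh ((α - 1) * τ) ^ 2 := by
      rw [← neg_sub, inv_neg]; ring
    rw [e]
    refine h.trans (mul_le_mul_of_nonneg_right ?_ (sq_nonneg _))
    rw [sq]
    exact mul_le_of_le_one_left (by positivity) (inv_le_one_of_one_le₀ hc)
  rw [entropyCurv, escortDeriv, hD, hP]
  have h3 := Real.cosh_sq τ
  calc _ = α / normPow α x ^ 2 * (x * (1 - x)) ^ (α - 1) *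
        (4 * (Real.cosh τ ^ 2 - (1 - α)⁻¹ * (-Real.sinh ((α - 1) * τ) ^ 2))) := by ring
    _ ≤ α / normPow α x ^ 2 * (x * (1 - x)) ^ (α - 1) * 4 := by
        refine mul_le_mul_of_nonneg_left (by linarith) (by positivity)
    _ = _ := by ring

/-- A two-sided bound for the second derivative, up to a constant. -/
theorem exists_abs_entropyCurv_le (hα : 0 < α) : ∃ C : ℝ, 0 ≤ C ∧ ∀ x : ℝ, 0 < x → x < 1 →
    |entropyCurv α x| ≤ C * (x ^ (min α 1 - 2) + (1 - x) ^ (min α 1 - 2)) := by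
  rcases lt_or_ge α 1 with h1 | h1
  · refine ⟨min (α / (1 - α)) (2 * α), le_min (div_nonneg hα.le (by linarith)) (by linarith),
      fun x hx0 hx1 => ?_⟩
    rw [min_eq_left h1.le, abs_of_nonneg (entropyCurv_nonneg_of_le_one hα h1.le hx0 hx1)]
    exact entropyCurv_le_of_lt_one hα h1 hx0 hx1
  · refine ⟨α + α / ((2⁻¹ : ℝ) ^ α) ^ 2 * |(1 - α)⁻¹|, by positivity, fun x hx0 hx1 => ?_⟩
    have hz : 0 < 1 - x := by linarith
    have e : min α 1 - 2 = -1 := by rw [min_eq_right h1]; norm_num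
    rw [e, Real.rpow_neg_one, Real.rpow_neg_one]
    have h2 := entropyCurv_le_of_one_le h1 hx0 hx1
    have h3 : 1 ≤ x⁻¹ + (1 - x)⁻¹ := by
      have := (one_le_inv₀ hx0).2 hx1.le
      have := inv_pos.2 hz
      linarith
    have h4 : (2⁻¹ : ℝ) ^ α ≤ normPow α x := by
      rcases le_total x (1 - x) with h | h
      · have h5 : (2⁻¹ : ℝ) ^ α ≤ (1 - x) ^ α :=
          Real.rpow_le_rpow (by norm_num) (by linarith) hα.le
        have h6 := Real.rpow_nonneg hx0.le α
        rw [normPow]; linarith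
      · have h5 : (2⁻¹ : ℝ) ^ α ≤ x ^ α :=
          Real.rpow_le_rpow (by norm_num) (by linarith) hα.le
        have h6 := Real.rpow_nonneg hz.le α
        rw [normPow]; linarith
    have h5 : diffPow α x ^ 2 ≤ 1 := by
      have h6 := Real.rpow_nonneg hx0.le (α - 1)
      have h7 := Real.rpow_nonneg hz.le (α - 1)
      have h8 := Real.rpow_le_one hx0.le hx1.le (by linarith : 0 ≤ α - 1)
      have h9 := Real.rpow_le_one hz.le (by linarith) (by linarith : 0 ≤ α - 1)
      rw [sq_le_one_iff_abs_le_one, diffPow, abs_le]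
      constructor <;> linarith
    have h6 : -(α / ((2⁻¹ : ℝ) ^ α) ^ 2 * |(1 - α)⁻¹|) ≤ entropyCurv α x := by
      have hp : 0 ≤ (x * (1 - x)) ^ (α - 2) :=
        Real.rpow_nonneg (mul_nonneg hx0.le hz.le) _
      have h7 : -|(1 - α)⁻¹| ≤ (x * (1 - x)) ^ (α - 2) + (1 - α)⁻¹ * diffPow α x ^ 2 := by
        have h8 := neg_abs_le (1 - α)⁻¹
        have h9 := abs_nonneg (1 - α)⁻¹
        nlinarith [sq_nonneg (diffPow α x)]
      have h8 : α / normPow α x ^ 2 ≤ α / ((2⁻¹ : ℝ) ^ α) ^ 2 := by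
        gcongr
      have h9 : 0 ≤ α / normPow α x ^ 2 := by positivity
      rw [entropyCurv]
      calc _ ≤ α / normPow α x ^ 2 * (-|(1 - α)⁻¹|) := by
            nlinarith [abs_nonneg (1 - α)⁻¹]
        _ ≤ _ := mul_le_mul_of_nonneg_left h7 h9
    have h7 : 0 ≤ α / ((2⁻¹ : ℝ) ^ α) ^ 2 * |(1 - α)⁻¹| := by positivity
    rw [abs_le]
    constructor <;> nlinarith

theorem entropyCurv_half (α : ℝ) : entropyCurv α 2⁻¹ = 4 * α := by
  have e : (1 : ℝ) - 2⁻¹ = 2⁻¹ := by norm_num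
  have hp : (0 : ℝ) < 2⁻¹ ^ α := by positivity
  rw [entropyCurv, normPow, diffPow, e, sub_self, Real.mul_rpow (by norm_num) (by norm_num),
    Real.rpow_sub (by norm_num)]
  norm_num
  field_simp
  norm_num

end EntropyDerivatives

/-! ### Bounds for the kernel by squared increments -/

section KernelBounds

open MeasureTheory

variable {h : ℝ → ℝ} {x y s t p C α : ℝ}

theorem segment_pos {r : ℝ} (hs : 0 < s) (ht : 0 < t) (hr : r ∈ Set.Icc (0 : ℝ) 1) :
    0 < (1 - r) * s + r * t := by
  rcases hr.1.eq_or_lt with h | h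
  · subst h; simpa
  · have : 0 ≤ (1 - r) * s := mul_nonneg (by linarith [hr.2]) hs.le
    have : 0 < r * t := mul_pos h ht
    linarith

theorem continuousOn_segment_rpow (hs : 0 < s) (ht : 0 < t) (e : ℝ) :
    ContinuousOn (fun r : ℝ => ((1 - r) * s + r * t) ^ e) (Set.uIcc 0 1) := by
  rw [Set.uIcc_of_le zero_le_one]
  exact ContinuousOn.rpow_const (by fun_prop) fun r hr => Or.inl (segment_pos hs ht hr).ne'

theorem integral_segment_rpow_neg_two (hs : 0 < s) (ht : 0 < t) :
    ∫ r in (0 : ℝ)..1, ((1 - r) * s + r * t) ^ (-2 : ℝ) = (s * t)⁻¹ := by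
  have hd : ∀ r ∈ Set.uIcc (0 : ℝ) 1, HasDerivAt (fun r => r / (s * ((1 - r) * s + r * t)))
      (((1 - r) * s + r * t) ^ (-2 : ℝ)) r := by
    intro r hr
    rw [Set.uIcc_of_le zero_le_one] at hr
    have h0 := segment_pos hs ht hr
    have h1 : HasDerivAt (fun r : ℝ => s * ((1 - r) * s + r * t)) (s * (t - s)) r :=
      (((((hasDerivAt_id r).const_sub 1).mul_const s).add
        ((hasDerivAt_id r).mul_const t)).const_mul s).congr_deriv (by ring)
    refine ((hasDerivAt_id r).div h1 (mul_pos hs h0).ne').congr_deriv ?_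
    rw [Real.rpow_neg h0.le, Real.rpow_two, id]
    field_simp
    ring
  rw [intervalIntegral.integral_eq_sub_of_hasDerivAt hd
    (continuousOn_segment_rpow hs ht _).intervalIntegrable]
  simp [mul_comm]

/-- By concavity of `u ↦ u ^ (1 - p)`, the average of `w ^ (2 p - 2)` over a segment is at most the
corresponding power of the average of `w ^ (-2)`. -/
theorem integral_segment_rpow_le (hs : 0 < s) (ht : 0 < t) (hp0 : 0 ≤ p) (hp1 : p ≤ 1) :
    ∫ r in (0 : ℝ)..1, ((1 - r) * s + r * t) ^ (2 * p - 2) ≤ (s * t) ^ (p - 1) := by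
  have hst : 0 < s * t := mul_pos hs ht
  have hpt : ∀ r ∈ Set.Icc (0 : ℝ) 1, ((1 - r) * s + r * t) ^ (2 * p - 2)
      ≤ (s * t) ^ p * (1 - p) * ((1 - r) * s + r * t) ^ (-2 : ℝ) + (s * t) ^ (p - 1) * p := by
    intro r hr
    have h0 := segment_pos hs ht hr
    have h1 := Real.geom_mean_le_arith_mean2_weighted (w₁ := 1 - p) (w₂ := p)
      (p₁ := ((1 - r) * s + r * t) ^ (-2 : ℝ)) (p₂ := (s * t)⁻¹) (by linarith) hp0
      (Real.rpow_nonneg h0.le _) (by positivity) (by ring)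
    rw [← Real.rpow_mul h0.le, Real.inv_rpow hst.le] at h1
    have e1 : -2 * (1 - p) = 2 * p - 2 := by ring
    rw [e1] at h1
    have h2 : 0 < (s * t) ^ p := Real.rpow_pos_of_pos hst p
    have e2 : (s * t) ^ (p - 1) = (s * t) ^ p * (s * t)⁻¹ := by
      rw [Real.rpow_sub_one hst.ne', div_eq_mul_inv]
    calc _ = (s * t) ^ p * (((1 - r) * s + r * t) ^ (2 * p - 2) * ((s * t) ^ p)⁻¹) := by
          field_simp
      _ ≤ (s * t) ^ p * ((1 - p) * ((1 - r) * s + r * t) ^ (-2 : ℝ) + p * (s * t)⁻¹) := by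
          gcongr
      _ = _ := by rw [e2]; ring
  have hi := (continuousOn_segment_rpow hs ht (-2)).intervalIntegrable (μ := volume)
  calc _ ≤ ∫ r in (0 : ℝ)..1, ((s * t) ^ p * (1 - p) * ((1 - r) * s + r * t) ^ (-2 : ℝ)
        + (s * t) ^ (p - 1) * p) :=
        intervalIntegral.integral_mono_on zero_le_one
          (continuousOn_segment_rpow hs ht _).intervalIntegrable
          ((hi.const_mul _).add intervalIntegrable_const) hpt
    _ = (s * t) ^ p * (1 - p) * (s * t)⁻¹ + (s * t) ^ (p - 1) * p := by
        rw [intervalIntegral.integral_add (hi.const_mul _) intervalIntegrable_const,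
          intervalIntegral.integral_const_mul, integral_segment_rpow_neg_two hs ht]
        simp
    _ = _ := by
        rw [Real.rpow_sub_one hst.ne']
        field_simp
        ring

theorem segment_mem_uIcc {r : ℝ} (hr : r ∈ Set.Icc (0 : ℝ) 1) (s t : ℝ) :
    (1 - r) * s + r * t ∈ Set.uIcc s t :=
  convex_uIcc s t Set.left_mem_uIcc Set.right_mem_uIcc (by linarith [hr.2]) hr.1 (by ring)

theorem segmentAvg_le_rpow (hh : Continuous h) (hs0 : 0 < s) (hs1 : s < 1) (ht0 : 0 < t)
    (ht1 : t < 1) (hp0 : 0 ≤ p) (hp1 : p ≤ 1) (hC : 0 ≤ C)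
    (hle : ∀ w ∈ Set.uIcc s t, h w ≤ C * (w ^ (2 * p - 2) + (1 - w) ^ (2 * p - 2))) :
    segmentAvg h s t ≤ C * ((s * t) ^ (p - 1) + ((1 - s) * (1 - t)) ^ (p - 1)) := by
  have hs1' : 0 < 1 - s := by linarith
  have ht1' : 0 < 1 - t := by linarith
  have i₁ := (continuousOn_segment_rpow hs0 ht0 (2 * p - 2)).intervalIntegrable (μ := volume)
  have i₂ := (continuousOn_segment_rpow hs1' ht1' (2 * p - 2)).intervalIntegrable (μ := volume)
  calc segmentAvg h s t ≤ ∫ r in (0 : ℝ)..1, C * (((1 - r) * s + r * t) ^ (2 * p - 2)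
        + ((1 - r) * (1 - s) + r * (1 - t)) ^ (2 * p - 2)) := by
        refine intervalIntegral.integral_mono_on zero_le_one
          (Continuous.intervalIntegrable (by fun_prop) _ _) ((i₁.add i₂).const_mul C)
          fun r hr => ?_
        have := hle _ (segment_mem_uIcc hr s t)
        rwa [show 1 - ((1 - r) * s + r * t) = (1 - r) * (1 - s) + r * (1 - t) by ring] at this
    _ = C * ((∫ r in (0 : ℝ)..1, ((1 - r) * s + r * t) ^ (2 * p - 2))
        + ∫ r in (0 : ℝ)..1, ((1 - r) * (1 - s) + r * (1 - t)) ^ (2 * p - 2)) := by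
        rw [intervalIntegral.integral_const_mul, intervalIntegral.integral_add i₁ i₂]
    _ ≤ _ := by
        gcongr
        · exact integral_segment_rpow_le hs0 ht0 hp0 hp1
        · exact integral_segment_rpow_le hs1' ht1' hp0 hp1

theorem mem_unit_of_mem_uIcc {w : ℝ} (hx : x ∈ Set.Ioo (0 : ℝ) 1) (hy : y ∈ Set.Ioo (0 : ℝ) 1)
    (hw : w ∈ Set.uIcc x y) : w ∈ Set.Ioo (0 : ℝ) 1 :=
  Set.ordConnected_Ioo.uIcc_subset hx hy hw

/-- The kernel of a function with power singularities at `0` and `1` is bounded by the squared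
increments of the powers whose derivatives have half the singularity. -/
theorem widomKernel_le_rpow (hh : Continuous h) (hx : x ∈ Set.Ioo (0 : ℝ) 1)
    (hy : y ∈ Set.Ioo (0 : ℝ) 1) (hp0 : 0 < p) (hp1 : p ≤ 1) (hC : 0 ≤ C)
    (hle : ∀ w ∈ Set.uIcc x y, h w ≤ C * (w ^ (2 * p - 2) + (1 - w) ^ (2 * p - 2))) :
    widomKernel h x y
      ≤ C / p ^ 2 * ((x ^ p - y ^ p) ^ 2 + ((1 - x) ^ p - (1 - y) ^ p) ^ 2) / 2 := by
  have hsq : Real.sqrt C * Real.sqrt C = C := Real.mul_self_sqrt hC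
  have hmem := fun {w : ℝ} (hw : w ∈ Set.uIcc x y) => mem_unit_of_mem_uIcc hx hy hw
  have key := widomKernel_le_sq (x := x) (y := y) hh
    (ψ₁ := fun w => Real.sqrt C / p * w ^ p) (ψ₁' := fun w => Real.sqrt C * w ^ (p - 1))
    (ψ₂ := fun w => Real.sqrt C / p * (1 - w) ^ p)
    (ψ₂' := fun w => -(Real.sqrt C * (1 - w) ^ (p - 1)))
    (fun w hw => ((Real.hasDerivAt_rpow_const (Or.inl (hmem hw).1.ne')).const_mul _).congr_deriv
      (by field_simp))
    (fun w hw => ((hasDerivAt_rpow_compl (hmem hw).2 p).const_mul _).congr_deriv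
      (by field_simp))
    (continuousOn_const.mul (continuousOn_id.rpow_const fun w hw => Or.inl (hmem hw).1.ne'))
    ((continuousOn_const.mul (ContinuousOn.rpow_const (by fun_prop) fun w hw =>
      Or.inl (by linarith [(hmem hw).2]))).neg) ?_
  · refine key.trans_eq ?_
    calc _ = Real.sqrt C * Real.sqrt C / p ^ 2
          * ((x ^ p - y ^ p) ^ 2 + ((1 - x) ^ p - (1 - y) ^ p) ^ 2) / 2 := by field_simp
      _ = _ := by rw [hsq]
  · intro s hs t ht
    have hs' := hmem hs
    have ht' := hmem ht
    have h1 := segmentAvg_le_rpow hh hs'.1 hs'.2 ht'.1 ht'.2 hp0.le hp1 hC fun w hw =>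
      hle w (Set.uIcc_subset_uIcc hs ht hw)
    rw [Real.mul_rpow hs'.1.le ht'.1.le,
      Real.mul_rpow (by linarith [hs'.2]) (by linarith [ht'.2])] at h1
    refine h1.trans_eq ?_
    nth_rewrite 1 [← hsq]
    ring

theorem interval_swap {F : ℝ → ℝ → ℝ} (hF : Continuous fun q : ℝ × ℝ => F q.1 q.2)
    (a b c d : ℝ) : ∫ x in a..b, ∫ y in c..d, F x y = ∫ y in c..d, ∫ x in a..b, F x y := by
  apply intervalIntegral_intervalIntegral_swap
  refine IntegrableOn.mono_set ?_
    (Set.prod_mono Set.uIoc_subset_uIcc Set.uIoc_subset_uIcc)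
  exact hF.continuousOn.integrableOn_compact (isCompact_uIcc.prod isCompact_uIcc)

/-- If `h` is at most the derivative of an increasing function `X`, the kernel is at most the
product of the increments of `X` and of the identity: the point `(1 - r) s + r t` moves with speed
at least `1 / 2` in `s` or in `t`, and the corresponding integral is computed first. -/
theorem widomKernel_le_mul (hh : Continuous h) (hxy : x ≤ y) {X X' : ℝ → ℝ}
    (hX : ∀ w ∈ Set.Icc x y, HasDerivAt X (X' w) w) (hX0 : ∀ w ∈ Set.Icc x y, 0 ≤ X' w)
    (hXc : ContinuousOn X' (Set.Icc x y)) (hle : ∀ w ∈ Set.Icc x y, h w ≤ X' w) :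
    widomKernel h x y ≤ (y - x) * (X y - X x) := by
  have hmono : MonotoneOn X (Set.Icc x y) := by
    refine monotoneOn_of_deriv_nonneg (convex_Icc x y)
      (fun w hw => (hX w hw).continuousAt.continuousWithinAt)
      (fun w hw => (hX w (interior_subset hw)).differentiableAt.differentiableWithinAt)
      fun w hw => ?_
    rw [(hX w (interior_subset hw)).deriv]
    exact hX0 w (interior_subset hw)
  have hXxy : 0 ≤ X y - X x :=
    sub_nonneg.2 (hmono (Set.left_mem_Icc.2 hxy) (Set.right_mem_Icc.2 hxy) hxy)
  -- the estimate for the integral over one endpoint with weight at least one half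
  have hline : ∀ r ∈ Set.Icc (1 / 2 : ℝ) 1, ∀ s ∈ Set.Icc x y,
      ∫ t in x..y, h ((1 - r) * s + r * t) ≤ 2 * (X y - X x) := by
    intro r hr s hs
    have hr0 : 0 < r := by linarith [hr.1]
    have hmem : ∀ t ∈ Set.Icc x y, (1 - r) * s + r * t ∈ Set.Icc x y := fun t ht =>
      convex_Icc x y hs ht (by linarith [hr.2]) hr0.le (by ring)
    have hd : ∀ t ∈ Set.uIcc x y, HasDerivAt (fun t => X ((1 - r) * s + r * t) / r)
        (X' ((1 - r) * s + r * t)) t := by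
      intro t ht
      rw [Set.uIcc_of_le hxy] at ht
      have h1 : HasDerivAt (fun t : ℝ => (1 - r) * s + r * t) r t :=
        (((hasDerivAt_id t).const_mul r).const_add _).congr_deriv (by ring)
      exact (((hX _ (hmem t ht)).comp t h1).div_const r).congr_deriv (by field_simp)
    have hc : ContinuousOn (fun t => X' ((1 - r) * s + r * t)) (Set.uIcc x y) := by
      rw [Set.uIcc_of_le hxy]
      exact hXc.comp (by fun_prop) hmem
    have e := intervalIntegral.integral_eq_sub_of_hasDerivAt hd hc.intervalIntegrable
    have h2 : ∫ t in x..y, h ((1 - r) * s + r * t)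
        ≤ ∫ t in x..y, X' ((1 - r) * s + r * t) :=
      intervalIntegral.integral_mono_on hxy (Continuous.intervalIntegrable (by fun_prop) _ _)
        hc.intervalIntegrable fun t ht => hle _ (hmem t ht)
    have hm1 := hmem x (Set.left_mem_Icc.2 hxy)
    have hm2 := hmem y (Set.right_mem_Icc.2 hxy)
    have h3 : X ((1 - r) * s + r * y) ≤ X y := hmono hm2 (Set.right_mem_Icc.2 hxy) hm2.2
    have h4 : X x ≤ X ((1 - r) * s + r * x) := hmono (Set.left_mem_Icc.2 hxy) hm1 hm1.1
    rw [e, ← sub_div] at h2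
    refine h2.trans ?_
    rw [div_le_iff₀ hr0]
    nlinarith [hr.1]
  have hsquare : ∀ r ∈ Set.Icc (1 / 2 : ℝ) 1,
      ∫ s in x..y, ∫ t in x..y, h ((1 - r) * s + r * t) ≤ (y - x) * (2 * (X y - X x)) := by
    intro r hr
    calc _ ≤ ∫ _s in x..y, 2 * (X y - X x) := by
          refine intervalIntegral.integral_mono_on hxy (Continuous.intervalIntegrable ?_ _ _)
            intervalIntegrable_const (hline r hr)
          apply intervalIntegral.continuous_parametric_intervalIntegral_of_continuous'
          fun_prop
      _ = _ := by simp; ring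
  have hall : ∀ r ∈ Set.Icc (0 : ℝ) 1,
      ∫ s in x..y, ∫ t in x..y, h ((1 - r) * s + r * t) ≤ (y - x) * (2 * (X y - X x)) := by
    intro r hr
    rcases le_total (1 / 2) r with h1 | h1
    · exact hsquare r ⟨h1, hr.2⟩
    · rw [interval_swap (F := fun s t => h ((1 - r) * s + r * t)) (by fun_prop)]
      have := hsquare (1 - r) ⟨by linarith, by linarith [hr.1]⟩
      simp only [sub_sub_cancel] at this
      simpa only [add_comm] using this
  have e1 : ∀ s, ∫ t in x..y, segmentAvg h s t
      = ∫ r in (0 : ℝ)..1, ∫ t in x..y, h ((1 - r) * s + r * t) := fun s =>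
    interval_swap (F := fun t r => h ((1 - r) * s + r * t)) (by fun_prop) _ _ _ _
  have e2 : ∫ s in x..y, ∫ t in x..y, segmentAvg h s t
      = ∫ r in (0 : ℝ)..1, ∫ s in x..y, ∫ t in x..y, h ((1 - r) * s + r * t) := by
    simp only [e1]
    refine interval_swap (F := fun s r => ∫ t in x..y, h ((1 - r) * s + r * t)) ?_ _ _ _ _
    apply intervalIntegral.continuous_parametric_intervalIntegral_of_continuous'
    fun_prop
  have h5 : ∫ r in (0 : ℝ)..1, ∫ s in x..y, ∫ t in x..y, h ((1 - r) * s + r * t)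
      ≤ ∫ _r in (0 : ℝ)..1, (y - x) * (2 * (X y - X x)) := by
    refine intervalIntegral.integral_mono_on zero_le_one (Continuous.intervalIntegrable ?_ _ _)
      intervalIntegrable_const hall
    apply intervalIntegral.continuous_parametric_intervalIntegral_of_continuous'
    apply intervalIntegral.continuous_parametric_intervalIntegral_of_continuous'
    fun_prop
  rw [← e2, intervalIntegral.integral_const] at h5
  rw [widomKernel]
  simp only [sub_zero, one_smul] at h5
  linarith

/-- For `α ≥ 2` the kernel is bounded by the increments of the identity and of the normalized
power. -/
theorem widomKernel_le_escort (hα : 2 ≤ α) (hh : Continuous h) (hx : x ∈ Set.Ioo (0 : ℝ) 1)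
    (hy : y ∈ Set.Ioo (0 : ℝ) 1) (hle : ∀ w ∈ Set.uIcc x y, h w ≤ entropyCurv α w) :
    widomKernel h x y ≤ 4 * ((x - y) ^ 2 + (escort α x - escort α y) ^ 2) / 2 := by
  wlog hxy : x ≤ y generalizing x y
  · rw [widomKernel_symm, sub_sq_comm x, sub_sq_comm (escort α x)]
    rw [Set.uIcc_comm] at hle
    exact this hy hx hle (le_of_not_ge hxy)
  rw [Set.uIcc_of_le hxy] at hle
  have hmem : ∀ w ∈ Set.Icc x y, w ∈ Set.Ioo (0 : ℝ) 1 := fun w hw =>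
    ⟨hx.1.trans_le hw.1, hw.2.trans_lt hy.2⟩
  have h1 := widomKernel_le_mul hh hxy (X := fun w => 4 * escort α w)
    (X' := fun w => 4 * escortDeriv α w)
    (fun w hw => (hasDerivAt_escort (hmem w hw).1 (hmem w hw).2).const_mul 4)
    (fun w hw => by
      have := escortDeriv_nonneg (by linarith : 0 ≤ α) (hmem w hw).1 (hmem w hw).2
      positivity)
    (continuousOn_const.mul (continuousOn_escortDeriv.mono hmem))
    (fun w hw => (hle w hw).trans (entropyCurv_le_of_two_le hα (hmem w hw).1 (hmem w hw).2))
  nlinarith [sq_nonneg ((y - x) - (escort α y - escort α x))]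

end KernelBounds

/-! ### A logarithmic bound for the pair sum of a squared increment -/

section Fourier

open MeasureTheory Real

theorem integral_cos_int_mul (n : ℤ) :
    ∫ θ in (0 : ℝ)..π, cos (n * θ) = if n = 0 then π else 0 := by
  split_ifs with h
  · subst h; simp
  · have hn : (n : ℝ) ≠ 0 := by exact_mod_cast h
    rw [intervalIntegral.integral_comp_mul_left (fun θ => cos θ) hn]
    simp

theorem integral_sin_mul_sin (s : ℕ) {t : ℕ} (ht : t ≠ 0) :
    ∫ θ in (0 : ℝ)..π, sin (s * θ) * sin (t * θ) = if s = t then π / 2 else 0 := by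
  have e : ∀ θ : ℝ, sin (s * θ) * sin (t * θ)
      = (cos (((s - t : ℤ) : ℝ) * θ) - cos (((s + t : ℤ) : ℝ) * θ)) / 2 := by
    intro θ
    push_cast
    rw [sub_mul, add_mul, cos_sub, cos_add]
    ring
  simp only [e]
  rw [intervalIntegral.integral_div, intervalIntegral.integral_sub
    (Continuous.intervalIntegrable (by fun_prop) _ _)
    (Continuous.intervalIntegrable (by fun_prop) _ _), integral_cos_int_mul, integral_cos_int_mul,
    if_neg (by omega : ¬((s : ℤ) + t = 0))]
  by_cases h : s = t
  · rw [if_pos h, if_pos (by omega), sub_zero]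
  · rw [if_neg h, if_neg (by omega)]; simp

/-- From `sin² = (1 - cos (2 ·)) / 2` and the Taylor series of the logarithm; at the point
`r exp (2 i θ)` only `|1 - z| ≤ 2` is used. -/
theorem sum_pow_div_mul_sin_sq_le {r : ℝ} (hr0 : 0 ≤ r) (hr1 : r < 1) (θ : ℝ) (n : ℕ) :
    ∑ s ∈ Finset.range n, r ^ s / s * sin (s * θ) ^ 2 ≤ (-log (1 - r) + log 2) / 2 := by
  have hz1 : ‖(r : ℂ)‖ < 1 := by rw [Complex.norm_real, norm_of_nonneg hr0]; exact hr1
  have hz2 : ‖(r : ℂ) * Complex.exp ((2 * θ : ℝ) * Complex.I)‖ < 1 := by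
    rw [norm_mul, Complex.norm_exp_ofReal_mul_I, mul_one]; exact hz1
  have h1 := Complex.hasSum_re (Complex.hasSum_taylorSeries_neg_log hz1)
  have h2 := Complex.hasSum_re (Complex.hasSum_taylorSeries_neg_log hz2)
  have h3 := (h1.sub h2).div_const 2
  have e : ∀ s : ℕ, (((r : ℂ) ^ s / s).re
      - (((r : ℂ) * Complex.exp ((2 * θ : ℝ) * Complex.I)) ^ s / s).re) / 2
      = r ^ s / s * sin (s * θ) ^ 2 := by
    intro s
    have e1 : ((r : ℂ) ^ s / s).re = r ^ s / s := by norm_cast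
    have e2 : (((r : ℂ) * Complex.exp ((2 * θ : ℝ) * Complex.I)) ^ s / s)
        = ((r ^ s / s : ℝ) : ℂ) * Complex.exp ((2 * (s * θ) : ℝ) * Complex.I) := by
      rw [mul_pow, ← Complex.exp_nat_mul]
      push_cast
      rw [mul_div_right_comm]
      congr 2
      ring
    rw [e1, e2, Complex.re_ofReal_mul, Complex.exp_ofReal_mul_I_re, cos_two_mul, cos_sq']
    ring
  simp only [e] at h3
  have h4 := sum_le_hasSum (Finset.range n) (fun s _ => by positivity) h3
  refine h4.trans ?_
  have e1 : (-Complex.log (1 - (r : ℂ))).re = -log (1 - r) := by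
    rw [← Complex.ofReal_one, ← Complex.ofReal_sub, Complex.neg_re, Complex.log_ofReal_re]
  have e2 : -log 2 ≤ (-Complex.log (1 - (r : ℂ) * Complex.exp ((2 * θ : ℝ) * Complex.I))).re := by
    rw [Complex.neg_re, Complex.log_re, neg_le_neg_iff]
    refine log_le_log ?_ ?_
    · rw [norm_pos_iff, sub_ne_zero]
      intro h
      rw [← h, norm_one] at hz2
      exact lt_irrefl _ hz2
    · refine (norm_sub_le _ _).trans ?_
      rw [norm_one]
      linarith
  rw [e1]
  linarith

/-- The Cauchy–Schwarz inequality with weight `|v|`. -/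
theorem sq_integral_mul_le {v g : ℝ → ℝ} (hv : Continuous v) (hg : Continuous g) :
    (∫ θ in (0 : ℝ)..π, v θ * g θ) ^ 2
      ≤ (∫ θ in (0 : ℝ)..π, |v θ|) * ∫ θ in (0 : ℝ)..π, |v θ| * g θ ^ 2 := by
  have h1 : |∫ θ in (0 : ℝ)..π, v θ * g θ| ≤ ∫ θ in (0 : ℝ)..π, |v θ| * |g θ| := by
    refine (intervalIntegral.abs_integral_le_integral_abs pi_pos.le).trans_eq ?_
    simp only [abs_mul]
  have h2 : ∀ c : ℝ, 0 ≤ (∫ θ in (0 : ℝ)..π, |v θ|) * (c * c)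
      + (-2 * ∫ θ in (0 : ℝ)..π, |v θ| * |g θ|) * c + ∫ θ in (0 : ℝ)..π, |v θ| * g θ ^ 2 := by
    intro c
    have h3 : 0 ≤ ∫ θ in (0 : ℝ)..π, |v θ| * (|g θ| - c) ^ 2 :=
      intervalIntegral.integral_nonneg pi_pos.le fun θ _ => by positivity
    have e : ∀ θ, |v θ| * (|g θ| - c) ^ 2
        = |v θ| * (c * c) + (-2 * (|v θ| * |g θ|) * c + |v θ| * g θ ^ 2) := by
      intro θ; rw [← sq_abs (g θ)]; ring
    simp only [e] at h3
    rw [intervalIntegral.integral_add (Continuous.intervalIntegrable (by fun_prop) _ _)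
      (Continuous.intervalIntegrable (by fun_prop) _ _), intervalIntegral.integral_add
      (Continuous.intervalIntegrable (by fun_prop) _ _)
      (Continuous.intervalIntegrable (by fun_prop) _ _), intervalIntegral.integral_mul_const,
      intervalIntegral.integral_mul_const, intervalIntegral.integral_const_mul] at h3
    linarith
  have h3 := discrim_le_zero h2
  rw [discrim] at h3
  have h4 : (∫ θ in (0 : ℝ)..π, v θ * g θ) ^ 2 ≤ (∫ θ in (0 : ℝ)..π, |v θ| * |g θ|) ^ 2 :=
    sq_le_sq.2 (h1.trans (le_abs_self _))
  nlinarith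

/-- The squared `H^{1/2}` norm of a cosine polynomial is bounded by the squared `L¹` norm of its
derivative, times a logarithm. The frequencies are split smoothly by
`1 ≤ r ^ s + (1 - r) s`; the first part is estimated in `L¹` and the second one in `L²`. -/
theorem sum_mul_sq_le {n : ℕ} (A : ℕ → ℝ) {v : ℝ → ℝ}
    (hv : ∀ θ, v θ = ∑ s ∈ Finset.range n, A s * (s * sin (s * θ))) {r : ℝ} (hr0 : 0 ≤ r)
    (hr1 : r < 1) :
    ∑ s ∈ Finset.range n, s * A s ^ 2
      ≤ 2 / π ^ 2 * (∫ θ in (0 : ℝ)..π, |v θ|) ^ 2 * (-log (1 - r) + log 2)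
        + (1 - r) * (2 / π * ∫ θ in (0 : ℝ)..π, v θ ^ 2) := by
  have hpi := pi_pos
  have hvc : Continuous v := by
    rw [show v = fun θ => ∑ s ∈ Finset.range n, A s * (s * sin (s * θ)) from funext hv]
    fun_prop
  have hcoef : ∀ t ∈ Finset.range n, ∫ θ in (0 : ℝ)..π, v θ * sin (t * θ) = t * A t * (π / 2) := by
    intro t ht
    rcases eq_or_ne t 0 with rfl | ht0
    · simp
    have e : ∀ θ, v θ * sin (t * θ)
        = ∑ s ∈ Finset.range n, s * A s * (sin (s * θ) * sin (t * θ)) := by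
      intro θ
      rw [hv, Finset.sum_mul]
      exact Finset.sum_congr rfl fun s _ => by ring
    simp only [e]
    rw [intervalIntegral.integral_finsetSum fun i _ =>
      Continuous.intervalIntegrable (by fun_prop) _ _]
    simp only [intervalIntegral.integral_const_mul, integral_sin_mul_sin _ ht0, mul_ite, mul_zero]
    rw [Finset.sum_ite_eq', if_pos ht]
  have hsq : ∫ θ in (0 : ℝ)..π, v θ ^ 2 = ∑ s ∈ Finset.range n, s ^ 2 * A s ^ 2 * (π / 2) := by
    have e : ∀ θ, v θ ^ 2 = ∑ s ∈ Finset.range n, A s * s * (v θ * sin (s * θ)) := by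
      intro θ
      rw [sq]
      nth_rewrite 2 [hv]
      rw [Finset.mul_sum]
      exact Finset.sum_congr rfl fun s _ => by ring
    simp only [e]
    rw [intervalIntegral.integral_finsetSum fun i _ =>
      Continuous.intervalIntegrable (by fun_prop) _ _]
    refine Finset.sum_congr rfl fun s hs => ?_
    rw [intervalIntegral.integral_const_mul, hcoef s hs]
    ring
  set D := ∫ θ in (0 : ℝ)..π, |v θ| with hD
  have hD0 : 0 ≤ D := intervalIntegral.integral_nonneg hpi.le fun θ _ => abs_nonneg _
  have hterm : ∀ s ∈ Finset.range n, s * A s ^ 2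
      ≤ 4 / π ^ 2 * D * (∫ θ in (0 : ℝ)..π, |v θ| * (r ^ s / s * sin (s * θ) ^ 2))
        + (1 - r) * (2 / π * (s ^ 2 * A s ^ 2 * (π / 2))) := by
    intro s hs
    rcases eq_or_ne s 0 with rfl | hs0
    · simp
    have hs0' : (0 : ℝ) < s := by positivity
    have h1 := sq_integral_mul_le hvc (g := fun θ => sin (s * θ)) (by fun_prop)
    rw [hcoef s hs] at h1
    have h2 : 1 + s * (r - 1) ≤ r ^ s := by
      have := one_add_mul_le_pow (a := r - 1) (by linarith) s
      simpa using this
    have e1 : ∫ θ in (0 : ℝ)..π, |v θ| * (r ^ s / s * sin (s * θ) ^ 2)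
        = r ^ s / s * ∫ θ in (0 : ℝ)..π, |v θ| * sin (s * θ) ^ 2 := by
      rw [← intervalIntegral.integral_const_mul]
      congr 1
      funext θ
      ring
    have h3 : s * A s ^ 2 * r ^ s
        ≤ 4 / π ^ 2 * D * (r ^ s / s * ∫ θ in (0 : ℝ)..π, |v θ| * sin (s * θ) ^ 2) := by
      calc _ = r ^ s / s * (4 / π ^ 2) * (s * A s * (π / 2)) ^ 2 := by field_simp; norm_num
        _ ≤ r ^ s / s * (4 / π ^ 2) * (D * ∫ θ in (0 : ℝ)..π, |v θ| * sin (s * θ) ^ 2) := by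
            gcongr
        _ = _ := by ring
    have h4 : 2 / π * (s ^ 2 * A s ^ 2 * (π / 2)) = s ^ 2 * A s ^ 2 := by field_simp
    rw [e1, h4]
    nlinarith [mul_nonneg hs0'.le (sq_nonneg (A s))]
  refine (Finset.sum_le_sum hterm).trans ?_
  rw [Finset.sum_add_distrib, ← Finset.mul_sum, ← Finset.mul_sum, ← Finset.mul_sum, ← hsq,
    ← intervalIntegral.integral_finsetSum fun i _ =>
      Continuous.intervalIntegrable (by fun_prop) _ _]
  have hlog : ∫ θ in (0 : ℝ)..π, ∑ s ∈ Finset.range n, |v θ| * (r ^ s / s * sin (s * θ) ^ 2)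
      ≤ D * ((-log (1 - r) + log 2) / 2) := by
    rw [hD, ← intervalIntegral.integral_mul_const]
    refine intervalIntegral.integral_mono_on hpi.le
      (Continuous.intervalIntegrable (by fun_prop) _ _)
      (Continuous.intervalIntegrable (by fun_prop) _ _) fun θ _ => ?_
    rw [← Finset.mul_sum]
    exact mul_le_mul_of_nonneg_left (sum_pow_div_mul_sin_sq_le hr0 hr1 θ n) (abs_nonneg _)
  have : 4 / π ^ 2 * D * ∫ θ in (0 : ℝ)..π, ∑ s ∈ Finset.range n,
      |v θ| * (r ^ s / s * sin (s * θ) ^ 2)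
      ≤ 2 / π ^ 2 * D ^ 2 * (-log (1 - r) + log 2) := by
    calc _ ≤ 4 / π ^ 2 * D * (D * ((-log (1 - r) + log 2) / 2)) := by gcongr
      _ = _ := by ring
  linarith

/-- Collecting the steps of equal length turns the bond sum into a sum over Fourier modes. -/
theorem bond_eq_sum {κ : Type} [Fintype κ] {d : κ → ℤ} {c : κ → ℝ} {σ : κ ≃ κ}
    (hσd : ∀ x, d (σ x) = -d x) (hσc : ∀ x, c (σ x) = c x) {n : ℕ} (hn : ∀ x, (d x).natAbs < n) :
    2 * bond d c d c
      = ∑ s ∈ Finset.range n, s * (∑ k, if (d k).natAbs = s then c k else 0) ^ 2 := by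
  have h1 : bond d c d c
      = ∑ k, ∑ k', if d k = d k' then c k * c k' * (|d k| : ℤ) else 0 := by
    refine Finset.sum_congr rfl fun k _ => ?_
    rw [← σ.sum_comp]
    refine Finset.sum_congr rfl fun k' _ => ?_
    rw [hσd, hσc]
    exact if_congr (by omega) rfl rfl
  have h2 : 2 * bond d c d c
      = ∑ k, ∑ k', if (d k).natAbs = (d k').natAbs then c k * c k' * ((d k).natAbs : ℝ) else 0 := by
    rw [two_mul]
    nth_rewrite 1 [h1]
    rw [bond, ← Finset.sum_add_distrib]
    refine Finset.sum_congr rfl fun k _ => ?_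
    rw [← Finset.sum_add_distrib]
    refine Finset.sum_congr rfl fun k' _ => ?_
    have e : ((|d k| : ℤ) : ℝ) = ((d k).natAbs : ℝ) := by
      rw [Int.abs_eq_natAbs, Int.cast_natCast]
    rw [e]
    by_cases h0 : d k = 0
    · simp [h0]
    · by_cases h3 : d k = d k'
      · rw [if_pos h3, if_neg (by omega), if_pos (by omega), add_zero]
      · by_cases h4 : d k + d k' = 0
        · rw [if_neg h3, if_pos h4, if_pos (by omega), zero_add]
        · rw [if_neg h3, if_neg h4, if_neg (by omega), zero_add]
  rw [h2]
  symm
  calc _ = ∑ s ∈ Finset.range n, ∑ k, ∑ k', (if (d k).natAbs = s then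
        (if (d k).natAbs = (d k').natAbs then c k * c k' * ((d k).natAbs : ℝ) else 0) else 0) := by
        refine Finset.sum_congr rfl fun s _ => ?_
        rw [sq, Finset.sum_mul_sum, Finset.mul_sum]
        refine Finset.sum_congr rfl fun k _ => ?_
        rw [Finset.mul_sum]
        refine Finset.sum_congr rfl fun k' _ => ?_
        by_cases h : (d k).natAbs = s
        · subst h
          by_cases h' : (d k).natAbs = (d k').natAbs
          · rw [if_pos rfl, if_pos h'.symm, if_pos rfl, if_pos h']; ring
          · rw [if_pos rfl, if_neg (Ne.symm h'), if_pos rfl, if_neg h']; ring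
        · rw [if_neg h, if_neg h]; ring
    _ = _ := by
        rw [Finset.sum_comm]
        refine Finset.sum_congr rfl fun k _ => ?_
        rw [Finset.sum_comm]
        refine Finset.sum_congr rfl fun k' _ => ?_
        rw [Finset.sum_ite_eq, if_pos (Finset.mem_range.2 (hn k))]

variable {a b : ℝ}

open Filter in
/-- For polynomial symbols the pair sum of the squared increment is a sum over Fourier coefficients of
the symbol `p (a + 2 b cos θ)`, to which `sum_mul_sq_le` applies. -/
theorem eventually_pairSum_polynomial_le (a b : ℝ) (p : Polynomial ℝ) {r : ℝ} (hr0 : 0 ≤ r)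
    (hr1 : r < 1) {q : ℝ} (hq0 : 0 < q) (hq1 : q < 1) :
    ∀ᶠ N in atTop,
      chainPairSum a b (fun x y => (p.eval x - p.eval y) * (p.eval x - p.eval y)) q N
        ≤ 2 / π ^ 2 * (∫ θ in (0 : ℝ)..π, |(Polynomial.derivative p).eval (a + 2 * b * cos θ)
            * (2 * b * sin θ)|) ^ 2 * (-log (1 - r) + log 2)
          + (1 - r) * (2 / π * ∫ θ in (0 : ℝ)..π,
            ((Polynomial.derivative p).eval (a + 2 * b * cos θ) * (2 * b * sin θ)) ^ 2) := by
  obtain ⟨κ, _, d, c, σ, h1, h2, h3, h4⟩ := eventually_pairSum_polynomial a b p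
  filter_upwards [h4 q hq0 hq1] with N h5
  obtain ⟨L, hL0, hL⟩ := exists_step_bound d
  have hn : ∀ x, (d x).natAbs < L.toNat + 1 := fun x => by have := abs_le.1 (hL x); omega
  rw [chainPairSum, h5, bond_eq_sum h1 h2 hn]
  refine sum_mul_sq_le _ (fun θ => ?_) hr0 hr1
  have e1 : HasDerivAt (fun θ => p.eval (a + 2 * b * cos θ))
      ((Polynomial.derivative p).eval (a + 2 * b * cos θ) * (2 * b * -sin θ)) θ :=
    (p.hasDerivAt _).comp θ (((hasDerivAt_cos θ).const_mul (2 * b)).const_add a)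
  have e2 : HasDerivAt (fun θ : ℝ => ∑ k, c k * cos (d k * θ))
      (∑ k, c k * (-sin (d k * θ) * d k)) θ :=
    HasDerivAt.fun_sum fun k _ => (((hasDerivAt_cos (d k * θ)).comp θ
      (((hasDerivAt_id θ).const_mul (d k : ℝ)).congr_deriv (mul_one _))).const_mul (c k))
  have e3 : (fun θ => p.eval (a + 2 * b * cos θ)) = fun θ => ∑ k, c k * cos (d k * θ) :=
    funext h3
  rw [e3] at e1
  have e4 := e1.unique e2
  have e5 : ∀ k, c k * (-sin (d k * θ) * d k)
      = -(c k * ((d k).natAbs * sin ((d k).natAbs * θ))) := by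
    intro k
    rcases Int.natAbs_eq (d k) with h | h
    · have : ((d k : ℤ) : ℝ) = ((d k).natAbs : ℝ) := by rw [h]; simp
      rw [this]; ring
    · have : ((d k : ℤ) : ℝ) = -((d k).natAbs : ℝ) := by
        rw [← Int.cast_natCast (d k).natAbs, ← Int.cast_neg, ← h]
      rw [this, neg_mul ((d k).natAbs : ℝ) θ, sin_neg]; ring
  simp only [e5, Finset.sum_neg_distrib] at e4
  have e6 : (Polynomial.derivative p).eval (a + 2 * b * cos θ) * (2 * b * sin θ)
      = ∑ k, c k * ((d k).natAbs * sin ((d k).natAbs * θ)) := by linarith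
  rw [e6]
  simp only [Finset.sum_mul]
  rw [Finset.sum_comm]
  refine Finset.sum_congr rfl fun k _ => ?_
  simp only [ite_mul, zero_mul]
  rw [Finset.sum_ite_eq, if_pos (Finset.mem_range.2 (hn k))]

open Filter Topology in
/-- The pair sum of the squared increment of a monotone function is at most the square of its
total increment times a logarithm, up to a term that involves its Lipschitz constant. -/
theorem eventually_pairSum_sq_le_log (hb : 0 < b) {w w' : ℝ → ℝ}
    (hw : ∀ x, HasDerivAt w (w' x) x) (hwc : Continuous w') (hw0 : ∀ x, 0 ≤ w' x) {M D : ℝ}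
    (hM : ∀ x, w' x ≤ M) (hD : w (a + 2 * b) - w (a - 2 * b) ≤ D) {r : ℝ} (hr0 : 0 ≤ r)
    (hr1 : r < 1) {q : ℝ} (hq0 : 0 < q) (hq1 : q < 1) {ε : ℝ} (hε : 0 < ε) :
    ∀ᶠ N in atTop, chainPairSum a b (fun x y => (w x - w y) * (w x - w y)) q N
      ≤ 2 / π ^ 2 * D ^ 2 * (-log (1 - r) + log 2) + (1 - r) * (2 / π * (2 * b * M * D)) + ε := by
  have hM0 : 0 ≤ M := (hw0 0).trans (hM 0)
  have hlog : 0 ≤ -log (1 - r) + log 2 := by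
    have h1 := log_nonpos (x := 1 - r) (by linarith) (by linarith)
    have h2 := log_nonneg (x := 2) (by norm_num)
    linarith
  -- the bound obtained from an approximation by a polynomial up to `η` in `C¹`
  set B : ℝ → ℝ := fun η => 2 / π ^ 2 * (D + 2 * b * π * η) ^ 2 * (-log (1 - r) + log 2)
    + (1 - r) * (2 / π * (2 * b * (M + η) * (D + 2 * b * π * η)))
    + η * (2 * M + 3 * η) * (4 * b ^ 2) with hB
  have hBc : Continuous B := by fun_prop
  have hB0 : B 0 = 2 / π ^ 2 * D ^ 2 * (-log (1 - r) + log 2)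
      + (1 - r) * (2 / π * (2 * b * M * D)) := by simp [hB]
  obtain ⟨η, hηB, hη0⟩ : ∃ η, B η < B 0 + ε ∧ 0 < η := by
    have h1 : ∀ᶠ η in 𝓝[>] (0 : ℝ), B η < B 0 + ε :=
      ((hBc.tendsto 0).mono_left nhdsWithin_le_nhds).eventually_lt_const (by linarith)
    exact (h1.and self_mem_nhdsWithin).exists
  obtain ⟨p, hp1, -, hp3⟩ := exists_polynomial_near_deriv (a := a) hw hwc hb hη0
  have hband : ∀ θ : ℝ, a + 2 * b * cos θ ∈ band a b := fun θ => by
    have h1 := cos_le_one θ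
    have h2 := neg_one_le_cos θ
    constructor <;> nlinarith
  have hp4 : ∀ x ∈ band a b, |(Polynomial.derivative p).eval x| ≤ w' x + η := by
    intro x hx
    have h1 := abs_le.1 (hp3 x hx)
    have h2 := hw0 x
    rw [abs_le]
    constructor <;> linarith
  have hvar : ∫ θ in (0 : ℝ)..π, w' (a + 2 * b * cos θ) * (2 * b * sin θ)
      = w (a + 2 * b) - w (a - 2 * b) := by
    have hd : ∀ θ ∈ Set.uIcc (0 : ℝ) π, HasDerivAt (fun θ => -w (a + 2 * b * cos θ))
        (w' (a + 2 * b * cos θ) * (2 * b * sin θ)) θ := fun θ _ =>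
      (((hw _).comp θ (((hasDerivAt_cos θ).const_mul (2 * b)).const_add a)).neg).congr_deriv
        (by ring)
    rw [intervalIntegral.integral_eq_sub_of_hasDerivAt hd
      (Continuous.intervalIntegrable (by fun_prop) _ _)]
    simp
    ring_nf
  have hvp : ∀ θ ∈ Set.Icc 0 π, |(Polynomial.derivative p).eval (a + 2 * b * cos θ)
      * (2 * b * sin θ)| ≤ w' (a + 2 * b * cos θ) * (2 * b * sin θ) + η * (2 * b) := by
    intro θ hθ
    have hs : 0 ≤ sin θ := sin_nonneg_of_mem_Icc hθ
    have hs1 := sin_le_one θ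
    rw [abs_mul, abs_of_nonneg (by positivity : 0 ≤ 2 * b * sin θ)]
    calc _ ≤ (w' (a + 2 * b * cos θ) + η) * (2 * b * sin θ) := by
          gcongr
          exact hp4 _ (hband θ)
      _ = w' (a + 2 * b * cos θ) * (2 * b * sin θ) + η * (2 * b * sin θ) := by ring
      _ ≤ _ := by
          have : 2 * b * sin θ ≤ 2 * b * 1 := by gcongr
          rw [mul_one] at this
          gcongr
  have hDp : ∫ θ in (0 : ℝ)..π, |(Polynomial.derivative p).eval (a + 2 * b * cos θ)
      * (2 * b * sin θ)| ≤ D + 2 * b * π * η := by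
    calc _ ≤ ∫ θ in (0 : ℝ)..π, (w' (a + 2 * b * cos θ) * (2 * b * sin θ) + η * (2 * b)) :=
          intervalIntegral.integral_mono_on pi_pos.le
            (Continuous.intervalIntegrable (by fun_prop) _ _)
            (Continuous.intervalIntegrable (by fun_prop) _ _) hvp
      _ = w (a + 2 * b) - w (a - 2 * b) + π * (η * (2 * b)) := by
          rw [intervalIntegral.integral_add (Continuous.intervalIntegrable (by fun_prop) _ _)
            (Continuous.intervalIntegrable (by fun_prop) _ _), hvar]
          simp
          ring
      _ ≤ _ := by linarith
  have hDp0 : 0 ≤ ∫ θ in (0 : ℝ)..π, |(Polynomial.derivative p).eval (a + 2 * b * cos θ)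
      * (2 * b * sin θ)| := intervalIntegral.integral_nonneg pi_pos.le fun θ _ => abs_nonneg _
  have hSp : ∫ θ in (0 : ℝ)..π, ((Polynomial.derivative p).eval (a + 2 * b * cos θ)
      * (2 * b * sin θ)) ^ 2 ≤ 2 * b * (M + η) * (D + 2 * b * π * η) := by
    calc _ ≤ ∫ θ in (0 : ℝ)..π, 2 * b * (M + η) *
          |(Polynomial.derivative p).eval (a + 2 * b * cos θ) * (2 * b * sin θ)| := by
          refine intervalIntegral.integral_mono_on pi_pos.le
            (Continuous.intervalIntegrable (by fun_prop) _ _)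
            (Continuous.intervalIntegrable (by fun_prop) _ _) fun θ hθ => ?_
          rw [← sq_abs, sq]
          refine mul_le_mul_of_nonneg_right ?_ (abs_nonneg _)
          have hs : |sin θ| ≤ 1 := abs_sin_le_one θ
          rw [abs_mul, abs_mul, abs_of_pos (by positivity : 0 < 2 * b)]
          have h1 := (hp4 _ (hband θ)).trans (add_le_add_left (hM _) η)
          calc _ ≤ (M + η) * (2 * b * 1) := by gcongr
            _ = _ := by ring
      _ = 2 * b * (M + η) * ∫ θ in (0 : ℝ)..π,
          |(Polynomial.derivative p).eval (a + 2 * b * cos θ) * (2 * b * sin θ)| :=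
          intervalIntegral.integral_const_mul _ _
      _ ≤ _ := by gcongr
  filter_upwards [eventually_pairSum_polynomial_le a b p hr0 hr1 hq0 hq1,
    eventually_pairSum_sq_le (a := a) hb hq0 hq1] with N h1 ⟨hmem, hsq⟩
  have h2 : chainPairSum a b (fun x y => (p.eval x - p.eval y) * (p.eval x - p.eval y)) q N
      ≤ 2 / π ^ 2 * (D + 2 * b * π * η) ^ 2 * (-log (1 - r) + log 2)
        + (1 - r) * (2 / π * (2 * b * (M + η) * (D + 2 * b * π * η))) := by
    refine h1.trans (add_le_add ?_ ?_)
    · gcongr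
    · have : 0 ≤ 1 - r := by linarith
      gcongr
  have h3 := hsq (fun x y => (w x - w y) * (w x - w y)
    + (-1) * ((p.eval x - p.eval y) * (p.eval x - p.eval y))) (η * (2 * M + 3 * η)) (by
      intro x hx y hy
      have h4 := hp1 x hx y hy
      have h5 : |w x - w y| ≤ M * |x - y| := by
        refine (convex_Icc (a - 2 * b) (a + 2 * b)).norm_image_sub_le_of_norm_hasDerivWithin_le
          (fun z _ => (hw z).hasDerivWithinAt) (fun z hz => ?_) hy hx
        rw [norm_eq_abs, abs_of_nonneg (hw0 z)]
        exact hM z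
      set u := w x - w y
      set v := p.eval x - p.eval y
      have e : w x - p.eval x - (w y - p.eval y) = u - v := by ring
      rw [e] at h4
      have h6 : |u + v| ≤ (2 * M + η) * |x - y| := by
        calc |u + v| = |2 * u - (u - v)| := by ring_nf
          _ ≤ |2 * u| + |u - v| := abs_sub _ _
          _ ≤ _ := by rw [abs_mul, abs_two]; linarith
      calc u * u + -1 * (v * v) = (u - v) * (u + v) := by ring
        _ ≤ |u - v| * |u + v| := by rw [← abs_mul]; exact le_abs_self _
        _ ≤ (η * |x - y|) * ((2 * M + η) * |x - y|) := by gcongr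
        _ = η * (2 * M + η) * ((x - y) * (x - y)) := by rw [← abs_mul_abs_self (x - y)]; ring
        _ ≤ _ := by
          refine mul_le_mul_of_nonneg_right ?_ (mul_self_nonneg _)
          nlinarith)
  rw [chainPairSum, pairSum_add, pairSum_const_mul] at h3
  have h4 : B η = _ := rfl
  simp only [hB] at hηB
  rw [← hB0]
  simp only [hB]
  simp only [chainPairSum] at h2 h3 ⊢
  linarith

end Fourier

/-! ### The Fermi function -/

section Fermi

open Real

theorem logistic_pos (x : ℝ) : 0 < logistic x := by unfold logistic; positivity

theorem one_sub_logistic (x : ℝ) : 1 - logistic x = logistic (-x) := by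
  have h : exp x * exp (-x) = 1 := by rw [← exp_add]; simp
  unfold logistic
  have h1 : 0 < 1 + exp x := by positivity
  have h2 : 0 < 1 + exp (-x) := by positivity
  field_simp
  linear_combination -h

theorem logistic_lt_one (x : ℝ) : logistic x < 1 := by
  have := logistic_pos (-x)
  rw [← one_sub_logistic] at this
  linarith

theorem logistic_mem (x : ℝ) : logistic x ∈ Set.Ioo (0 : ℝ) 1 :=
  ⟨logistic_pos x, logistic_lt_one x⟩

theorem logistic_le_exp (x : ℝ) : logistic x ≤ exp x :=
  div_le_self (exp_pos x).le (by linarith [exp_pos x])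

theorem hasDerivAt_logistic (x : ℝ) :
    HasDerivAt logistic (logistic x * (1 - logistic x)) x := by
  have h1 : 0 < 1 + exp x := by positivity
  refine ((hasDerivAt_exp x).div ((hasDerivAt_exp x).const_add 1) h1.ne').congr_deriv ?_
  unfold logistic
  field_simp

theorem hasDerivAt_logistic_mul (μ x : ℝ) : HasDerivAt (fun x => logistic (μ * x))
    (μ * (logistic (μ * x) * (1 - logistic (μ * x)))) x :=
  ((hasDerivAt_logistic (μ * x)).comp x ((hasDerivAt_id x).const_mul μ)).congr_deriv (by
    simp only [mul_one]; ring)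

@[fun_prop]
theorem continuous_logistic : Continuous logistic :=
  continuous_iff_continuousAt.2 fun x => (hasDerivAt_logistic x).continuousAt

theorem logistic_mono : Monotone logistic :=
  monotone_of_deriv_nonneg (fun x => (hasDerivAt_logistic x).differentiableAt) fun x => by
    rw [(hasDerivAt_logistic x).deriv]
    have := logistic_pos x
    have := logistic_lt_one x
    exact mul_nonneg (by linarith) (by linarith)

theorem hasDerivAt_logistic_mul_rpow (μ p x : ℝ) : HasDerivAt (fun x => logistic (μ * x) ^ p)
    (p * μ * (logistic (μ * x) ^ p * (1 - logistic (μ * x)))) x := by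
  have h0 := logistic_pos (μ * x)
  refine ((hasDerivAt_logistic_mul μ x).rpow_const (Or.inl h0.ne')).congr_deriv ?_
  rw [rpow_eq_rpow_sub_one_mul h0 p]
  ring

/-- Passing from a Fermi function to its escort distribution multiplies the inverse temperature. -/
theorem escort_logistic (α x : ℝ) : escort α (logistic x) = logistic (α * x) := by
  have h1 : 0 < 1 + exp x := by positivity
  have h2 : 1 - logistic x = 1 / (1 + exp x) := by
    unfold logistic; field_simp; ring
  rw [escort, normPow, h2, logistic, div_rpow (exp_pos x).le h1.le,
    div_rpow zero_le_one h1.le, one_rpow, ← exp_mul, mul_comm x α, logistic]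
  have h3 : 0 < (1 + exp x) ^ α := by positivity
  field_simp
  ring

theorem abs_sub_le_of_hasDerivAt_band {a b C : ℝ} {w w' : ℝ → ℝ}
    (hw : ∀ x, HasDerivAt w (w' x) x) (hC : ∀ x ∈ band a b, |w' x| ≤ C) {x y : ℝ}
    (hx : x ∈ band a b) (hy : y ∈ band a b) : |w x - w y| ≤ C * |x - y| :=
  (convex_Icc (a - 2 * b) (a + 2 * b)).norm_image_sub_le_of_norm_hasDerivWithin_le
    (fun z _ => (hw z).hasDerivWithinAt) (fun z hz => hC z hz) hy hx

end Fermi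

/-! ### The asymptotic mutual information as a limit of pair sums -/

section ChainLimit

open Filter Topology

variable {a b α β : ℝ}

theorem mutualInformation_gibbsState_eq_blockDefect {N : ℕ} {V : Matrix (Fin N) (Fin N) ℝ}
    (hV : V.IsHermitian) (α β : ℝ) (A : Finset (Fin N)) :
    mutualInformation α A (gibbsState β (hamiltonian V))
      = blockDefect hV (fun x => logistic (-β * x)) (modeEntropy α) A / Real.log 2 := by
  have hmem : ∀ (B : Finset (Fin N)) (i : B),
      (block_isHermitian hV (fun x => logistic (-β * x)) B).eigenvalues i ∈ Set.Ioo (0 : ℝ) 1 :=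
    fun B i => block_eigenvalues_mem (hV := hV) (φ := fun x => logistic (-β * x)) (convex_Ioo 0 1)
      (fun k => logistic_mem (-β * hV.eigenvalues k)) B i
  have h₁ := block_isHermitian hV (fun x => logistic (-β * x)) A
  have h₂ := block_isHermitian hV (fun x => logistic (-β * x)) Aᶜ
  rw [blockDefect]
  exact mutualInformation_gibbsState (O := eigMat hV) (V := V)
    (Γ := funMat hV fun x => logistic (-β * x)) (v := hV.eigenvalues) (O₁ := eigMat h₁)
    (y₁ := h₁.eigenvalues) (O₂ := eigMat h₂)
    (y₂ := h₂.eigenvalues) (eigMat_transpose_mul hV) (mul_eigMat hV) β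
    (funMat_mul_eigMat hV fun x => logistic (-β * x)) A
    (eigMat_transpose_mul h₁) (hmem A) (mul_eigMat h₁) (eigMat_transpose_mul h₂) (hmem Aᶜ)
    (mul_eigMat h₂) α

theorem mutualInformationXX_eq (a b α β q : ℝ) (N : ℕ) : mutualInformationXX a b α β q N
    = chainDefect a b (fun x => logistic (-β * x)) (modeEntropy α) q N / Real.log 2 :=
  mutualInformation_gibbsState_eq_blockDefect _ α β _

/-- `ℓ` is the limit of the pair sums with the Widom kernel of the entropy of a mode, evaluated at
the Fermi function of inverse temperature `β`. The second derivative of the entropy is singular at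
`0` and `1`, hence the continuous function `h` that agrees with it where the Fermi function takes
its values. -/
def IsWidomLimit (a b α β ℓ : ℝ) : Prop :=
  ∃ h : ℝ → ℝ, Continuous h ∧
    (∀ x ∈ band a b, ∀ y ∈ band a b, ∀ w ∈ Set.uIcc (logistic (-β * x)) (logistic (-β * y)),
      h w = entropyCurv α w) ∧
    Tendsto (chainPairSum a b
      (fun x y => widomKernel h (logistic (-β * x)) (logistic (-β * y))) (1 / 2)) atTop (𝓝 ℓ)

/-- The asymptotic mutual information exists and equals `ℓ / log 2`, for every ratio `q`. -/
theorem exists_isWidomLimit (hb : 0 < b) (α : ℝ) (hβ : 0 < β) : ∃ ℓ, IsWidomLimit a b α β ℓ ∧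
    ∀ q : ℝ, 0 < q → q < 1 →
      Tendsto (fun N => mutualInformationXX a b α β q N) atTop (𝓝 (ℓ / Real.log 2)) := by
  set c := logistic (-β * (a + 2 * b)) with hc
  set d := logistic (-β * (a - 2 * b)) with hd
  have hcd : ∀ x ∈ band a b, logistic (-β * x) ∈ Set.Icc c d := fun x hx =>
    ⟨logistic_mono (by nlinarith [hx.2]), logistic_mono (by nlinarith [hx.1])⟩
  have hcd' : c ≤ d := logistic_mono (by nlinarith)
  have hsub : ∀ x ∈ Set.Icc c d, x ∈ Set.Ioo (0 : ℝ) 1 := fun x hx =>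
    ⟨(logistic_pos _).trans_le hx.1, hx.2.trans_lt (logistic_lt_one _)⟩
  set h : ℝ → ℝ := fun w => entropyCurv α (max c (min d w)) with hh
  have hhc : Continuous h := continuousOn_entropyCurv.comp_continuous (by fun_prop) fun w =>
    hsub _ ⟨le_max_left _ _, max_le hcd' (min_le_left _ _)⟩
  have hhe : ∀ w ∈ Set.Icc c d, h w = entropyCurv α w := fun w hw => by
    simp only [hh, min_eq_right hw.2, max_eq_right hw.1]
  obtain ⟨ℓ, hℓ⟩ := exists_bothTendTo (a := a) hb (hasDerivAt_logistic_mul (-β)) (by fun_prop) hcd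
    (g := modeEntropy α) (g' := entropyDeriv α) hhc
    (fun x hx => hasDerivAt_modeEntropy (hsub x hx).1 (hsub x hx).2)
    (fun x hx => by
      have hx' := Set.Ioo_subset_Icc_self hx
      rw [hhe x hx']
      exact hasDerivAt_entropyDeriv (hsub x hx').1 (hsub x hx').2)
  refine ⟨ℓ, ⟨h, hhc, fun x hx y hy w hw => hhe w ?_, (hℓ (1 / 2) (by norm_num) (by norm_num)).2⟩,
    fun q hq0 hq1 => ?_⟩
  · exact Set.ordConnected_Icc.uIcc_subset (hcd x hx) (hcd y hy) hw
  · simp only [mutualInformationXX_eq]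
    exact (hℓ q hq0 hq1).1.div_const _

/-- A kernel close to a multiple of `(x - y)²` on the band has a limit close to the same multiple
of `4 b²`. -/
theorem abs_limit_sub_le (hb : 0 < b) {K : ℝ → ℝ → ℝ} {ℓ c C : ℝ}
    (h : Tendsto (chainPairSum a b K (1 / 2)) atTop (𝓝 ℓ))
    (hK : ∀ x ∈ band a b, ∀ y ∈ band a b, |K x y - c * ((x - y) * (x - y))|
      ≤ C * ((x - y) * (x - y))) : |ℓ - c * (4 * b ^ 2)| ≤ C * (4 * b ^ 2) := by
  have hev := eventually_pairSum_sq_le (a := a) hb (q := 1 / 2) (by norm_num) (by norm_num)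
  have h1 : ℓ ≤ (c + C) * (4 * b ^ 2) := le_of_tendsto h (by
    filter_upwards [hev] with N hN
    exact hN.2 K _ fun x hx y hy => by
      have := (abs_le.1 (hK x hx y hy)).2
      linarith)
  have h2 : -1 * ℓ ≤ (C - c) * (4 * b ^ 2) := le_of_tendsto (h.const_mul (-1)) (by
    filter_upwards [hev] with N hN
    rw [chainPairSum, ← pairSum_const_mul]
    exact hN.2 _ _ fun x hx y hy => by
      have := (abs_le.1 (hK x hx y hy)).1
      linarith)
  rw [abs_le]
  constructor <;> linarith

end ChainLimit

/-! ### High temperature -/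

section HighTemperature

open Filter Topology

variable {a b α β : ℝ}

theorem widomKernel_const (c x y : ℝ) :
    widomKernel (fun _ => c) x y = c / 2 * ((x - y) * (x - y)) := by
  simp only [widomKernel, segmentAvg, intervalIntegral.integral_const, smul_eq_mul]
  ring

/-- At high temperature the Fermi function is close to `1 / 2 - β x / 4`, and the entropy of a mode is
close to a quadratic polynomial with second derivative `-4 α`. -/
theorem tendsto_isWidomLimit_div_sq (hb : 0 < b) {L : ℝ → ℝ}
    (hL : ∀ β, 0 < β → IsWidomLimit a b α β (L β)) (hα : 0 < α) :
    Tendsto (fun β => L β / β ^ 2) (𝓝[>] 0) (𝓝 (α * b ^ 2 / 2)) := by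
  rw [Metric.tendsto_nhds]
  intro ε hε
  set ε' := ε / (8 * b ^ 2 * (1 + 4 * α)) with hε'
  have hε'0 : 0 < ε' := by positivity
  -- close to `1/2` the curvature of the entropy is close to `4 α`
  have hcont : ContinuousAt (entropyCurv α) 2⁻¹ :=
    continuousOn_entropyCurv.continuousAt (Ioo_mem_nhds (by norm_num) (by norm_num))
  obtain ⟨δ, hδ0, hδ⟩ := Metric.continuousAt_iff.1 hcont ε' hε'0
  rw [entropyCurv_half] at hδ
  set η := min (δ / 2) (min ε' 1) with hη
  have hη0 : 0 < η := by positivity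
  have hηδ : η < δ := (min_le_left _ _).trans_lt (by linarith)
  have hηε : η ≤ ε' := (min_le_right _ _).trans (min_le_left _ _)
  have hη1 : η ≤ 1 := (min_le_right _ _).trans (min_le_right _ _)
  set R := |a| + 2 * b with hR
  have hR0 : 0 < R := by positivity
  have hband : ∀ x ∈ band a b, |x| ≤ R := fun x hx => by
    have h1 := neg_abs_le a
    have h2 := le_abs_self a
    have h3 := hx.1
    have h4 := hx.2
    rw [abs_le]
    constructor <;> linarith
  have hlim : ∀ᶠ β in 𝓝[>] (0 : ℝ), β < η / R :=
    nhdsWithin_le_nhds (eventually_lt_nhds (by positivity))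
  filter_upwards [hlim, self_mem_nhdsWithin] with β hβ (hβ0 : 0 < β)
  rw [lt_div_iff₀ hR0] at hβ
  have hhalf : logistic 0 = 2⁻¹ := by norm_num [logistic]
  have hlog : ∀ x ∈ band a b, |logistic (-β * x) - 2⁻¹| ≤ η := by
    intro x hx
    have h1 := convex_univ.norm_image_sub_le_of_norm_hasDerivWithin_le (C := 1)
      (fun z _ => (hasDerivAt_logistic z).hasDerivWithinAt) (fun z _ => by
        have := logistic_pos z
        have := logistic_lt_one z
        rw [Real.norm_eq_abs, abs_le]
        constructor <;> nlinarith) (Set.mem_univ 0) (Set.mem_univ (-β * x))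
    rw [hhalf, sub_zero, one_mul, Real.norm_eq_abs, Real.norm_eq_abs, abs_mul, abs_neg,
      abs_of_pos hβ0] at h1
    have h2 := mul_le_mul_of_nonneg_left (hband x hx) hβ0.le
    linarith
  obtain ⟨h, hh, hhe, ht⟩ := hL β hβ0
  have key := abs_limit_sub_le (c := α / 8 * β ^ 2) (C := (ε' / 2 + 4 * α * η) * β ^ 2) hb ht (by
    intro x hx y hy
    set u := logistic (-β * x)
    set v := logistic (-β * y)
    have hd1 : |u - v| ≤ β * |x - y| :=
      abs_sub_le_of_hasDerivAt_band (hasDerivAt_logistic_mul (-β)) (fun z _ => by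
        have h1 := logistic_pos (-β * z)
        have h2 := logistic_lt_one (-β * z)
        rw [abs_mul, abs_neg, abs_of_pos hβ0, abs_of_nonneg (by nlinarith)]
        exact mul_le_of_le_one_right hβ0.le (by nlinarith)) hx hy
    have hd2 : |(u + β / 4 * x) - (v + β / 4 * y)| ≤ β * η * |x - y| :=
      abs_sub_le_of_hasDerivAt_band (w := fun z => logistic (-β * z) + β / 4 * z)
        (fun z => (hasDerivAt_logistic_mul (-β) z).add ((hasDerivAt_id z).const_mul (β / 4)))
        (fun z hz => by
          have h1 := hlog z hz
          set f := logistic (-β * z)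
          have e : -β * (f * (1 - f)) + β / 4 * 1 = β * |f - 2⁻¹| ^ 2 := by
            rw [sq_abs]; ring
          rw [e, abs_of_nonneg (by positivity)]
          have := abs_nonneg (f - 2⁻¹)
          exact mul_le_mul_of_nonneg_left (by nlinarith) hβ0.le) hx hy
    have hk := abs_widomKernel_le (x := u) (y := v) (h := fun w => h w + -(4 * α))
      (C := ε') (by fun_prop) (fun w hw => by
        have h1 : |w - 2⁻¹| ≤ η := by
          have := Set.ordConnected_Icc (a := 2⁻¹ - η) (b := 2⁻¹ + η) |>.uIcc_subset
            (x := u) (y := v) (by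
              have := abs_le.1 (hlog x hx)
              exact ⟨by linarith, by linarith⟩) (by
              have := abs_le.1 (hlog y hy)
              exact ⟨by linarith, by linarith⟩) hw
          rw [abs_le]
          exact ⟨by linarith [this.1], by linarith [this.2]⟩
        rw [hhe x hx y hy w hw, ← sub_eq_add_neg]
        exact (hδ (h1.trans_lt hηδ)).le)
    rw [widomKernel_add hh continuous_const, widomKernel_const] at hk
    set W := widomKernel h u v
    have h1 : |(u - v) * (u - v) - β ^ 2 / 16 * ((x - y) * (x - y))|
        ≤ 2 * η * (β ^ 2 * ((x - y) * (x - y))) := by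
      have e : (u - v) * (u - v) - β ^ 2 / 16 * ((x - y) * (x - y))
          = (u + β / 4 * x - (v + β / 4 * y)) * ((u - v) - β / 4 * (x - y)) := by ring
      have e2 : |(u - v) - β / 4 * (x - y)| ≤ 2 * (β * |x - y|) := by
        refine (abs_sub _ _).trans ?_
        rw [abs_mul, abs_of_pos (by positivity : 0 < β / 4)]
        nlinarith [abs_nonneg (x - y)]
      rw [e, abs_mul]
      calc _ ≤ (β * η * |x - y|) * (2 * (β * |x - y|)) := by gcongr
        _ = 2 * η * (β ^ 2 * (|x - y| * |x - y|)) := by ring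
        _ = _ := by rw [abs_mul_abs_self]
    have h2 : (u - v) * (u - v) ≤ β ^ 2 * ((x - y) * (x - y)) := mul_self_le_of_abs_le hd1
    have h3 : |W - 2 * α * ((u - v) * (u - v))| ≤ ε' / 2 * (β ^ 2 * ((x - y) * (x - y))) := by
      have e : W - 2 * α * ((u - v) * (u - v)) = W + -(4 * α) / 2 * ((u - v) * (u - v)) := by ring
      rw [e]
      exact hk.trans (by gcongr)
    have e : W - α / 8 * β ^ 2 * ((x - y) * (x - y)) = (W - 2 * α * ((u - v) * (u - v)))
        + 2 * α * ((u - v) * (u - v) - β ^ 2 / 16 * ((x - y) * (x - y))) := by ring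
    rw [e]
    refine (abs_add_le _ _).trans ?_
    rw [abs_mul, abs_of_pos (by positivity : 0 < 2 * α)]
    calc _ ≤ ε' / 2 * (β ^ 2 * ((x - y) * (x - y)))
          + 2 * α * (2 * η * (β ^ 2 * ((x - y) * (x - y)))) := by gcongr
      _ = _ := by ring)
  have e : L β / β ^ 2 - α * b ^ 2 / 2 = (L β - α / 8 * β ^ 2 * (4 * b ^ 2)) / β ^ 2 := by
    field_simp
    ring
  rw [Real.dist_eq, e, abs_div, abs_of_pos (by positivity : 0 < β ^ 2), div_lt_iff₀ (by positivity)]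
  refine key.trans_lt ?_
  have h5 : (ε' / 2 + 4 * α * η) * (4 * b ^ 2) < ε := by
    have e2 : ε' * (8 * b ^ 2 * (1 + 4 * α)) = ε := by
      rw [hε']; field_simp
    have h6 : 4 * α * η ≤ 4 * α * ε' := by gcongr
    have h7 : 0 < ε' * b ^ 2 * α := by positivity
    have h8 : 0 < ε' * b ^ 2 := by positivity
    calc _ ≤ (ε' / 2 + 4 * α * ε') * (4 * b ^ 2) := by gcongr
      _ < ε := by nlinarith
  calc _ = (ε' / 2 + 4 * α * η) * (4 * b ^ 2) * β ^ 2 := by ring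
    _ < _ := by gcongr

end HighTemperature

/-! ### Low temperature -/

section LowTemperature

open Filter Topology

variable {a b α β : ℝ}

/-- Powers of Fermi functions are monotone with values in `[0, 1]`, uniformly in the temperature `1 / μ`,
which only enters through the Lipschitz constant. -/
theorem eventually_pairSum_logistic_le (hb : 0 < b) {μ p M r ε : ℝ} (hp : 0 < p)
    (hM : p * |μ| ≤ M) (hr0 : 0 ≤ r) (hr1 : r < 1) (hε : 0 < ε) :
    ∀ᶠ N in atTop, chainPairSum a b
        (fun x y => (logistic (μ * x) ^ p - logistic (μ * y) ^ p) ^ 2) (1 / 2) N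
      ≤ 2 / Real.pi ^ 2 * (-Real.log (1 - r) + Real.log 2)
        + (1 - r) * (2 / Real.pi * (2 * b * M)) + ε := by
  have hs : ∀ x, 0 ≤ logistic x ^ p ∧ logistic x ^ p ≤ 1 := fun x =>
    ⟨Real.rpow_nonneg (logistic_pos x).le p,
      Real.rpow_le_one (logistic_pos x).le (logistic_lt_one x).le hp.le⟩
  have hs' : ∀ x, 0 ≤ logistic x ^ p * (1 - logistic x) ∧
      logistic x ^ p * (1 - logistic x) ≤ 1 := fun x => by
    have h1 := hs x
    have h2 := logistic_pos x
    have h3 := logistic_lt_one x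
    exact ⟨mul_nonneg h1.1 (by linarith), mul_le_one₀ h1.2 (by linarith) (by linarith)⟩
  -- the sign `s` makes the function increasing
  obtain ⟨s, hs1, hsμ⟩ : ∃ s : ℝ, s * s = 1 ∧ s * μ = |μ| := by
    rcases le_total 0 μ with h | h
    · exact ⟨1, by norm_num, by rw [abs_of_nonneg h, one_mul]⟩
    · exact ⟨-1, by norm_num, by rw [abs_of_nonpos h, neg_one_mul]⟩
  have hs2 : |s| = 1 := by
    have := abs_mul_abs_self s
    rw [hs1] at this
    nlinarith [abs_nonneg s]
  have hder : ∀ x, HasDerivAt (fun x => s * logistic (μ * x) ^ p)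
      (p * |μ| * (logistic (μ * x) ^ p * (1 - logistic (μ * x)))) x := fun x =>
    ((hasDerivAt_logistic_mul_rpow μ p x).const_mul s).congr_deriv (by rw [← hsμ]; ring)
  have h := eventually_pairSum_sq_le_log (a := a) (q := 1 / 2) hb hder
    (by
      have : Continuous fun x => logistic (μ * x) ^ p :=
        Continuous.rpow_const (by fun_prop) fun x => Or.inl (logistic_pos _).ne'
      fun_prop) (fun x => mul_nonneg (by positivity) (hs' _).1) (M := M) (D := 1)
    (fun x => (mul_le_of_le_one_right (by positivity) (hs' _).2).trans hM)
    (by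
      rw [← mul_sub]
      refine (le_abs_self _).trans ?_
      rw [abs_mul, hs2, one_mul, abs_le]
      have h1 := hs (μ * (a + 2 * b))
      have h2 := hs (μ * (a - 2 * b))
      constructor <;> linarith) hr0 hr1 (by norm_num) (by norm_num) hε
  filter_upwards [h] with N hN
  have e : (fun x y => (logistic (μ * x) ^ p - logistic (μ * y) ^ p) ^ 2)
      = fun x y => (s * logistic (μ * x) ^ p - s * logistic (μ * y) ^ p)
        * (s * logistic (μ * x) ^ p - s * logistic (μ * y) ^ p) := by
    funext x y
    linear_combination -(logistic (μ * x) ^ p - logistic (μ * y) ^ p) ^ 2 * hs1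
  rw [e]
  refine hN.trans (le_of_eq ?_)
  ring

/-- If a kernel is bounded by squared increments of two powers of Fermi functions whose inverse
temperatures are proportional to `β`, then the limit of its pair sums grows at most like `log β`. -/
theorem limit_le_log (hb : 0 < b) {K : ℝ → ℝ → ℝ} {ℓ c μ₁ μ₂ p M : ℝ} (hc : 0 ≤ c)
    (hβ : 1 < β) (hp : 0 < p) (h₁ : p * |μ₁| ≤ M * β) (h₂ : p * |μ₂| ≤ M * β)
    (h : Tendsto (chainPairSum a b K (1 / 2)) atTop (𝓝 ℓ))
    (hK : ∀ x ∈ band a b, ∀ y ∈ band a b, K x y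
      ≤ c * ((logistic (μ₁ * x) ^ p - logistic (μ₁ * y) ^ p) ^ 2
        + (logistic (μ₂ * x) ^ p - logistic (μ₂ * y) ^ p) ^ 2)) :
    ℓ ≤ c * (4 / Real.pi ^ 2) * Real.log β
      + c * (4 / Real.pi ^ 2 * Real.log 2 + 8 / Real.pi * b * M) := by
  refine le_of_forall_pos_le_add fun ε hε => le_of_tendsto h ?_
  have hβ0 : 0 < β := by linarith
  -- with `r = 1 - 1 / β` the logarithm is `log β` and the Lipschitz term is bounded
  have hη : 0 < ε / (2 * c + 1) := by positivity
  have hr0 : 0 ≤ 1 - β⁻¹ := by linarith [inv_lt_one_of_one_lt₀ hβ]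
  have hr1 : 1 - β⁻¹ < 1 := by linarith [inv_pos.2 hβ0]
  filter_upwards [eventually_pairSum_sq_le (a := a) hb (q := 1 / 2) (by norm_num) (by norm_num),
    eventually_pairSum_logistic_le (a := a) hb hp h₁ hr0 hr1 hη,
    eventually_pairSum_logistic_le (a := a) hb hp h₂ hr0 hr1 hη] with N ⟨hmem, _⟩ hN1 hN2
  have hle := pairSum_le (A := block (1 / 2) N)
    (G := fun x y => c * ((logistic (μ₁ * x) ^ p - logistic (μ₁ * y) ^ p) ^ 2
      + (logistic (μ₂ * x) ^ p - logistic (μ₂ * y) ^ p) ^ 2))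
    fun k l => hK _ (hmem k) _ (hmem l)
  rw [pairSum_const_mul, pairSum_add] at hle
  have e1 : 1 - (1 - β⁻¹) = β⁻¹ := by ring
  rw [e1, Real.log_inv, neg_neg] at hN1 hN2
  have e2 : β⁻¹ * (2 / Real.pi * (2 * b * (M * β))) = 4 / Real.pi * b * M := by
    field_simp
    ring
  rw [e2] at hN1 hN2
  have h3 := mul_le_mul_of_nonneg_left (add_le_add hN1 hN2) hc
  have h4 : c * (2 * (ε / (2 * c + 1))) ≤ ε := by
    have : ε / (2 * c + 1) * (2 * c + 1) = ε := by field_simp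
    nlinarith
  refine hle.trans (h3.trans ?_)
  calc _ = c * (4 / Real.pi ^ 2) * Real.log β
        + c * (4 / Real.pi ^ 2 * Real.log 2 + 8 / Real.pi * b * M)
        + c * (2 * (ε / (2 * c + 1))) := by ring
    _ ≤ _ := by gcongr

/-- The exponents of the squared increments are `α / 2` for `α < 1` and `1 / 2` for `1 ≤ α < 2`; for
`2 ≤ α` the increments of the Fermi function and of its escort distribution are used. -/
theorem exists_log_bound (hb : 0 < b) (hα : 0 < α) : ∃ c B : ℝ,
    c * (4 / Real.pi ^ 2) / Real.log 2 ≤ lowTemperatureConstant α ∧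
    ∀ β ℓ, 1 < β → IsWidomLimit a b α β ℓ → ℓ ≤ c * (4 / Real.pi ^ 2) * Real.log β + B := by
  have hlog2 : 0 < Real.log 2 := Real.log_pos (by norm_num)
  have hpi := Real.pi_pos
  -- the comparison with the constant, after clearing denominators, where `m = min 1 α`
  have hconst : ∀ {c m : ℝ}, min 1 α = m → 0 < m → 2 * c * m ^ 3 ≤ 27 / 2 * α →
      (α ≠ 1 → 2 * c * |1 - α| * m ^ 2 ≤ 4 * α) →
      c * (4 / Real.pi ^ 2) / Real.log 2 ≤ lowTemperatureConstant α := by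
    intro c m hm hm0 h1 h2
    have e : c * (4 / Real.pi ^ 2) / Real.log 2
        = 2 * α / (Real.pi ^ 2 * Real.log 2 * m ^ 2) * (2 * c * m ^ 2 / α) := by
      field_simp
      ring
    have h3 : 2 * c * m ^ 2 / α ≤ 27 / (2 * m) := by
      rw [div_le_div_iff₀ hα (by positivity)]
      nlinarith
    rw [lowTemperatureConstant, hm, e]
    refine mul_le_mul_of_nonneg_left ?_ (by positivity)
    split_ifs with h
    · exact h3
    · refine le_min h3 ?_
      have h4 : 0 < |1 - α| := abs_pos.2 (sub_ne_zero.2 (Ne.symm h))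
      rw [div_le_div_iff₀ hα h4]
      linarith [h2 h]
  -- the bound of the kernel by powers with exponent `p` of the occupation numbers
  have hpow : ∀ {C p : ℝ}, 0 < p → p ≤ 1 → 0 ≤ C →
      (∀ w : ℝ, 0 < w → w < 1 → entropyCurv α w ≤ C * (w ^ (2 * p - 2) + (1 - w) ^ (2 * p - 2))) →
      ∃ B : ℝ, ∀ β ℓ, 1 < β → IsWidomLimit a b α β ℓ →
        ℓ ≤ C / p ^ 2 / 2 * (4 / Real.pi ^ 2) * Real.log β + B := by
    intro C p hp0 hp1 hC hcurv
    refine ⟨C / p ^ 2 / 2 * (4 / Real.pi ^ 2 * Real.log 2 + 8 / Real.pi * b * p),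
      fun β ℓ hβ hℓ => ?_⟩
    obtain ⟨h, hh, hhe, ht⟩ := hℓ
    refine limit_le_log (μ₁ := -β) (μ₂ := β) (M := p) hb (by positivity) hβ hp0
      (by rw [abs_neg, abs_of_pos (by linarith)]) (by rw [abs_of_pos (by linarith)]) ht ?_
    intro x hx y hy
    have := widomKernel_le_rpow hh (logistic_mem (-β * x)) (logistic_mem (-β * y)) hp0 hp1 hC
      fun w hw => by
        have hw' := mem_unit_of_mem_uIcc (logistic_mem _) (logistic_mem _) hw
        rw [hhe x hx y hy w hw]
        exact hcurv w hw'.1 hw'.2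
    simp only [one_sub_logistic, neg_mul, neg_neg] at this ⊢
    linarith
  rcases lt_or_ge α 1 with h1 | h1
  · have hC : 0 ≤ min (α / (1 - α)) (2 * α) :=
      le_min (div_nonneg hα.le (by linarith)) (by linarith)
    obtain ⟨B, hB⟩ := hpow (p := α / 2) (by positivity) (by linarith) hC fun w hw0 hw1 => by
      have e : 2 * (α / 2) - 2 = α - 2 := by ring
      rw [e]
      exact entropyCurv_le_of_lt_one hα h1 hw0 hw1
    refine ⟨_, B, hconst (min_eq_right h1.le) hα ?_ fun _ => ?_, hB⟩
    · have h2 := min_le_right (α / (1 - α)) (2 * α)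
      calc _ = 4 * α * min (α / (1 - α)) (2 * α) := by field_simp; ring
        _ ≤ 4 * α * (2 * α) := by gcongr
        _ ≤ _ := by nlinarith
    · rw [abs_of_pos (by linarith)]
      have h2 := min_le_left (α / (1 - α)) (2 * α)
      have h3 : 0 < 1 - α := by linarith
      calc _ = 4 * (1 - α) * min (α / (1 - α)) (2 * α) := by field_simp; ring
        _ ≤ 4 * (1 - α) * (α / (1 - α)) := by gcongr
        _ = _ := by field_simp
  rcases lt_or_ge α 2 with h2 | h2
  · obtain ⟨B, hB⟩ := hpow (p := 1 / 2) (by norm_num) (by norm_num) hα.le fun w hw0 hw1 => by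
      have e : (2 : ℝ) * (1 / 2) - 2 = -1 := by norm_num
      rw [e, Real.rpow_neg_one, Real.rpow_neg_one]
      exact entropyCurv_le_of_one_le h1 hw0 hw1
    refine ⟨_, B, hconst (min_eq_left h1) one_pos ?_ fun _ => ?_, hB⟩
    · norm_num
      linarith
    · rw [abs_of_nonpos (by linarith)]
      norm_num
      nlinarith
  · refine ⟨2, 2 * (4 / Real.pi ^ 2 * Real.log 2 + 8 / Real.pi * b * α),
      hconst (min_eq_left h1) one_pos ?_ fun _ => ?_, fun β ℓ hβ hℓ => ?_⟩
    · linarith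
    · rw [abs_of_nonpos (by linarith)]
      linarith
    · obtain ⟨h, hh, hhe, ht⟩ := hℓ
      have hβ0 : 0 < β := by linarith
      refine limit_le_log (μ₁ := -β) (μ₂ := α * -β) hb (by norm_num) hβ one_pos
        (by rw [abs_neg, abs_of_pos hβ0]; nlinarith)
        (by rw [abs_mul, abs_neg, abs_of_pos hα, abs_of_pos hβ0, one_mul]) ht ?_
      intro x hx y hy
      have := widomKernel_le_escort h2 hh (logistic_mem (-β * x)) (logistic_mem (-β * y))
        fun w hw => (hhe x hx y hy w hw).le
      simp only [escort_logistic, ← mul_assoc] at this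
      simp only [Real.rpow_one]
      linarith

theorem limsup_isWidomLimit_le (hb : 0 < b) {L : ℝ → ℝ}
    (hL : ∀ β, 0 < β → IsWidomLimit a b α β (L β)) (hα : 0 < α) :
    limsup (fun β : ℝ => ((L β / Real.log 2 / Real.log β : ℝ) : EReal)) atTop
      ≤ (lowTemperatureConstant α : EReal) := by
  obtain ⟨c, B, hc, hB⟩ := exists_log_bound (a := a) hb hα
  have hlog2 : 0 < Real.log 2 := Real.log_pos (by norm_num)
  have h1 : Tendsto (fun β : ℝ => c * (4 / Real.pi ^ 2) / Real.log 2
      + B / Real.log 2 * (Real.log β)⁻¹) atTop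
      (𝓝 (c * (4 / Real.pi ^ 2) / Real.log 2 + B / Real.log 2 * 0)) :=
    (Real.tendsto_log_atTop.inv_tendsto_atTop.const_mul _).const_add _
  rw [mul_zero, add_zero] at h1
  have h2 : Tendsto (fun β : ℝ => ((c * (4 / Real.pi ^ 2) / Real.log 2
      + B / Real.log 2 * (Real.log β)⁻¹ : ℝ) : EReal)) atTop
      (𝓝 ((c * (4 / Real.pi ^ 2) / Real.log 2 : ℝ) : EReal)) :=
    (continuous_coe_real_ereal.tendsto _).comp h1
  calc _ ≤ limsup (fun β : ℝ => ((c * (4 / Real.pi ^ 2) / Real.log 2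
      + B / Real.log 2 * (Real.log β)⁻¹ : ℝ) : EReal)) atTop := by
        refine limsup_le_limsup ?_
        filter_upwards [eventually_gt_atTop 1] with β hβ
        rw [EReal.coe_le_coe_iff]
        have hlog : 0 < Real.log β := Real.log_pos hβ
        have := hB β (L β) hβ (hL β (by linarith))
        calc _ ≤ (c * (4 / Real.pi ^ 2) * Real.log β + B) / Real.log 2 / Real.log β := by gcongr
          _ = _ := by field_simp
    _ = _ := h2.limsup_eq
    _ ≤ _ := EReal.coe_le_coe_iff.2 hc

/-- A power of a Fermi function is almost constant at distance at least `G` from the zero of the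
energy. -/
theorem abs_logistic_rpow_sub_le {G p : ℝ} (hp0 : 0 < p) (hp1 : p ≤ 1)
    (hG : ∀ x ∈ band a b, G ≤ |x|) (hG0 : 0 ≤ G) (μ : ℝ) {x y : ℝ} (hx : x ∈ band a b)
    (hy : y ∈ band a b) : |logistic (μ * x) ^ p - logistic (μ * y) ^ p|
      ≤ |μ| * Real.exp (-(p * |μ| * G)) * |x - y| := by
  refine abs_sub_le_of_hasDerivAt_band (hasDerivAt_logistic_mul_rpow μ p) (fun z hz => ?_) hx hy
  set t := μ * z with ht
  have h0 := logistic_pos t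
  have h1 := logistic_lt_one t
  have ht' : |μ| * G ≤ |t| := by
    rw [ht, abs_mul]
    exact mul_le_mul_of_nonneg_left (hG z hz) (abs_nonneg _)
  have hs0 : 0 ≤ logistic t ^ p := Real.rpow_nonneg h0.le p
  have hs1 : logistic t ^ p ≤ 1 := Real.rpow_le_one h0.le h1.le hp0.le
  have key : logistic t ^ p * (1 - logistic t) ≤ Real.exp (-(p * |μ| * G)) := by
    rcases le_total t 0 with h | h
    · rw [abs_of_nonpos h] at ht'
      calc _ ≤ logistic t ^ p := mul_le_of_le_one_right hs0 (by linarith)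
        _ ≤ Real.exp t ^ p := Real.rpow_le_rpow h0.le (logistic_le_exp t) hp0.le
        _ = Real.exp (t * p) := (Real.exp_mul t p).symm
        _ ≤ _ := Real.exp_le_exp.2 (by nlinarith)
    · rw [abs_of_nonneg h] at ht'
      calc _ ≤ 1 - logistic t := mul_le_of_le_one_left (by linarith) hs1
        _ = logistic (-t) := one_sub_logistic t
        _ ≤ Real.exp (-t) := logistic_le_exp _
        _ ≤ _ := Real.exp_le_exp.2 (by
            have := mul_nonneg (abs_nonneg μ) hG0
            nlinarith)
  rw [abs_mul, abs_mul, abs_of_pos hp0, abs_of_nonneg (mul_nonneg hs0 (by linarith))]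
  calc _ ≤ 1 * |μ| * Real.exp (-(p * |μ| * G)) := by gcongr
    _ = _ := by ring

/-- If `0` lies outside of the band, the asymptotic mutual information is exponentially small in
`β` times the gap. -/
theorem exists_gap_bound (hb : 0 < b) (hα : 0 < α) (hab : 2 * b < |a|) : ∃ C : ℝ,
    ∀ β ℓ, 0 < β → IsWidomLimit a b α β ℓ →
      |ℓ| ≤ C * (β ^ 2 * Real.exp (-((|a| - 2 * b) * min α 1 * β))) := by
  obtain ⟨C, hC0, hC⟩ := exists_abs_entropyCurv_le hα
  set m := min α 1 with hm
  have hm0 : 0 < m := lt_min hα one_pos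
  have hm1 : m ≤ 1 := min_le_right _ _
  set G := |a| - 2 * b with hG
  have hG0 : 0 ≤ G := by linarith
  have hGx : ∀ x ∈ band a b, G ≤ |x| := by
    intro x hx
    have h1 : |a - x| ≤ 2 * b := abs_le.2 ⟨by linarith [hx.2], by linarith [hx.1]⟩
    have h2 := abs_sub_abs_le_abs_sub a x
    linarith
  set p := m / 2 with hp
  have hp0 : 0 < p := by positivity
  refine ⟨C / p ^ 2 * (4 * b ^ 2), fun β ℓ hβ hℓ => ?_⟩
  obtain ⟨h, hh, hhe, ht⟩ := hℓ
  set E := Real.exp (-(p * β * G)) with hE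
  have hEE : E ^ 2 = Real.exp (-(G * m * β)) := by
    rw [hE, ← Real.exp_nat_mul]
    congr 1
    rw [hp]
    push_cast
    ring
  have key := abs_limit_sub_le (c := 0) (C := C / p ^ 2 * (β ^ 2 * E ^ 2)) hb ht (by
    intro x hx y hy
    rw [zero_mul, sub_zero]
    have e : 2 * p - 2 = m - 2 := by rw [hp]; ring
    have hcurv : ∀ w ∈ Set.uIcc (logistic (-β * x)) (logistic (-β * y)),
        |h w| ≤ C * (w ^ (2 * p - 2) + (1 - w) ^ (2 * p - 2)) := fun w hw => by
      have hw' := mem_unit_of_mem_uIcc (logistic_mem _) (logistic_mem _) hw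
      rw [hhe x hx y hy w hw, e]
      exact hC w hw'.1 hw'.2
    have h1 := widomKernel_le_rpow hh (logistic_mem (-β * x)) (logistic_mem (-β * y)) hp0
      (by linarith) hC0 fun w hw => (abs_le.1 (hcurv w hw)).2
    have h2 := widomKernel_le_rpow (h := fun w => -1 * h w) (by fun_prop)
      (logistic_mem (-β * x)) (logistic_mem (-β * y)) hp0
      (by linarith) hC0 fun w hw => by linarith [(abs_le.1 (hcurv w hw)).1]
    rw [widomKernel_const_mul] at h2
    have h3 := abs_logistic_rpow_sub_le hp0 (by linarith) hGx hG0 (-β) hx hy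
    have h4 := abs_logistic_rpow_sub_le hp0 (by linarith) hGx hG0 β hx hy
    rw [abs_neg] at h3
    rw [abs_of_pos hβ, ← hE] at h3 h4
    have h5 := mul_self_le_of_abs_le h3
    have h6 := mul_self_le_of_abs_le h4
    have e' : ∀ z, -(-β * z) = β * z := fun z => by ring
    rw [one_sub_logistic, one_sub_logistic, e', e'] at h1 h2
    have h7 : (logistic (-β * x) ^ p - logistic (-β * y) ^ p) ^ 2
        + (logistic (β * x) ^ p - logistic (β * y) ^ p) ^ 2
        ≤ 2 * (β ^ 2 * E ^ 2 * ((x - y) * (x - y))) := by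
      rw [sq, sq (logistic (β * x) ^ p - _)]
      linarith
    have h8 := mul_le_mul_of_nonneg_left h7 (by positivity : 0 ≤ C / p ^ 2)
    rw [abs_le]
    constructor <;> linarith)
  rw [zero_mul, sub_zero, hEE] at key
  linarith

theorem tendsto_exp_mul_isWidomLimit (hb : 0 < b) {L : ℝ → ℝ}
    (hL : ∀ β, 0 < β → IsWidomLimit a b α β (L β)) (hα : 0 < α) (hab : 2 * b < |a|) {κ : ℝ}
    (hκ : κ < (|a| - 2 * b) * min α 1) :
    Tendsto (fun β => Real.exp (κ * β) * L β) atTop (𝓝 0) := by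
  obtain ⟨C, hC⟩ := exists_gap_bound hb hα hab
  set g := (|a| - 2 * b) * min α 1
  have h1 : Tendsto (fun β : ℝ => C * (β ^ (2 : ℝ) * Real.exp (-(g - κ) * β))) atTop (𝓝 (C * 0)) :=
    (tendsto_rpow_mul_exp_neg_mul_atTop_nhds_zero 2 (g - κ) (by linarith)).const_mul C
  rw [mul_zero] at h1
  refine squeeze_zero_norm' ?_ h1
  filter_upwards [eventually_gt_atTop 0] with β hβ
  have h2 := hC β (L β) hβ (hL β hβ)
  have e : -(g - κ) * β = κ * β + -(g * β) := by ring
  rw [Real.norm_eq_abs, abs_mul, Real.abs_exp, e, Real.exp_add, Real.rpow_two]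
  calc _ ≤ Real.exp (κ * β) * (C * (β ^ 2 * Real.exp (-(g * β)))) := by gcongr
    _ = _ := by ring

end LowTemperature

end FermiXX

end

open Filter Topology in
/-- There is a function `Iinf` of the inverse temperature, the asymptotic mutual information
`I_{α,∞}(A:B)`, which is the limit of `I_α(A:B)` as the number of sites tends to infinity (for
every ratio `q` of the bipartition), with the stated temperature dependence. -/
theorem theorem2 (a b α : ℝ) (hb : 0 < b) (hα : 0 < α) :
    ∃ Iinf : ℝ → ℝ,
      (∀ β : ℝ, 0 < β → ∀ q : ℝ, 0 < q → q < 1 →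
        Tendsto (fun N : ℕ => FermiXX.mutualInformationXX a b α β q N) atTop (𝓝 (Iinf β))) ∧
      Tendsto (fun β : ℝ => Iinf β / β ^ 2) (𝓝[>] 0) (𝓝 (α * b ^ 2 / (2 * Real.log 2))) ∧
      (|a| < 2 * b →
        limsup (fun β : ℝ => ((Iinf β / Real.log β : ℝ) : EReal)) atTop
          ≤ ((FermiXX.lowTemperatureConstant α : ℝ) : EReal)) ∧
      (2 * b < |a| →
        ∀ κ : ℝ, κ < (|a| - 2 * b) * min α 1 →
          Tendsto (fun β : ℝ => Real.exp (κ * β) * Iinf β) atTop (𝓝 0)) := by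
  have hlog2 : 0 < Real.log 2 := Real.log_pos (by norm_num)
  have hex : ∀ β : ℝ, ∃ ℓ : ℝ, 0 < β → FermiXX.IsWidomLimit a b α β ℓ ∧
      ∀ q : ℝ, 0 < q → q < 1 → Tendsto (fun N => FermiXX.mutualInformationXX a b α β q N) atTop
        (𝓝 (ℓ / Real.log 2)) := fun β => by
    by_cases hβ : 0 < β
    · obtain ⟨ℓ, hℓ⟩ := FermiXX.exists_isWidomLimit (a := a) hb α hβ
      exact ⟨ℓ, fun _ => hℓ⟩
    · exact ⟨0, fun h => absurd h hβ⟩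
  choose L hL using hex
  have hW : ∀ β, 0 < β → FermiXX.IsWidomLimit a b α β (L β) := fun β hβ => (hL β hβ).1
  refine ⟨fun β => L β / Real.log 2, fun β hβ => (hL β hβ).2, ?_,
    fun _ => FermiXX.limsup_isWidomLimit_le hb hW hα, fun hab κ hκ => ?_⟩
  · have h := (FermiXX.tendsto_isWidomLimit_div_sq hb hW hα).div_const (Real.log 2)
    convert h using 2
    · ring
    · field_simp
  · have h := (FermiXX.tendsto_exp_mul_isWidomLimit hb hW hα hab hκ).div_const (Real.log 2)
    rw [zero_div] at h
    refine h.congr fun β => ?_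
    ring
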